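/- **Theorem (strong factorization of Jack polynomials).** A partition is a weakly decreasing sequence $\lambda=(\lambda_1\ge\lambda_2\ge\cdots)$ of nonnegative integers with finitely many nonzero terms; $|\lambda|=\sum_i\lambda_i$, $\ell(\lambda)$ is the number of nonzero terms, $\lambda^t$ is the conjugate partition, and $b(\lambda)=\sum_i\binom{\lambda_i}{2}$. Write $<$ for the strict dominance order on partitions of the same size and $m_\nu$ for the monomial symmetric functions. Let $$\mathrm{hook}_\alpha(\lambda)=\prod_{\square\in\lambda}\bigl(\alpha\,a(\square)+\ell(\square)+1\bigr),$$ where $a(\square)$ and $\ell(\square)$ are the arm- and leg-length of the box $\square$ of the Young diagram of $\lambda$. The Jack symmetric function $J^{(\alpha)}_\lambda$ is the unique symmetric function over $\mathbb{Q}(\alpha)$ such that for every $N\ge\ell(\lambda)$ its restriction to $N$ variables has the form $$J^{(\alpha)}_\lambda=\mathrm{hook}_\alpha(\lambda)\,m_\lambda+\sum_{\nu<\lambda}a^\lambda_\nu m_\nu,\qquad a^\lambda_\nu\in\mathbb{Q}(\alpha),$$ and is an eigenvector of the Laplace--Beltrami operator $$D_\alpha=\sum_{i\le N}\sum_{j\ne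 i}\frac{x_i^2}{x_i-x_j}\frac{\partial}{\partial x_i}+\frac{\alpha}{2}\sum_{i\le N}x_i^2\frac{\partial^2}{\partial x_i^2}$$ with eigenvalue $\alpha\, b(\lambda)-b(\lambda^t)+(N-1)|\lambda|$. The restriction $J^{(\alpha)}_\lambda(x_1,\dots,x_N)$ is the Jack polynomial in $N$ variables. Let $r\ge 0$ and let $\lambda^1,\dots,\lambda^r$ be partitions. For $I\subseteq[r]=\{1,\dots,r\}$ let $\lambda^I=\bigoplus_{i\in I}\lambda^i$ be the entry-wise sum. Then $$\prod_{I\subseteq[r]}\bigl(J^{(\alpha)}_{\lambda^I}\bigr)^{(-1)^{|I|}}=1+O(\alpha^{r-1})\qquad(\alpha\to0).$$ Here the product is taken in $R(\alpha)$, where $R$ is the field of fractions of the ring of symmetric functions over $\mathbb{Q}$, and for $f\in R(\alpha)$ and $k\in\mathbb{Z}$, $f=O(\alpha^k)$ means that the rational function $f\cdot\alpha^{-k}$ of $\alpha$ has no pole at $0$. The same holds for the Jack polynomials $J^{(\alpha)}_{\lambda^I}(x_1,\dots,x_N)$ in any finite number $N\ge\max_i\ell(\lambda^i)$ of variables, with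 $R=\mathbb{Q}(x_1,\dots,x_N)$. -/

import Mathlib

noncomputable section

namespace Jack

/-- The weakly decreasing, finitely supported sequences of natural numbers, under entry-wise
addition. -/
def partitionMonoid : AddSubmonoid (ℕ →₀ ℕ) where
  carrier := {f | Antitone f}
  zero_mem' := fun _ _ _ => le_rfl
  add_mem' := fun hf hg _ _ h => add_le_add (hf h) (hg h)

/-- Integer partitions, as weakly decreasing, finitely supported sequences of natural numbers
`lam 0 ≥ lam 1 ≥ …` (the sequence of parts, completed by zeros; the part usually written
`lam_{i+1}` is `lam.1 i`). Addition is the entry-wise sum of partitions, and `0` is the empty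
partition. -/
abbrev IntPartition : Type := partitionMonoid

namespace IntPartition

/-- The size `|lam|`. -/
def size (lam : IntPartition) : ℕ := lam.1.sum fun _ k => k

/-- The length, i.e. the number of nonzero parts. -/
def length (lam : IntPartition) : ℕ := lam.1.support.card

/-- The conjugate partition: its part number `j` (counted from `0`) is the number of `i` with
`lam i ≥ j + 1`. -/
def conj (lam : IntPartition) : IntPartition :=
  ⟨Finsupp.onFinset (Finset.range (lam.1 0))
      (fun j => (lam.1.support.filter fun i => j < lam.1 i).card)
      (by
        intro j hj
        obtain ⟨i, hi⟩ := Finset.card_pos.1 (Nat.pos_of_ne_zero hj)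
        exact Finset.mem_range.2
          (lt_of_lt_of_le (Finset.mem_filter.1 hi).2 (lam.2 (Nat.zero_le i)))),
    by
      intro j k hjk
      exact Finset.card_le_card fun i hi =>
        Finset.mem_filter.2 ⟨(Finset.mem_filter.1 hi).1,
          lt_of_le_of_lt hjk (Finset.mem_filter.1 hi).2⟩⟩

/-- The boxes of the Young diagram, as pairs (row, column) counted from `0`. -/
def boxes (lam : IntPartition) : Finset (Σ _ : ℕ, ℕ) :=
  lam.1.support.sigma fun i => Finset.range (lam.1 i)

/-- The arm-length of a box of the Young diagram. -/
def arm (lam : IntPartition) (s : Σ _ : ℕ, ℕ) : ℕ := lam.1 s.1 - (s.2 + 1)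

/-- The leg-length of a box of the Young diagram. -/
def leg (lam : IntPartition) (s : Σ _ : ℕ, ℕ) : ℕ := lam.conj.1 s.2 - (s.1 + 1)

/-- `b(lam) = ∑ i, binomial (lam i) 2`. -/
def b (lam : IntPartition) : ℕ := lam.1.sum fun _ k => k.choose 2

/-- The dominance order `nu ≤ lam` on partitions of the same size. -/
def DominatedBy (nu lam : IntPartition) : Prop :=
  nu.size = lam.size ∧
    ∀ k : ℕ, ∑ i ∈ Finset.range k, nu.1 i ≤ ∑ i ∈ Finset.range k, lam.1 i

end IntPartition

open IntPartition

/-- The multiset of nonzero values of a finitely supported function: for a partition, its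
multiset of parts; for the exponent of a monomial, its multiset of nonzero exponents. -/
def parts {ι : Type*} (e : ι →₀ ℕ) : Multiset ℕ := e.support.val.map e

/-- The field `ℚ(α)`; the Jack parameter `α` is `RatFunc.X`. -/
abbrev QAlpha : Type := RatFunc ℚ

/-- The hook polynomial `∏ (α * arm + leg + 1)`, the product being over the boxes of `lam`. -/
def hook (lam : IntPartition) : QAlpha :=
  ∏ s ∈ lam.boxes, (RatFunc.X * (lam.arm s : QAlpha) + (lam.leg s : QAlpha) + 1)

/-- The eigenvalue `α * b(lam) - b(conj lam) + (N - 1) * |lam|`. -/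
def eigenvalue (N : ℕ) (lam : IntPartition) : QAlpha :=
  RatFunc.X * (lam.b : QAlpha) - (lam.conj.b : QAlpha) + ((N : QAlpha) - 1) * (lam.size : QAlpha)

/-- The monomial symmetric polynomial `m_nu(x_1, …, x_N)`: the sum of all distinct monomials whose
nonzero exponents are, up to order, the parts of `nu`. (It is `0` if `nu` has length `> N`.) -/
def monomialPoly (N : ℕ) (K : Type*) [CommSemiring K] (nu : IntPartition) :
    MvPolynomial (Fin N) K :=
  ∑ e ∈ (Finset.finsuppAntidiag (Finset.univ : Finset (Fin N)) nu.size).filter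
      (fun e => parts e = parts nu.1),
    MvPolynomial.monomial e 1

/-- The Laplace–Beltrami operator in `N` variables over `ℚ(α)`,
`∑ i, ∑ j ≠ i, x_i ^ 2 / (x_i - x_j) * ∂_i + (α / 2) * ∑ i, x_i ^ 2 * ∂_i ^ 2`,
with values in the field of rational functions in `x_1, …, x_N`. -/
def laplaceBeltrami (N : ℕ) (f : MvPolynomial (Fin N) QAlpha) :
    FractionRing (MvPolynomial (Fin N) QAlpha) :=
  let ι := algebraMap (MvPolynomial (Fin N) QAlpha) (FractionRing (MvPolynomial (Fin N) QAlpha))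
  (∑ i : Fin N, ∑ j ∈ Finset.univ.erase i,
      ι (MvPolynomial.X i) ^ 2 / (ι (MvPolynomial.X i) - ι (MvPolynomial.X j)) *
        ι (MvPolynomial.pderiv i f)) +
    ι (MvPolynomial.C (RatFunc.X / 2) *
      ∑ i : Fin N, MvPolynomial.X i ^ 2 * MvPolynomial.pderiv i (MvPolynomial.pderiv i f))

/-- The two conditions that characterize the Jack polynomial `J_lam` in `N ≥ length lam` variables:
it is an eigenvector of the Laplace–Beltrami operator with the prescribed eigenvalue, and
it has the form `hook lam * m_lam + ∑_{nu < lam} a nu * m_nu` with `a nu` in `ℚ(α)`, where `<` is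
the strict dominance order. (The second condition implies that `f` is symmetric.) -/
def IsJackPoly (N : ℕ) (lam : IntPartition) (f : MvPolynomial (Fin N) QAlpha) : Prop :=
  laplaceBeltrami N f = algebraMap _ _ (MvPolynomial.C (eigenvalue N lam) * f) ∧
  ∃ a : IntPartition →₀ QAlpha,
    (∀ nu ∈ a.support, DominatedBy nu lam ∧ nu ≠ lam) ∧
    f = MvPolynomial.C (hook lam) * monomialPoly N QAlpha lam +
      a.sum fun nu c => MvPolynomial.C c * monomialPoly N QAlpha nu

/-- `a` is the family of coefficients, in the basis of monomial symmetric functions, of the Jack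
symmetric function `J_lam`: its restriction to any number `N ≥ length lam` of variables is the Jack
polynomial `J_lam(x_1, …, x_N)`. -/
def IsJackExpansion (lam : IntPartition) (a : IntPartition →₀ QAlpha) : Prop :=
  ∀ N : ℕ, lam.length ≤ N →
    IsJackPoly N lam (a.sum fun nu c => MvPolynomial.C c * monomialPoly N QAlpha nu)

open Classical in
/-- The coefficients of the Jack symmetric function `J_lam` in the basis of monomial symmetric
functions. (There is exactly one such family; the `else` branch never occurs.) -/
def jackCoeff (lam : IntPartition) : IntPartition →₀ QAlpha :=
  if h : ∃ a, IsJackExpansion lam a then h.choose else 0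

/-- The field homomorphism `ℚ(α) → R(α)` that fixes `α`, for a field `R` that contains `ℚ`. -/
def extendScalars (R : Type*) [Field R] [Algebra ℚ R] : QAlpha →+* RatFunc R :=
  RatFunc.mapRingHom (Polynomial.mapRingHom (algebraMap ℚ R))
    (nonZeroDivisors_le_comap_nonZeroDivisors_of_injective _
      (Polynomial.map_injective _ (algebraMap ℚ R).injective))

/-- The element `∑ nu, (coefficient of m_nu in J_lam) * m_nu` of `R(α)`, where the field `R ⊇ ℚ`
contains the monomial symmetric functions `m nu` (in some alphabet). -/
def jackIn {R : Type*} [Field R] [Algebra ℚ R] (m : IntPartition → R) (lam : IntPartition) :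
    RatFunc R :=
  (jackCoeff lam).sum fun nu c => extendScalars R c * RatFunc.C (m nu)

/-- The Jack polynomial `J_lam(x_1, …, x_N)` as an element of `R(α)`, where `R` is the field
`ℚ(x_1, …, x_N)`. -/
def jackPoly (N : ℕ) (lam : IntPartition) :
    RatFunc (FractionRing (MvPolynomial (Fin N) ℚ)) :=
  jackIn (fun nu => algebraMap (MvPolynomial (Fin N) ℚ) _ (monomialPoly N ℚ nu)) lam

/-- The ring of symmetric functions over `ℚ`: the formal power series in infinitely many variables
`x_0, x_1, …` that have bounded degree and are invariant under all permutations of the variables. -/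
def SymmFun : Subalgebra ℚ (MvPowerSeries ℕ ℚ) where
  carrier := {f | (∃ d : ℕ, ∀ e : ℕ →₀ ℕ, MvPowerSeries.coeff e f ≠ 0 → e.degree ≤ d) ∧
    ∀ σ : Equiv.Perm ℕ, MvPowerSeries.renameEquiv ℚ σ f = f}
  mul_mem' := by
    rintro f g ⟨⟨d, hd⟩, hf⟩ ⟨⟨d', hd'⟩, hg⟩
    refine ⟨⟨d + d', fun e he => ?_⟩, fun σ => by rw [map_mul, hf, hg]⟩
    rw [MvPowerSeries.coeff_mul] at he
    obtain ⟨p, hp, hne⟩ := Finset.exists_ne_zero_of_sum_ne_zero he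
    rw [← Finset.HasAntidiagonal.mem_antidiagonal.1 hp, map_add]
    exact add_le_add (hd _ (left_ne_zero_of_mul hne)) (hd' _ (right_ne_zero_of_mul hne))
  add_mem' := by
    rintro f g ⟨⟨d, hd⟩, hf⟩ ⟨⟨d', hd'⟩, hg⟩
    refine ⟨⟨max d d', fun e he => ?_⟩, fun σ => by rw [map_add, hf, hg]⟩
    by_cases h : MvPowerSeries.coeff e f = 0
    · refine (hd' e fun h' => he ?_).trans (le_max_right _ _)
      rw [map_add, h, h', add_zero]
    · exact (hd e h).trans (le_max_left _ _)
  algebraMap_mem' := by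
    classical
    intro q
    refine ⟨⟨0, fun e he => ?_⟩, fun σ => AlgEquiv.commutes _ q⟩
    by_contra h
    refine he ?_
    rw [MvPowerSeries.algebraMap_apply, MvPowerSeries.coeff_C, if_neg]
    rintro rfl
    exact h (by simp)

open Classical in
/-- The power series `m_nu(x_0, x_1, …)`: the sum of all monomials whose nonzero exponents are, up
to order, the parts of `nu`. -/
def monomialSeries (nu : IntPartition) : MvPowerSeries ℕ ℚ :=
  fun e => if parts e = parts nu.1 then 1 else 0

theorem coeff_monomialSeries (nu : IntPartition) (e : ℕ →₀ ℕ) [Decidable (parts e = parts nu.1)] :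
    MvPowerSeries.coeff e (monomialSeries nu) = if parts e = parts nu.1 then 1 else 0 := by
  rw [MvPowerSeries.coeff_apply, monomialSeries]
  congr

theorem sum_parts {ι : Type*} (e : ι →₀ ℕ) : (parts e).sum = e.degree := rfl

theorem parts_embDomain {ι κ : Type*} (g : ι ↪ κ) (e : ι →₀ ℕ) :
    parts (e.embDomain g) = parts e := by
  simp [parts, Finsupp.support_embDomain, Finset.map_val, Multiset.map_map]

theorem monomialSeries_mem (nu : IntPartition) : monomialSeries nu ∈ SymmFun := by
  classical
  refine ⟨⟨nu.1.degree, fun e he => ?_⟩, fun σ => ?_⟩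
  · rw [coeff_monomialSeries] at he
    have h : parts e = parts nu.1 := by
      by_contra h
      exact he (if_neg h)
    rw [← sum_parts, h, sum_parts]
  · ext e
    obtain ⟨e', rfl⟩ : ∃ e', Finsupp.embDomain σ.toEmbedding e' = e :=
      ⟨Finsupp.embDomain σ.symm.toEmbedding e, by
        ext i
        simp [Finsupp.embDomain_eq_mapDomain, ← Finsupp.mapDomain_comp]⟩
    have h := MvPowerSeries.coeff_embDomain_rename σ.toEmbedding (monomialSeries nu) e'
    rw [coeff_monomialSeries, parts_embDomain, ← coeff_monomialSeries]
    exact h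

/-- The monomial symmetric function `m_nu(x_0, x_1, …)`. -/
def monomialSymm (nu : IntPartition) : SymmFun := ⟨monomialSeries nu, monomialSeries_mem nu⟩

/-- The Jack symmetric function `J_lam` as an element of `R(α)`, where `R` is the field of fractions
of the ring of symmetric functions over `ℚ`. -/
def jackSymm (lam : IntPartition) : RatFunc (FractionRing SymmFun) :=
  jackIn (fun nu => algebraMap SymmFun _ (monomialSymm nu)) lam

/-- For `f` in `R(α)` and an integer `k`: `f = O(α ^ k)`, i.e. the rational function
`f * α ^ (-k)` has no pole at `0`. -/
def IsBigO {R : Type*} [Field R] (f : RatFunc R) (k : ℤ) : Prop :=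
  (f * RatFunc.X ^ (-k)).denom.eval 0 ≠ 0

end Jack

end

/-!
The proof is by induction on a set `S` of indices. Each `J_I`, the Jack polynomial of the sum of
the `lam i` with `i ∈ I`, satisfies `D J_I = E_I J_I`, where `D` is the Laplace–Beltrami operator;
dividing by `J_I` turns this into a Riccati equation for the logarithmic derivatives of `J_I`. Take
its alternating sum over `I ⊆ S`: that of the eigenvalues `E_I` is `O(α ^ (|S| - 1))`, and if the
alternating product of the `J_I` is already known to be `1` modulo `α ^ m` with `m < |S| - 1`, then
the factorization for the proper subsets of `S` makes the quadratic terms cancel modulo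
`α ^ (m + 1)`, so that the first-order part of `D` annihilates the alternating product to that
order. Hence the coefficient of `α ^ m` in the difference of the products of the `J_I` with `|I|`
even and with `|I|` odd is a symmetric polynomial which is an eigenvector of the first-order part
of `D` at `α = 0`, for the eigenvalue of a partition `μ`. As the hook products themselves factorize,
this polynomial involves only exponents strictly dominated by `μ`. The eigenvalues `-b(λᵗ)` at
`α = 0` are strictly monotone for the dominance order, so the polynomial vanishes and `m` can be
increased. A symmetric function is determined by its restrictions to finitely many variables, which
reduces the statement for symmetric functions to the one for polynomials.
-/

namespace Jack

open Finset MvPolynomial IntPartition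

section AlternatingSums

variable {ι κ M G O : Type*}

/-- The alternating product `∏ u I ^ (-1) ^ |I|` over the subsets `I` of `S`; its additive version
`altSum` is the alternating sum `∑ (-1) ^ |I| • a I`. -/
@[to_additive]
def altProd [CommGroup G] (S : Finset ι) (u : Finset ι → G) : G :=
  ∏ I ∈ S.powerset, u I ^ ((-1 : ℤ) ^ #I)

@[to_additive]
theorem altProd_congr [CommGroup G] {S : Finset ι} {u v : Finset ι → G} (h : ∀ I ⊆ S, u I = v I) :
    altProd S u = altProd S v :=
  prod_congr rfl fun I hI => by rw [h I (mem_powerset.1 hI)]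

@[to_additive]
theorem altProd_mul [CommGroup G] (S : Finset ι) (u v : Finset ι → G) :
    altProd S (fun I => u I * v I) = altProd S u * altProd S v := by
  simp only [altProd, mul_zpow, prod_mul_distrib]

theorem altProd_div [CommGroup G] (S : Finset ι) (u v : Finset ι → G) :
    altProd S (fun I => u I / v I) = altProd S u / altProd S v := by
  simp only [altProd, div_zpow, prod_div_distrib]

@[to_additive]
theorem altProd_prod [CommGroup G] (S : Finset ι) (s : Finset κ) (u : κ → Finset ι → G) :
    altProd S (fun I => ∏ k ∈ s, u k I) = ∏ k ∈ s, altProd S (u k) := by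
  simp only [altProd, ← prod_zpow]
  exact prod_comm

@[to_additive]
theorem map_altProd {H F : Type*} [CommGroup G] [CommGroup H] [FunLike F G H]
    [MonoidHomClass F G H] (f : F) (S : Finset ι) (u : Finset ι → G) :
    f (altProd S u) = altProd S fun I => f (u I) := by
  simp only [altProd, map_prod, map_zpow]

theorem altSum_const_mul [CommRing O] (S : Finset ι) (c : O) (a : Finset ι → O) :
    altSum S (fun I => c * a I) = c * altSum S a :=
  (map_altSum (AddMonoidHom.mulLeft c) S a).symm

theorem altProd_insert [DecidableEq ι] [CommGroup G] {s : ι} {S : Finset ι} (hs : s ∉ S)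
    (u : Finset ι → G) :
    altProd (insert s S) u = altProd S u / altProd S fun I => u (insert s I) := by
  rw [altProd, prod_powerset_insert hs, altProd, altProd, div_eq_mul_inv, ← prod_inv_distrib]
  congr 1
  refine prod_congr rfl fun I hI => ?_
  rw [card_insert_of_notMem fun h => hs (mem_powerset.1 hI h), pow_succ, mul_neg_one, zpow_neg]

theorem sum_Icc_neg_one_pow_card [DecidableEq ι] {A S : Finset ι} (h : A ⊆ S) :
    ∑ I ∈ Icc A S, (-1 : ℤ) ^ #I = if A = S then (-1) ^ #S else 0 := by
  have disjoint_of_subset {B : Finset ι} (hB : B ∈ (S \ A).powerset) : Disjoint A B :=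
    disjoint_sdiff.mono_right (mem_powerset.1 hB)
  have injOn_union : Set.InjOn (A ∪ ·) (S \ A).powerset := fun B hB C hC hBC => by
    rw [← union_sdiff_cancel_left (disjoint_of_subset hB),
      ← union_sdiff_cancel_left (disjoint_of_subset hC)]
    exact congrArg (· \ A) hBC
  calc ∑ I ∈ Icc A S, (-1 : ℤ) ^ #I
      = ∑ B ∈ (S \ A).powerset, (-1) ^ #A * (-1 : ℤ) ^ #B := by
        rw [Icc_eq_image_powerset h, sum_image injOn_union]
        exact sum_congr rfl fun B hB => by
          rw [card_union_of_disjoint (disjoint_of_subset hB), pow_add]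
    _ = if A = S then (-1) ^ #S else 0 := by
        have hempty : S \ A = ∅ ↔ A = S :=
          sdiff_eq_empty_iff_subset.trans ⟨h.antisymm, fun hAS => hAS.ge⟩
        rw [← mul_sum, sum_powerset_neg_one_pow_card, mul_ite, mul_one, mul_zero]
        split_ifs <;> simp_all

theorem altSum_sum_of_subset [DecidableEq ι] [AddCommGroup M] (S : Finset ι) (s : Finset κ)
    (A : κ → Finset ι) (hA : ∀ k ∈ s, A k ⊆ S) (f : κ → M) :
    altSum S (fun I => ∑ k ∈ s with A k ⊆ I, f k) =
      ∑ k ∈ s with A k = S, (-1 : ℤ) ^ #S • f k := by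
  simp only [sum_filter]
  rw [altSum_sum]
  refine sum_congr rfl fun k hk => ?_
  calc altSum S (fun I => if A k ⊆ I then f k else 0)
      = (∑ I ∈ Icc (A k) S, (-1 : ℤ) ^ #I) • f k := by
        simp only [altSum, Icc_eq_filter_powerset, sum_filter, sum_smul, smul_ite, ite_smul,
          smul_zero, zero_smul]
    _ = if A k = S then (-1 : ℤ) ^ #S • f k else 0 := by
        rw [sum_Icc_neg_one_pow_card (hA k hk), ite_smul, zero_smul]

theorem altSum_altSum [AddCommGroup M] (I : Finset ι) (a : Finset ι → M) :
    altSum I (fun A => altSum A a) = a I := by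
  classical
  have filter_subset {A : Finset ι} (hA : A ⊆ I) : {B ∈ I.powerset | B ⊆ A} = A.powerset := by
    ext B
    simpa using fun hB : B ⊆ A => hB.trans hA
  calc altSum I (fun A => altSum A a)
      = altSum I (fun A => ∑ B ∈ I.powerset with B ⊆ A, (-1 : ℤ) ^ #B • a B) :=
        altSum_congr fun A hA => by rw [filter_subset hA, altSum]
    _ = ∑ B ∈ I.powerset with B = I, (-1 : ℤ) ^ #I • (-1 : ℤ) ^ #B • a B :=
        altSum_sum_of_subset I _ (fun B => B) (fun B => mem_powerset.1) _
    _ = a I := by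
        rw [filter_eq', if_pos (mem_powerset_self I), sum_singleton, smul_smul,
          ← mul_pow, neg_one_mul, neg_neg, one_pow, one_smul]

theorem altSum_mul [DecidableEq ι] [CommRing O] (S : Finset ι) (a b : Finset ι → O) :
    altSum S (fun I => a I * b I) =
      ∑ p ∈ S.powerset ×ˢ S.powerset with p.1 ∪ p.2 = S,
        (-1 : ℤ) ^ #S • (((-1 : ℤ) ^ #p.1 • altSum p.1 a) *
          ((-1 : ℤ) ^ #p.2 • altSum p.2 b)) := by
  have pairs_subset {I : Finset ι} (hI : I ⊆ S) :
      {p ∈ S.powerset ×ˢ S.powerset | p.1 ∪ p.2 ⊆ I} = I.powerset ×ˢ I.powerset := by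
    ext p
    simp only [mem_product, mem_powerset, mem_filter, union_subset_iff]
    exact ⟨fun h => h.2, fun h => ⟨⟨h.1.trans hI, h.2.trans hI⟩, h⟩⟩
  refine Eq.trans ?_ (altSum_sum_of_subset S (S.powerset ×ˢ S.powerset) (fun p => p.1 ∪ p.2) ?_
    fun p => ((-1 : ℤ) ^ #p.1 • altSum p.1 a) * ((-1 : ℤ) ^ #p.2 • altSum p.2 b))
  · refine altSum_congr fun I hI => ?_
    rw [pairs_subset hI, sum_product]
    dsimp only
    rw [← sum_mul_sum]
    exact congrArg₂ (· * ·) (altSum_altSum I a).symm (altSum_altSum I b).symm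
  · intro p hp
    obtain ⟨h₁, h₂⟩ := mem_product.1 hp
    exact union_subset (mem_powerset.1 h₁) (mem_powerset.1 h₂)

theorem pow_dvd_altSum_mul [CommRing O] {α : O} {S : Finset ι} {a b : Finset ι → O} {m : ℕ}
    (hm : m < #S - 1) (ha : α ^ m ∣ altSum S a) (hb : α ^ m ∣ altSum S b)
    (ha_lt : ∀ T ⊂ S, T.Nonempty → α ^ (#T - 1) ∣ altSum T a)
    (hb_lt : ∀ T ⊂ S, T.Nonempty → α ^ (#T - 1) ∣ altSum T b) :
    α ^ m ∣ altSum S fun I => a I * b I := by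
  classical
  rw [altSum_mul]
  refine dvd_sum fun ⟨A, B⟩ hAB => dvd_smul_of_dvd _ ?_
  simp only [mem_filter, mem_product, mem_powerset] at hAB
  obtain ⟨⟨hA, hB⟩, hunion⟩ := hAB
  rcases eq_or_ne A S with rfl | hAS
  · exact (dvd_smul_of_dvd _ ha).mul_right _
  rcases eq_or_ne B S with rfl | hBS
  · exact (dvd_smul_of_dvd _ hb).mul_left _
  have hA_ne : A.Nonempty := nonempty_iff_ne_empty.2 fun h => hBS <| by
    rwa [h, empty_union] at hunion
  have hB_ne : B.Nonempty := nonempty_iff_ne_empty.2 fun h => hAS <| by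
    rwa [h, union_empty] at hunion
  have hcard : m ≤ (#A - 1) + (#B - 1) := by
    have := card_union_le A B
    have := hA_ne.card_pos
    have := hB_ne.card_pos
    rw [hunion] at *
    omega
  calc α ^ m ∣ α ^ (#A - 1) * α ^ (#B - 1) := pow_add α _ _ ▸ pow_dvd_pow α hcard
    _ ∣ _ := mul_dvd_mul (dvd_smul_of_dvd _ (ha_lt A (hA.ssubset_of_ne hAS) hA_ne))
      (dvd_smul_of_dvd _ (hb_lt B (hB.ssubset_of_ne hBS) hB_ne))

end AlternatingSums

section LogarithmicDerivative

variable {ι k O : Type*} [CommRing k] [CommRing O] [Algebra k O]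

/-- The logarithmic derivative `D u / u` of a unit `u`. -/
def dlog (D : Derivation k O O) : Additive Oˣ →+ O where
  toFun u := D (u.toMul : O) * ((u.toMul⁻¹ : Oˣ) : O)
  map_zero' := by simp
  map_add' u v := by
    simp only [toMul_add, Units.val_mul, mul_inv, Derivation.leibniz, smul_eq_mul]
    have hu := u.toMul.mul_inv
    have hv := v.toMul.mul_inv
    linear_combination (D (v.toMul : O) * ((v.toMul⁻¹ : Oˣ) : O)) * hu +
      (D (u.toMul : O) * ((u.toMul⁻¹ : Oˣ) : O)) * hv

theorem derivation_eq_mul_dlog (D : Derivation k O O) (u : Oˣ) :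
    D (u : O) = u * dlog D (Additive.ofMul u) := by
  rw [mul_comm]
  exact (Units.inv_mul_cancel_right _ u).symm

theorem derivation_derivation_eq_mul_dlog (D : Derivation k O O) (u : Oˣ) :
    D (D (u : O)) = u * (D (dlog D (Additive.ofMul u)) +
      dlog D (Additive.ofMul u) * dlog D (Additive.ofMul u)) := by
  rw [derivation_eq_mul_dlog, Derivation.leibniz, derivation_eq_mul_dlog, smul_eq_mul, smul_eq_mul]
  ring

theorem dlog_altProd (D : Derivation k O O) (S : Finset ι) (u : Finset ι → Oˣ) :
    dlog D (Additive.ofMul (altProd S u)) = altSum S fun I => dlog D (Additive.ofMul (u I)) := by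
  simp only [altProd, altSum, ofMul_prod, ofMul_zpow, map_sum, map_zsmul]

theorem pow_dvd_derivation (D : Derivation k O O) {α : O} (hα : D α = 0) {n : ℕ} {x : O}
    (hx : α ^ n ∣ x) : α ^ n ∣ D x := by
  obtain ⟨y, rfl⟩ := hx
  exact ⟨D y, by simp [Derivation.leibniz_pow, hα]⟩

theorem pow_dvd_dlog (D : Derivation k O O) {α : O} (hα : D α = 0) {n : ℕ} {u : Oˣ}
    (hu : α ^ n ∣ (u : O) - 1) : α ^ n ∣ dlog D (Additive.ofMul u) := by
  have := pow_dvd_derivation D hα hu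
  rw [map_sub, Derivation.map_one_eq_zero, sub_zero] at this
  exact this.mul_right _

variable {κ : Type*} [Fintype κ]

theorem riccati_of_sum_derivation_eq (D : κ → Derivation k O O) (α : O) (w y : κ → O) {u : Oˣ}
    {c : O} (h : ∑ i, w i * D i u + α * ∑ i, y i * D i (D i u) = c * u) :
    ∑ i, w i * dlog (D i) (Additive.ofMul u) +
      α * ∑ i, y i * (D i (dlog (D i) (Additive.ofMul u)) +
        dlog (D i) (Additive.ofMul u) * dlog (D i) (Additive.ofMul u)) = c := by
  simp_rw [derivation_derivation_eq_mul_dlog, derivation_eq_mul_dlog _ u,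
    mul_left_comm _ (u : O), ← mul_sum, mul_left_comm _ (u : O), ← mul_add, mul_comm c] at h
  exact u.isUnit.mul_left_cancel h

/-- The nonlinear term of the Riccati equation only sees smaller subsets and powers of `α`, so the
alternating product gains one power of `α` under the first-order part of the operator. -/
theorem pow_succ_dvd_sum_derivation_altProd {α : O} {D : κ → Derivation k O O}
    (hα : ∀ i, D i α = 0) (w y : κ → O) {u : Finset ι → Oˣ} {E : Finset ι → O} {S : Finset ι}
    (heq : ∀ I ⊆ S, ∑ i, w i * D i (u I) + α * ∑ i, y i * D i (D i (u I)) = E I * u I)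
    (hE : α ^ (#S - 1) ∣ altSum S E)
    (ih : ∀ T ⊂ S, T.Nonempty → α ^ (#T - 1) ∣ ((altProd T u : Oˣ) : O) - 1)
    {m : ℕ} (hm : m < #S - 1) (hS : α ^ m ∣ ((altProd S u : Oˣ) : O) - 1) :
    α ^ (m + 1) ∣ ∑ i, w i * D i (altProd S u : Oˣ) := by
  classical
  set ψ : κ → Finset ι → O := fun i I => dlog (D i) (Additive.ofMul (u I))
  have dlog_eq (i : κ) (T : Finset ι) :
      dlog (D i) (Additive.ofMul (altProd T u)) = altSum T (ψ i) := dlog_altProd _ _ _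
  have hψS (i : κ) : α ^ m ∣ altSum S (ψ i) := dlog_eq i S ▸ pow_dvd_dlog _ (hα i) hS
  have hψ_lt (i : κ) (T : Finset ι) (hT : T ⊂ S) (hne : T.Nonempty) :
      α ^ (#T - 1) ∣ altSum T (ψ i) := dlog_eq i T ▸ pow_dvd_dlog _ (hα i) (ih T hT hne)
  have altSum_riccati : ∑ i, w i * altSum S (ψ i) +
      α * ∑ i, y i * (D i (altSum S (ψ i)) + altSum S fun I => ψ i I * ψ i I) = altSum S E := by
    rw [← altSum_congr fun I hI => riccati_of_sum_derivation_eq D α w y (heq I hI)]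
    simp_rw [altSum_add, altSum_const_mul, altSum_sum, altSum_const_mul, altSum_add, map_altSum]
    rfl
  have first_order : α ^ (m + 1) ∣ ∑ i, w i * altSum S (ψ i) := by
    rw [eq_sub_of_add_eq altSum_riccati, pow_succ']
    refine dvd_sub ((pow_succ' α m ▸ pow_dvd_pow α hm).trans hE) (mul_dvd_mul_left α ?_)
    exact dvd_sum fun i _ => Dvd.dvd.mul_left
      ((pow_dvd_derivation _ (hα i) (hψS i)).add
        (pow_dvd_altSum_mul hm (hψS i) (hψS i) (hψ_lt i) (hψ_lt i))) _
  simp_rw [derivation_eq_mul_dlog, dlog_eq, mul_left_comm _ ((altProd S u : Oˣ) : O), ← mul_sum]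
  exact first_order.mul_left _

end LogarithmicDerivative

section Partitions

theorem eq_range_card_of_isLowerSet {s : Finset ℕ} (h : IsLowerSet (s : Set ℕ)) : s = range #s := by
  refine eq_of_subset_of_card_le (fun i hi => ?_) (card_range _).le
  have hsub : range (i + 1) ⊆ s := fun j hj => h (Nat.lt_succ_iff.1 (mem_range.1 hj)) hi
  have := card_le_card hsub
  rw [card_range] at this
  exact mem_range.2 this

namespace IntPartition

variable {lam nu : IntPartition} {N : ℕ}

theorem filter_lt_eq_range_conj (lam : IntPartition) (j : ℕ) :
    {i ∈ lam.1.support | j < lam.1 i} = range (lam.conj.1 j) := by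
  refine eq_range_card_of_isLowerSet fun i k hki hi => ?_
  have : lam.1 i ≤ lam.1 k := lam.2 hki
  simp only [coe_filter, Finsupp.mem_support_iff, Set.mem_ofPred_eq] at hi ⊢
  omega

theorem lt_conj_apply_iff {i j : ℕ} : i < lam.conj.1 j ↔ j < lam.1 i := by
  rw [← mem_range, ← filter_lt_eq_range_conj, mem_filter, Finsupp.mem_support_iff]
  omega

theorem conj_apply_eq_of_le_of_lt {t j : ℕ} (h₁ : lam.1 (t + 1) ≤ j) (h₂ : j < lam.1 t) :
    lam.conj.1 j = t + 1 := by
  have := lt_conj_apply_iff.2 h₂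
  have := (lt_conj_apply_iff (i := t + 1)).not.2 h₁.not_gt
  omega

theorem conj_apply_eq_countP_parts (lam : IntPartition) (j : ℕ) :
    lam.conj.1 j = (parts lam.1).countP (j < ·) := by
  rw [parts, Multiset.countP_map, ← filter_val, ← card_def]
  rfl

theorem eq_of_parts_eq {lam nu : IntPartition} (h : parts lam.1 = parts nu.1) : lam = nu := by
  refine Subtype.ext (Finsupp.ext fun i => eq_of_forall_lt_iff fun j => ?_)
  rw [← lt_conj_apply_iff (lam := lam), ← lt_conj_apply_iff (lam := nu),
    conj_apply_eq_countP_parts, conj_apply_eq_countP_parts, h]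

theorem support_eq_range (lam : IntPartition) : lam.1.support = range lam.length := by
  refine eq_range_card_of_isLowerSet fun i k hki hi => ?_
  have : lam.1 i ≤ lam.1 k := lam.2 hki
  simp only [mem_coe, Finsupp.mem_support_iff] at hi ⊢
  omega

theorem apply_eq_zero {i : ℕ} (h : lam.length ≤ i) : lam.1 i = 0 := by
  rwa [← Finsupp.notMem_support_iff, support_eq_range, mem_range, not_lt]

theorem length_le_iff : lam.length ≤ N ↔ ∀ i, lam.1 i ≠ 0 → i < N := by
  rw [← range_subset_range, ← support_eq_range, subset_iff]
  simp only [Finsupp.mem_support_iff, mem_range]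

theorem coe_sum_apply {ι : Type*} (s : Finset ι) (lam : ι → IntPartition) (k : ℕ) :
    (∑ i ∈ s, lam i).1 k = ∑ i ∈ s, (lam i).1 k := by
  rw [← Finsupp.finsetSum_apply]
  exact DFunLike.congr_fun (map_sum partitionMonoid.subtype lam s) k

theorem length_add_le (h₁ : lam.length ≤ N) (h₂ : nu.length ≤ N) : (lam + nu).length ≤ N := by
  rw [length_le_iff] at *
  intro i (hi : lam.1 i + nu.1 i ≠ 0)
  by_contra hN
  have := mt (h₁ i) hN
  have := mt (h₂ i) hN
  omega

theorem length_zero : (0 : IntPartition).length = 0 := rfl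

theorem length_sum_le {ι : Type*} {s : Finset ι} {lam : ι → IntPartition}
    (h : ∀ i ∈ s, (lam i).length ≤ N) : (∑ i ∈ s, lam i).length ≤ N :=
  sum_induction lam (fun nu => nu.length ≤ N) (fun _ _ => length_add_le)
    (length_zero.trans_le N.zero_le) h

theorem sum_eq_sum_fin {M : Type*} [AddCommMonoid M] (h : lam.length ≤ N) (f : ℕ → ℕ → M)
    (hf : ∀ i, f i 0 = 0) : lam.1.sum f = ∑ i : Fin N, f i (lam.1 i) := by
  rw [Fin.sum_univ_eq_sum_range (fun i => f i (lam.1 i)) N]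
  refine Finsupp.sum_of_support_subset _ ?_ _ fun i _ => hf i
  rw [lam.support_eq_range]
  exact range_subset_range.2 h

theorem size_eq_sum_fin (h : lam.length ≤ N) : lam.size = ∑ i : Fin N, lam.1 i :=
  sum_eq_sum_fin h _ fun _ => rfl

theorem b_eq_sum_fin (h : lam.length ≤ N) : lam.b = ∑ i : Fin N, (lam.1 i).choose 2 :=
  sum_eq_sum_fin h _ fun _ => rfl

/-- Both sides sum the row index over all boxes, by columns and by rows. -/
theorem conj_b_eq_sum_fin (h : lam.length ≤ N) : lam.conj.b = ∑ i : Fin N, (i : ℕ) * lam.1 i := by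
  have support_conj : lam.conj.1.support ⊆ range (lam.1 0) := fun j hj =>
    mem_range.2 (lt_conj_apply_iff.1 (Nat.pos_of_ne_zero (Finsupp.mem_support_iff.1 hj)))
  have mem_iff (i j : ℕ) : j ∈ range (lam.1 0) ∧ i ∈ range (lam.conj.1 j) ↔
      j ∈ range (lam.1 i) ∧ i ∈ range N := by
    have := length_le_iff.1 h i
    have : lam.1 i ≤ lam.1 0 := lam.2 i.zero_le
    simp only [mem_range, lt_conj_apply_iff]
    omega
  calc lam.conj.b = ∑ j ∈ range (lam.1 0), (lam.conj.1 j).choose 2 :=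
        Finsupp.sum_of_support_subset _ support_conj _ fun _ _ => rfl
    _ = ∑ j ∈ range (lam.1 0), ∑ i ∈ range (lam.conj.1 j), i := by
        simp only [Nat.choose_two_right, sum_range_id]
    _ = ∑ i ∈ range N, ∑ _j ∈ range (lam.1 i), i := sum_comm' fun j i => mem_iff i j
    _ = ∑ i : Fin N, (i : ℕ) * lam.1 i := by
        rw [Fin.sum_univ_eq_sum_range (fun i => i * lam.1 i) N]
        simp only [sum_const, card_range, smul_eq_mul, mul_comm]

end IntPartition

end Partitions

section Exponents

variable {N : ℕ} {K : Type*} [CommSemiring K]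

/-- The first `N` entries of a sequence, as the exponent of a monomial in `N` variables. -/
noncomputable def exponent (N : ℕ) (x : ℕ →₀ ℕ) : Fin N →₀ ℕ :=
  Finsupp.equivFunOnFinite.symm fun i => x i

@[simp]
theorem exponent_apply (x : ℕ →₀ ℕ) (i : Fin N) : exponent N x i = x i := rfl

theorem exponent_embDomain (e : Fin N →₀ ℕ) : exponent N (e.embDomain Fin.valEmbedding) = e :=
  Finsupp.ext fun i => Finsupp.embDomain_apply_self Fin.valEmbedding e i

theorem embDomain_exponent {x : ℕ →₀ ℕ} (h : ∀ i, x i ≠ 0 → i < N) :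
    (exponent N x).embDomain Fin.valEmbedding = x := by
  ext i
  by_cases hi : i < N
  · exact Finsupp.embDomain_apply_self Fin.valEmbedding (exponent N x) ⟨i, hi⟩
  · rw [Finsupp.embDomain_of_notMem_range, not_ne_iff.1 (mt (h i) hi)]
    rintro ⟨j, rfl⟩
    exact hi j.2

theorem parts_exponent {lam : IntPartition} (h : lam.length ≤ N) :
    parts (exponent N lam.1) = parts lam.1 := by
  rw [← parts_embDomain Fin.valEmbedding, embDomain_exponent (length_le_iff.1 h)]

theorem degree_exponent {lam : IntPartition} (h : lam.length ≤ N) :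
    (exponent N lam.1).degree = lam.size := by
  rw [← sum_parts, parts_exponent h]
  rfl

theorem parts_mapDomain {σ τ : Type*} (s : σ ≃ τ) (e : σ →₀ ℕ) :
    parts (e.mapDomain s) = parts e := by
  rw [← parts_embDomain s.toEmbedding e, Finsupp.embDomain_eq_mapDomain, Equiv.coe_toEmbedding]

theorem antitone_embDomain_val {e : Fin N →₀ ℕ} (he : Antitone e) :
    Antitone (e.embDomain Fin.valEmbedding) := by
  intro i j hij
  by_cases hj : j < N
  · have h₁ := Finsupp.embDomain_apply_self Fin.valEmbedding e ⟨i, hij.trans_lt hj⟩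
    have h₂ := Finsupp.embDomain_apply_self Fin.valEmbedding e ⟨j, hj⟩
    rw [Fin.valEmbedding_apply] at h₁ h₂
    rw [h₁, h₂]
    exact he hij
  · rw [Finsupp.embDomain_of_notMem_range _ _ j (by rintro ⟨k, rfl⟩; exact hj k.2)]
    exact Nat.zero_le _

theorem exists_eq_mapDomain_exponent (e : Fin N →₀ ℕ) :
    ∃ (nu : IntPartition) (s : Equiv.Perm (Fin N)), nu.length ≤ N ∧
      e = (exponent N nu.1).mapDomain s := by
  let s : Equiv.Perm (Fin N) := Fin.revPerm.trans (Tuple.sort e)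
  have sorted : Antitone (e.mapDomain s.symm) := fun i j hij => by
    simp only [Finsupp.mapDomain_equiv_apply, Equiv.symm_symm]
    exact Tuple.monotone_sort e (Fin.rev_le_rev.2 hij)
  refine ⟨⟨_, antitone_embDomain_val sorted⟩, s, length_le_iff.2 fun i hi => ?_, ?_⟩
  · by_contra hN
    refine hi (Finsupp.embDomain_of_notMem_range _ _ i ?_)
    rintro ⟨j, rfl⟩
    exact hN j.2
  · rw [exponent_embDomain, ← Finsupp.mapDomain_comp, ← Equiv.coe_trans, Equiv.symm_trans_self,
      Equiv.coe_refl, Finsupp.mapDomain_id]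

theorem exists_parts_eq (e : Fin N →₀ ℕ) :
    ∃ nu : IntPartition, nu.length ≤ N ∧ parts nu.1 = parts e := by
  obtain ⟨nu, s, h, rfl⟩ := exists_eq_mapDomain_exponent e
  exact ⟨nu, h, by rw [parts_mapDomain, parts_exponent h]⟩

theorem exists_perm_of_parts_eq {e : Fin N →₀ ℕ} {nu : IntPartition} (h : parts e = parts nu.1) :
    nu.length ≤ N ∧ ∃ s : Equiv.Perm (Fin N), e = (exponent N nu.1).mapDomain s := by
  obtain ⟨mu, s, hmu, rfl⟩ := exists_eq_mapDomain_exponent e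
  rw [parts_mapDomain, parts_exponent hmu] at h
  exact eq_of_parts_eq h ▸ ⟨hmu, s, rfl⟩

theorem coeff_mapDomain_of_isSymmetric {σ : Type*} {f : MvPolynomial σ K} (hf : f.IsSymmetric)
    (s : Equiv.Perm σ) (e : σ →₀ ℕ) : coeff (e.mapDomain s) f = coeff e f := by
  conv_lhs => rw [← hf s]
  exact coeff_rename_mapDomain s s.injective f e

theorem eq_of_coeff_exponent_eq {f g : MvPolynomial (Fin N) K} (hf : f.IsSymmetric)
    (hg : g.IsSymmetric) (h : ∀ nu : IntPartition, nu.length ≤ N →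
      coeff (exponent N nu.1) f = coeff (exponent N nu.1) g) : f = g := by
  ext e
  obtain ⟨nu, s, hnu, rfl⟩ := exists_eq_mapDomain_exponent e
  rw [coeff_mapDomain_of_isSymmetric hf, coeff_mapDomain_of_isSymmetric hg, h nu hnu]

theorem coeff_monomialPoly (nu : IntPartition) (e : Fin N →₀ ℕ) :
    coeff e (monomialPoly N K nu) = if parts e = parts nu.1 then 1 else 0 := by
  simp only [monomialPoly, coeff_sum, coeff_monomial, sum_ite_eq']
  refine if_congr ?_ rfl rfl
  simp only [mem_filter, mem_finsuppAntidiag, and_iff_right_iff_imp]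
  intro h
  refine ⟨?_, subset_univ _⟩
  rw [← Finsupp.degree_eq_sum, ← sum_parts, h]
  rfl

theorem isSymmetric_monomialPoly (nu : IntPartition) : (monomialPoly N K nu).IsSymmetric := by
  intro s
  ext e
  have h : e = (e.mapDomain s.symm).mapDomain s := by
    rw [← Finsupp.mapDomain_comp, ← Equiv.coe_trans, Equiv.symm_trans_self, Equiv.coe_refl,
      Finsupp.mapDomain_id]
  rw [h, coeff_rename_mapDomain _ s.injective, coeff_monomialPoly, coeff_monomialPoly,
    parts_mapDomain s]

theorem map_monomialPoly {L : Type*} [CommSemiring L] (φ : K →+* L) (nu : IntPartition) :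
    map φ (monomialPoly N K nu) = monomialPoly N L nu := by
  simp only [monomialPoly, map_sum, map_monomial, map_one]

end Exponents

section SlowlyVarying

variable {ι κ M O : Type*} [AddCommMonoid M] [CommRing O] {α : O} {k : ℕ} {a b : M → O}

/-- All iterated differences of `a` of order `j ≤ k`, with arbitrary steps, are divisible
by `α ^ j`. The recursion asks for quotients by `α`, which need not be unique. -/
def SlowlyVarying (α : O) : ℕ → (M → O) → Prop
  | 0, _ => True
  | k + 1, a => ∀ d, ∃ b, SlowlyVarying α k b ∧ ∀ n, a (n + d) = a n + α * b n

namespace SlowlyVarying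

theorem of_succ (h : SlowlyVarying α (k + 1) a) : SlowlyVarying α k a := by
  induction k generalizing a with
  | zero => trivial
  | succ k ih =>
    intro d
    obtain ⟨b, hb, hab⟩ := h d
    exact ⟨b, ih hb, hab⟩

theorem const (k : ℕ) (c : O) : SlowlyVarying α k fun _ : M => c := by
  induction k generalizing c with
  | zero => trivial
  | succ k ih => exact fun d => ⟨fun _ => 0, ih 0, fun n => by rw [mul_zero, add_zero]⟩

theorem add (ha : SlowlyVarying α k a) (hb : SlowlyVarying α k b) :
    SlowlyVarying α k fun n => a n + b n := by
  induction k generalizing a b with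
  | zero => trivial
  | succ k ih =>
    intro d
    obtain ⟨a', ha', haa'⟩ := ha d
    obtain ⟨b', hb', hbb'⟩ := hb d
    exact ⟨_, ih ha' hb', fun n => by simp only [haa', hbb']; ring⟩

theorem shift (ha : SlowlyVarying α k a) (d : M) : SlowlyVarying α k fun n => a (n + d) := by
  induction k generalizing a with
  | zero => trivial
  | succ k ih =>
    intro e
    obtain ⟨a', ha', haa'⟩ := ha e
    exact ⟨_, ih ha', fun n => by rw [← haa', add_right_comm]⟩

theorem mul (ha : SlowlyVarying α k a) (hb : SlowlyVarying α k b) :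
    SlowlyVarying α k fun n => a n * b n := by
  induction k generalizing a b with
  | zero => trivial
  | succ k ih =>
    intro d
    obtain ⟨a', ha', haa'⟩ := ha d
    obtain ⟨b', hb', hbb'⟩ := hb d
    refine ⟨_, (ih ha' (hb.shift d).of_succ).add (ih ha.of_succ hb'), fun n => ?_⟩
    simp only [haa', hbb']
    ring

theorem prod (s : Finset κ) {a : κ → M → O} (ha : ∀ i ∈ s, SlowlyVarying α k (a i)) :
    SlowlyVarying α k fun n => ∏ i ∈ s, a i n := by
  have := prod_induction a (SlowlyVarying α k) (fun _ _ => mul) (const k 1) ha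
  rwa [show ∏ i ∈ s, a i = fun n => ∏ i ∈ s, a i n from funext fun n => prod_apply n s a] at this

theorem inv {u : M → Oˣ} (hu : SlowlyVarying α k fun n => (u n : O)) :
    SlowlyVarying α k fun n => (((u n)⁻¹ : Oˣ) : O) := by
  induction k with
  | zero => trivial
  | succ k ih =>
    intro d
    obtain ⟨b, hb, h⟩ := hu d
    have hinv := ih hu.of_succ
    refine ⟨_, (const k (-1)).mul ((hb.mul hinv).mul (hinv.shift d)), fun n => ?_⟩
    have hn := (u n).mul_inv
    have hd := (u (n + d)).mul_inv
    linear_combination -(((u n)⁻¹ : Oˣ) : O) * (((u (n + d))⁻¹ : Oˣ) : O) * h n +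
      (((u n)⁻¹ : Oˣ) : O) * hd - (((u (n + d))⁻¹ : Oˣ) : O) * hn

theorem exists_div_shift_eq {β : O} {u : M → Oˣ} {h : M → O} (hh : SlowlyVarying α (k + 1) h)
    (hu : ∀ n, (u n : O) = 1 + β * h n) (d : M) :
    ∃ h', SlowlyVarying α k h' ∧ ∀ n, ((u n / u (n + d) : Oˣ) : O) = 1 + β * α * h' n := by
  obtain ⟨b, hb, hhb⟩ := hh d
  have hus : SlowlyVarying α k fun n => (u n : O) := by
    simp_rw [hu]
    exact (const k 1).add ((const k β).mul hh.of_succ)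
  refine ⟨_, (const k (-1)).mul (hb.mul (hus.inv.shift d)), fun n => ?_⟩
  have hd := hu (n + d)
  rw [hhb] at hd
  rw [div_eq_mul_inv, Units.val_mul]
  linear_combination (((u (n + d))⁻¹ : Oˣ) : O) * (hu n - hd) + (u (n + d)).mul_inv

theorem exists_altProd_eq {f : M → Oˣ}
    (hf : ∀ d k, SlowlyVarying α k fun n => ((f n / f (n + d) : Oˣ) : O)) (x : ι → M) {S : Finset ι}
    (hS : S.Nonempty) (k : ℕ) :
    ∃ h, SlowlyVarying α k h ∧ ∀ n,
      ((altProd S fun I => f (n + ∑ i ∈ I, x i) : Oˣ) : O) = 1 + α ^ (#S - 1) * h n := by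
  classical
  induction hS using Nonempty.cons_induction generalizing k with
  | singleton i =>
    refine ⟨_, (hf (x i) k).add (const k (-1)), fun n => ?_⟩
    rw [← insert_empty, altProd_insert (notMem_empty i)]
    simp [altProd]
  | cons i S hi hS ih =>
    obtain ⟨h, hh, hu⟩ := ih (k + 1)
    obtain ⟨h', hh', hu'⟩ := hh.exists_div_shift_eq hu (x i)
    refine ⟨h', hh', fun n => ?_⟩
    have shifted : (altProd S fun I => f (n + ∑ j ∈ insert i I, x j)) =
        altProd S fun I => f (n + x i + ∑ j ∈ I, x j) :=
      altProd_congr fun I hI => by rw [sum_insert fun h => hi (hI h), add_assoc]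
    rw [cons_eq_insert, altProd_insert hi, shifted, hu' n, ← pow_succ,
      Nat.sub_add_cancel hS.card_pos, card_insert_of_notMem hi, Nat.add_sub_cancel]

end SlowlyVarying

/-- The units congruent to `1` modulo `c`. -/
def unitsCongrOne (c : O) : Subgroup Oˣ :=
  (Units.map (Ideal.Quotient.mk (Ideal.span {c}) : O →* O ⧸ Ideal.span {c})).ker

theorem mem_unitsCongrOne {c : O} {u : Oˣ} : u ∈ unitsCongrOne c ↔ c ∣ (u : O) - 1 := by
  rw [unitsCongrOne, MonoidHom.mem_ker, Units.ext_iff, ← Ideal.mem_span_singleton,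
    ← Ideal.Quotient.mk_eq_mk_iff_sub_mem]
  rfl

theorem altProd_prod_range_mem_unitsCongrOne {c : O} {g : ℕ → Oˣ}
    (hg : ∀ n, (g n : O) = c + α * n) (x : ι → ℕ) {S : Finset ι} (hS : S.Nonempty) :
    (altProd S fun I => ∏ a ∈ range (∑ i ∈ I, x i), g a) ∈ unitsCongrOne (α ^ (#S - 1)) := by
  have hgs (k : ℕ) : SlowlyVarying α k fun n => (g n : O) := by
    simp_rw [hg]
    cases k with
    | zero => trivial
    | succ k => exact fun d => ⟨_, .const k (d : O), fun n => by push_cast; ring⟩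
  have slowlyVarying_div (d k : ℕ) : SlowlyVarying α k fun n =>
      (((∏ a ∈ range n, g a) / ∏ a ∈ range (n + d), g a : Oˣ) : O) := by
    simp_rw [prod_range_add, div_mul_cancel_left, ← prod_inv_distrib, Units.coe_prod]
    exact .prod _ fun a _ => (hgs k).inv.shift a
  obtain ⟨h, -, hh⟩ := SlowlyVarying.exists_altProd_eq slowlyVarying_div x hS 0
  have hh₀ := hh 0
  simp only [zero_add] at hh₀
  exact mem_unitsCongrOne.2 ⟨h 0, sub_eq_iff_eq_add'.2 hh₀⟩

end SlowlyVarying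

section HookProduct

variable {ι K M : Type*} [CommSemiring K]

/-- The hook product of a partition with parameter `α` in an arbitrary semiring; `hook` is the case
of the parameter `RatFunc.X`. -/
noncomputable def hookProd (α : K) (lam : IntPartition) : K :=
  ∏ s ∈ lam.boxes, (α * (lam.arm s : K) + (lam.leg s : K) + 1)

theorem map_hookProd {L : Type*} [CommSemiring L] (φ : K →+* L) (α : K) (lam : IntPartition) :
    φ (hookProd α lam) = hookProd (φ α) lam := by
  simp only [hookProd, map_prod, map_add, map_mul, map_natCast, map_one]

theorem prod_Ico_conj_apply [CommMonoid M] (lam : IntPartition) (F : ℕ → ℕ → M) (i n : ℕ) :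
    ∏ j ∈ Ico (lam.1 (i + n)) (lam.1 i), F j (lam.conj.1 j) =
      ∏ t ∈ range n, ∏ j ∈ Ico (lam.1 (i + t + 1)) (lam.1 (i + t)), F j (i + t + 1) := by
  induction n with
  | zero => simp only [add_zero, Ico_self, prod_empty, range_zero]
  | succ n ih =>
    rw [prod_range_succ, ← ih, mul_comm, ← add_assoc,
      ← prod_Ico_consecutive (fun j => F j (lam.conj.1 j)) (lam.2 (Nat.le_succ (i + n)))
        (lam.2 (Nat.le_add_right i n))]
    refine congrArg (· * _) (prod_congr rfl fun j hj => ?_)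
    obtain ⟨h₁, h₂⟩ := mem_Ico.1 hj
    rw [conj_apply_eq_of_le_of_lt h₁ h₂]

theorem hookProd_eq_prod_rows (α : K) {lam : IntPartition} {N : ℕ} (hN : lam.length ≤ N) :
    hookProd α lam = ∏ i ∈ range N, ∏ j ∈ range (lam.1 i),
      (α * ((lam.1 i - (j + 1) : ℕ) : K) + ((lam.conj.1 j - (i + 1) : ℕ) : K) + 1) := by
  rw [hookProd, boxes, prod_sigma, lam.support_eq_range]
  refine prod_subset (range_subset_range.2 hN) fun i _ hi => ?_
  rw [apply_eq_zero (not_lt.1 (mt mem_range.2 hi)), range_zero, prod_empty]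

/-- The boxes of row `i` with leg-length `t` are the last boxes of the columns of height
`i + t + 1`, and their arm-lengths are consecutive integers. -/
theorem hookProd_eq_prod_arms (α : K) {lam : IntPartition} {N : ℕ} (hN : lam.length ≤ N) :
    hookProd α lam = ∏ i ∈ range N, ∏ t ∈ range (N - i),
      ∏ a ∈ Ico (lam.1 i - lam.1 (i + t)) (lam.1 i - lam.1 (i + t + 1)),
        (α * (a : K) + (t : K) + 1) := by
  rw [hookProd_eq_prod_rows α hN]
  refine prod_congr rfl fun i hi => ?_
  have hzero : lam.1 (i + (N - i)) = 0 :=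
    apply_eq_zero (hN.trans_eq (Nat.add_sub_cancel' (mem_range.1 hi).le).symm)
  have by_columns := prod_Ico_conj_apply lam (fun j t =>
    α * ((lam.1 i - (j + 1) : ℕ) : K) + ((t - (i + 1) : ℕ) : K) + 1) i (N - i)
  rw [hzero, ← range_eq_Ico] at by_columns
  rw [by_columns]
  refine prod_congr rfl fun t _ => ?_
  have : lam.1 (i + t + 1) ≤ lam.1 (i + t) := lam.2 (Nat.le_succ _)
  have : lam.1 (i + t) ≤ lam.1 i := lam.2 (Nat.le_add_right _ _)
  refine prod_nbij' (fun j => lam.1 i - (j + 1)) (fun a => lam.1 i - (a + 1)) ?_ ?_ ?_ ?_ ?_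
  any_goals simp only [mem_Ico]; omega
  intro j _
  rw [show i + t + 1 - (i + 1) = t by omega]

theorem altProd_hookProd_mem_unitsCongrOne {O : Type*} [CommRing O] {α : O}
    {g : ℕ → ℕ → Oˣ} (hg : ∀ t n, (g t n : O) = (t : O) + 1 + α * n) (lam : ι → IntPartition)
    {S : Finset ι} (hS : S.Nonempty) {H : Finset ι → Oˣ}
    (hH : ∀ I ⊆ S, (H I : O) = hookProd α (∑ i ∈ I, lam i)) :
    altProd S H ∈ unitsCongrOne (α ^ (#S - 1)) := by
  set N := S.powerset.sup fun I => (∑ i ∈ I, lam i).length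
  let P (i k t : ℕ) (I : Finset ι) : Oˣ :=
    ∏ a ∈ range (∑ j ∈ I, ((lam j).1 i - (lam j).1 k)), g t a
  have row_sub (I : Finset ι) {i k : ℕ} (h : i ≤ k) :
      (∑ j ∈ I, lam j).1 i - (∑ j ∈ I, lam j).1 k = ∑ j ∈ I, ((lam j).1 i - (lam j).1 k) := by
    rw [coe_sum_apply, coe_sum_apply, sum_tsub_distrib I fun j _ => (lam j).2 h]
  have H_eq (I) (hI : I ⊆ S) : H I = ∏ i ∈ range N, ∏ t ∈ range (N - i),
      P i (i + t + 1) t I / P i (i + t) t I := by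
    have length_le : (∑ i ∈ I, lam i).length ≤ N :=
      le_sup (f := fun I => (∑ i ∈ I, lam i).length) (mem_powerset.2 hI)
    ext
    rw [hH I hI, hookProd_eq_prod_arms α length_le]
    simp only [Units.coe_prod]
    refine prod_congr rfl fun i _ => prod_congr rfl fun t _ => ?_
    simp only [P]
    rw [← row_sub I (by omega : i ≤ i + t + 1), ← row_sub I (by omega : i ≤ i + t),
      ← prod_Ico_eq_div _ (Nat.sub_le_sub_left ((∑ i ∈ I, lam i).2 (Nat.le_succ _)) _),
      Units.coe_prod]
    exact prod_congr rfl fun a _ => by rw [hg]; ring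
  rw [altProd_congr H_eq, altProd_prod]
  simp_rw [altProd_prod, altProd_div]
  exact prod_mem fun i _ => prod_mem fun t _ => div_mem
    (altProd_prod_range_mem_unitsCongrOne (hg t) _ hS)
    (altProd_prod_range_mem_unitsCongrOne (hg t) _ hS)

end HookProduct

section PairOp

variable {σ K : Type*}

/-- The exponent `e` with its entries at `i` and `j` replaced by `a` and `e i + e j - a`. -/
noncomputable def redistribute (e : σ →₀ ℕ) (i j : σ) (a : ℕ) : σ →₀ ℕ :=
  (e.update i a).update j (e i + e j - a)

theorem redistribute_apply [DecidableEq σ] (e : σ →₀ ℕ) (i j : σ) (a : ℕ) (k : σ) :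
    redistribute e i j a k = if k = j then e i + e j - a else if k = i then a else e k := by
  simp only [redistribute, Finsupp.coe_update, Function.update_apply]

theorem update_update_eq_iff {e m : σ →₀ ℕ} {i j : σ} (hij : i ≠ j) {a b : ℕ} :
    (e.update i a).update j b = m ↔ m i = a ∧ m j = b ∧ ∀ k, k ≠ i → k ≠ j → m k = e k := by
  classical
  simp only [Finsupp.ext_iff, Finsupp.coe_update, Function.update_apply]
  constructor
  · intro h
    refine ⟨?_, ?_, fun k hi hj => ?_⟩
    · rw [← h i, if_neg hij, if_pos rfl]
    · rw [← h j, if_pos rfl]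
    · rw [← h k, if_neg hj, if_neg hi]
  · rintro ⟨h₁, h₂, h₃⟩ k
    split_ifs with hj hi
    · rw [hj, h₂]
    · rw [hi, h₁]
    · exact (h₃ k hi hj).symm

theorem lt_and_redistribute_eq_iff {e m : σ →₀ ℕ} {i j : σ} (hij : i ≠ j) :
    e i < m i ∧ redistribute m i j (e i) = e ↔
      m i ∈ Ioc (e i) (e i + e j) ∧ redistribute e i j (m i) = m := by
  simp only [redistribute, update_update_eq_iff hij, mem_Ioc]
  constructor
  · rintro ⟨h, -, hj, hk⟩
    exact ⟨⟨h, by omega⟩, trivial, by omega, fun k h₁ h₂ => (hk k h₁ h₂).symm⟩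
  · rintro ⟨⟨h, h_le⟩, -, hj, hk⟩
    exact ⟨h, trivial, by omega, fun k h₁ h₂ => (hk k h₁ h₂).symm⟩

theorem sum_ite_redistribute_eq [DecidableEq σ] [AddCommMonoid K] {e m : σ →₀ ℕ} {i j : σ}
    (hij : i ≠ j) (s : Finset ℕ) (f : ℕ → K) :
    ∑ a ∈ s, (if redistribute m i j a = e then f a else 0) =
      if e i ∈ s ∧ redistribute m i j (e i) = e then f (e i) else 0 := by
  have eq_of_redistribute_eq {a : ℕ} (h : redistribute m i j a = e) : e i = a :=
    ((update_update_eq_iff hij).1 h).1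
  rw [ite_and, ← sum_ite_eq s (e i) fun a => if redistribute m i j a = e then f a else 0]
  refine sum_congr rfl fun a _ => ?_
  by_cases ha : e i = a
  · rw [if_pos ha]
  · rw [if_neg ha, if_neg (mt eq_of_redistribute_eq ha)]

variable [CommRing K]

/-- The linear operator on polynomials that agrees on symmetric polynomials with
`(x_i ^ 2 * ∂_i - x_j ^ 2 * ∂_j) / (x_i - x_j)`. -/
noncomputable def pairOp (i j : σ) : MvPolynomial σ K →ₗ[K] MvPolynomial σ K :=
  (basisMonomials σ K).constr K fun m =>
    monomial m (m i : K) + ∑ a ∈ range (m i), monomial (redistribute m i j a) ((m i : K) - m j)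

/-- The obstruction to `pairOp` being `(x_i ^ 2 * ∂_i - x_j ^ 2 * ∂_j) / (x_i - x_j)`. -/
noncomputable def pairDefect (i j : σ) : MvPolynomial σ K →ₗ[K] MvPolynomial σ K :=
  (basisMonomials σ K).constr K fun m =>
    monomial ((m.update i 0).update j (m i + m j + 1)) ((m i : K) - m j)

theorem pairOp_monomial (i j : σ) (m : σ →₀ ℕ) (c : K) :
    pairOp i j (monomial m c) = monomial m (c * m i) +
      ∑ a ∈ range (m i), monomial (redistribute m i j a) (c * ((m i : K) - m j)) := by
  have h : monomial m c = c • basisMonomials σ K m := by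
    rw [coe_basisMonomials, smul_monomial, smul_eq_mul, mul_one]
  rw [h, map_smul, pairOp, Module.Basis.constr_basis, smul_add, smul_monomial, smul_sum]
  simp only [smul_monomial, smul_eq_mul]

theorem pairDefect_monomial (i j : σ) (m : σ →₀ ℕ) (c : K) :
    pairDefect i j (monomial m c) =
      monomial ((m.update i 0).update j (m i + m j + 1)) (c * ((m i : K) - m j)) := by
  have h : monomial m c = c • basisMonomials σ K m := by
    rw [coe_basisMonomials, smul_monomial, smul_eq_mul, mul_one]
  rw [h, map_smul, pairDefect, Module.Basis.constr_basis, smul_monomial, smul_eq_mul]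

theorem coeff_pairOp {i j : σ} (hij : i ≠ j) (f : MvPolynomial σ K) (e : σ →₀ ℕ) :
    coeff e (pairOp i j f) = e i * coeff e f +
      ∑ a ∈ Ioc (e i) (e i + e j), (2 * a - e i - e j) * coeff (redistribute e i j a) f := by
  classical
  induction f using MvPolynomial.induction_on' with
  | add p q hp hq =>
    simp only [map_add, coeff_add, hp, hq, mul_add, sum_add_distrib]
    ring
  | monomial m c =>
    rw [pairOp_monomial, coeff_add, coeff_sum]
    simp only [coeff_monomial, mul_ite, mul_zero, eq_comm (a := m)]
    rw [sum_ite_redistribute_eq hij, sum_ite_redistribute_eq hij]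
    simp only [mem_range, lt_and_redistribute_eq_iff hij]
    congr 1
    · split_ifs with h
      · rw [h, mul_comm]
      · rfl
    · refine if_ctx_congr Iff.rfl (fun h => ?_) fun _ => rfl
      obtain ⟨hi, hm⟩ := h
      have hj := ((update_update_eq_iff hij).1 hm).2.1
      have sum_eq : ((e i + e j : ℕ) : K) = ((m i + m j : ℕ) : K) := by
        congr 1
        have := (mem_Ioc.1 hi).2
        omega
      push_cast at sum_eq
      linear_combination c * sum_eq

theorem monomial_update_update (m : σ →₀ ℕ) {i j : σ} (hij : i ≠ j) (a b : ℕ) (c : K) :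
    monomial ((m.update i a).update j b) c =
      monomial ((m.update i 0).update j 0) c * X i ^ a * X j ^ b := by
  classical
  rw [X_pow_eq_monomial, X_pow_eq_monomial, monomial_mul, monomial_mul, mul_one, mul_one]
  congr 2
  rw [update_update_eq_iff hij]
  simp +contextual [hij, hij.symm, eq_comm]

theorem sub_mul_sum_pow_mul_pow (x y : K) (p q : ℕ) :
    (x - y) * ∑ a ∈ range p, x ^ a * y ^ (p + q - a) = y ^ (q + 1) * (x ^ p - y ^ p) := by
  rw [← (Commute.all x y).mul_geom_sum₂ p, mul_left_comm, mul_sum _ _ (y ^ (q + 1))]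
  refine congrArg _ (sum_congr rfl fun a ha => ?_)
  have := mem_range.1 ha
  rw [mul_left_comm, ← pow_add, show q + 1 + (p - 1 - a) = p + q - a by omega]

theorem sub_mul_pairOp {i j : σ} (hij : i ≠ j) (f : MvPolynomial σ K) :
    (X i - X j) * pairOp i j f =
      X i ^ 2 * pderiv i f - X j ^ 2 * pderiv j f - pairDefect i j f := by
  induction f using MvPolynomial.induction_on' with
  | add p q hp hq =>
    simp only [map_add, mul_add, hp, hq]
    ring
  | monomial m c =>
    obtain ⟨M, hM⟩ : ∃ M : MvPolynomial σ K, ∀ a b,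
        monomial ((m.update i a).update j b) c = M * X i ^ a * X j ^ b :=
      ⟨_, fun a b => monomial_update_update m hij a b c⟩
    have monomial_eq : (monomial m c : MvPolynomial σ K) = M * X i ^ m i * X j ^ m j := by
      rw [← hM, (update_update_eq_iff hij).2 ⟨rfl, rfl, fun _ _ _ => rfl⟩]
    have monomial_mul_eq (n : σ →₀ ℕ) (x y : K) : monomial n (x * y) = C y * monomial n x := by
      rw [C_mul_monomial, mul_comm]
    have X_sq_mul_pderiv (k : σ) :
        X k ^ 2 * pderiv k (monomial m c) = X k * (C (m k : K) * monomial m c) := by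
      rw [pow_two, mul_assoc, X_mul_pderiv_monomial, nsmul_eq_mul, map_natCast]
    have sum_eq : ∑ a ∈ range (m i), C ((m i : K) - m j) * (M * X i ^ a * X j ^ (m i + m j - a)) =
        C ((m i : K) - m j) * M * ∑ a ∈ range (m i), X i ^ a * X j ^ (m i + m j - a) := by
      rw [mul_sum]
      exact sum_congr rfl fun a _ => by ring
    rw [X_sq_mul_pderiv, X_sq_mul_pderiv, pairOp_monomial, pairDefect_monomial]
    simp only [redistribute, monomial_mul_eq, hM, monomial_eq]
    rw [sum_eq, mul_add, mul_left_comm _ (C _ * M), sub_mul_sum_pow_mul_pow]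
    simp only [map_sub, map_natCast]
    ring

theorem pairDefect_rename_swap [DecidableEq σ] {i j : σ} (hij : i ≠ j) (f : MvPolynomial σ K) :
    pairDefect i j (rename (Equiv.swap i j) f) = - pairDefect i j f := by
  induction f using MvPolynomial.induction_on' with
  | add p q hp hq => simp only [map_add, hp, hq, neg_add]
  | monomial m c =>
    have mapDomain_swap_apply (k) :
        (m.mapDomain (Equiv.swap i j)) k = m (Equiv.swap i j k) := by
      rw [Finsupp.mapDomain_equiv_apply, Equiv.symm_swap]
    rw [rename_monomial, pairDefect_monomial, pairDefect_monomial, ← map_neg]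
    simp only [mapDomain_swap_apply, Equiv.swap_apply_left, Equiv.swap_apply_right]
    congr 2
    · rw [add_comm (m j), update_update_eq_iff hij]
      refine ⟨?_, ?_, fun k hi hj => ?_⟩
      · simp [hij]
      · simp
      · simp [mapDomain_swap_apply, Equiv.swap_apply_of_ne_of_ne hi hj, hi, hj]
    · ring

theorem map_pairOp {L : Type*} [CommRing L] (φ : K →+* L) (i j : σ) (f : MvPolynomial σ K) :
    map φ (pairOp i j f) = pairOp i j (map φ f) := by
  induction f using MvPolynomial.induction_on' with
  | add p q hp hq => simp only [map_add, hp, hq]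
  | monomial m c => simp only [pairOp_monomial, map_add, map_sum, map_monomial, map_mul, map_sub,
      map_natCast]

theorem X_sub_X_ne_zero [Nontrivial K] {i j : σ} (hij : i ≠ j) :
    (X i - X j : MvPolynomial σ K) ≠ 0 :=
  sub_ne_zero.2 fun h => hij (X_injective h)

variable [IsDomain K] [CharZero K]

theorem sub_mul_pairOp_of_isSymmetric {i j : σ} (hij : i ≠ j) {f : MvPolynomial σ K}
    (hf : f.IsSymmetric) :
    (X i - X j) * pairOp i j f = X i ^ 2 * pderiv i f - X j ^ 2 * pderiv j f := by
  classical
  have h := pairDefect_rename_swap hij f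
  rw [hf (Equiv.swap i j), self_eq_neg] at h
  rw [sub_mul_pairOp hij, h, sub_zero]

theorem pairOp_comm {i j : σ} (hij : i ≠ j) {f : MvPolynomial σ K} (hf : f.IsSymmetric) :
    pairOp i j f = pairOp j i f := by
  apply mul_left_cancel₀ (X_sub_X_ne_zero (K := K) hij)
  rw [sub_mul_pairOp_of_isSymmetric hij hf]
  linear_combination sub_mul_pairOp_of_isSymmetric hij.symm hf

theorem rename_pairOp {i j : σ} (hij : i ≠ j) (s : Equiv.Perm σ) {f : MvPolynomial σ K}
    (hf : f.IsSymmetric) : rename s (pairOp i j f) = pairOp (s i) (s j) f := by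
  have hs : s i ≠ s j := s.injective.ne hij
  apply mul_left_cancel₀ (X_sub_X_ne_zero (K := K) hs)
  have h := congrArg (rename s) (sub_mul_pairOp_of_isSymmetric hij hf)
  simp only [map_mul, map_sub, rename_X, map_pow] at h
  rw [sub_mul_pairOp_of_isSymmetric hs hf, h, ← pderiv_rename s.injective,
    ← pderiv_rename s.injective, hf s]

end PairOp

section FirstOrderOp

variable {N : ℕ} {K : Type*} [CommRing K]

/-- The operator that agrees on symmetric polynomials with the first-order part
`∑ i, ∑ j ≠ i, x_i ^ 2 / (x_i - x_j) * ∂_i` of the Laplace–Beltrami operator. -/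
noncomputable def firstOrderOp (f : MvPolynomial (Fin N) K) : MvPolynomial (Fin N) K :=
  ∑ i, ∑ j ∈ Ioi i, pairOp i j f

theorem map_firstOrderOp {L : Type*} [CommRing L] (φ : K →+* L) (f : MvPolynomial (Fin N) K) :
    map φ (firstOrderOp f) = firstOrderOp (map φ f) := by
  simp only [firstOrderOp, map_sum, map_pairOp]

theorem coeff_firstOrderOp (f : MvPolynomial (Fin N) K) (e : Fin N →₀ ℕ) :
    coeff e (firstOrderOp f) = (∑ i : Fin N, ((N - 1 - i : ℕ) : K) * e i) * coeff e f +
      ∑ i, ∑ j ∈ Ioi i, ∑ a ∈ Ioc (e i) (e i + e j),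
        (2 * a - e i - e j) * coeff (redistribute e i j a) f := by
  have expand (i : Fin N) := sum_congr rfl fun j hj => coeff_pairOp (mem_Ioi.1 hj).ne f e (i := i)
  simp_rw [firstOrderOp, coeff_sum, expand, sum_add_distrib, sum_mul]
  simp only [sum_const, Fin.card_Ioi, nsmul_eq_mul, mul_assoc]

variable [IsDomain K] [CharZero K]

theorem sum_mul_map_pderiv_eq_map_firstOrderOp {F : Type*} [CommRing F]
    (θ : MvPolynomial (Fin N) K →+* F) {c : Fin N → Fin N → F}
    (hc : ∀ i j, i ≠ j → c i j * (θ (X i) - θ (X j)) = 1)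
    {f : MvPolynomial (Fin N) K} (hf : f.IsSymmetric) :
    ∑ i, ∑ j ∈ univ.erase i, θ (X i) ^ 2 * c i j * θ (pderiv i f) = θ (firstOrderOp f) := by
  have pair_up := sum_sum_Ioi_add_eq_sum_sum_off_diag
    (fun j i : Fin N => θ (X i) ^ 2 * c i j * θ (pderiv i f))
  simp_rw [compl_singleton] at pair_up
  simp_rw [← pair_up, firstOrderOp, map_sum]
  refine sum_congr rfl fun i _ => sum_congr rfl fun j hj => ?_
  have hij : i ≠ j := (mem_Ioi.1 hj).ne
  have mul_pairOp := congrArg θ (sub_mul_pairOp_of_isSymmetric hij hf)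
  simp only [map_mul, map_sub, map_pow] at mul_pairOp
  have hcij := hc i j hij
  have c_antisymm : c j i = - c i j := by
    linear_combination -(c j i) * hcij - c i j * hc j i hij.symm
  rw [c_antisymm]
  linear_combination (-c i j) * mul_pairOp + θ (pairOp i j f) * hcij

theorem two_mul_firstOrderOp {f : MvPolynomial (Fin N) K} (hf : f.IsSymmetric) :
    2 * firstOrderOp f = ∑ i, ∑ j ∈ univ.erase i, pairOp i j f := by
  have pair_up := sum_sum_Ioi_add_eq_sum_sum_off_diag (fun j i : Fin N => pairOp i j f)
  simp_rw [compl_singleton] at pair_up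
  simp_rw [← pair_up, firstOrderOp, mul_sum]
  refine sum_congr rfl fun i _ => sum_congr rfl fun j hj => ?_
  rw [pairOp_comm (mem_Ioi.1 hj).ne' hf, two_mul]

theorem isSymmetric_firstOrderOp {f : MvPolynomial (Fin N) K} (hf : f.IsSymmetric) :
    (firstOrderOp f).IsSymmetric := by
  intro s
  apply mul_left_cancel₀ (two_ne_zero (α := MvPolynomial (Fin N) K))
  have h := congrArg (rename s) (two_mul_firstOrderOp hf)
  rw [map_mul, map_ofNat] at h
  simp_rw [h, two_mul_firstOrderOp hf, map_sum]
  refine Fintype.sum_equiv s _ _ fun i => sum_equiv s (fun j => ?_) fun j hj => ?_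
  · simp only [mem_erase, mem_univ, and_true, ne_eq, s.apply_eq_iff_eq]
  · rw [rename_pairOp (ne_of_mem_erase hj).symm s hf]

end FirstOrderOp

section Dominance

variable {N : ℕ}

theorem card_filter_val_lt {k : ℕ} (hk : k ≤ N) : #{i : Fin N | i.1 < k} = k := by
  rw [Fin.card_filter_val_lt, min_eq_right hk]

theorem sum_range_eq_sum_filter {x : ℕ →₀ ℕ} {k : ℕ} (hk : k ≤ N) :
    ∑ i ∈ range k, x i = ∑ i : Fin N with i.1 < k, exponent N x i := by
  refine sum_bij' (fun i hi => ⟨i, (mem_range.1 hi).trans_le hk⟩) (fun i _ => i.1)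
    ?_ ?_ ?_ ?_ ?_ <;> simp

theorem sum_filter_lt_succ {M : Type*} [AddCommMonoid M] (x : Fin N → M) (i : Fin N) :
    ∑ j : Fin N with j.1 < i.1 + 1, x j = x i + ∑ j : Fin N with j.1 < i.1, x j := by
  rw [← sum_insert (by simp)]
  refine sum_congr ?_ fun _ _ => rfl
  ext j
  simp [le_iff_lt_or_eq, Fin.ext_iff, or_comm]

theorem eq_exponent_of_sum_filter_eq {e : Fin N →₀ ℕ} {x : ℕ →₀ ℕ}
    (h : ∀ k ≤ N, ∑ i : Fin N with i.1 < k, e i = ∑ i ∈ range k, x i) : e = exponent N x := by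
  ext i
  have sum_succ := h (i + 1) i.2
  rw [sum_filter_lt_succ, h i i.2.le, sum_range_succ] at sum_succ
  rw [exponent_apply]
  omega

namespace IntPartition

variable {lam nu mu : IntPartition}

theorem sum_le_sum_range (nu : IntPartition) (T : Finset ℕ) :
    ∑ i ∈ T, nu.1 i ≤ ∑ i ∈ range #T, nu.1 i := by
  have card_eq : #(T \ range #T) = #(range #T \ T) := card_sdiff_comm (card_range _).symm
  rw [← sum_inter_add_sum_sdiff T (range #T), ← sum_inter_add_sum_sdiff (range #T) T, inter_comm]
  refine Nat.add_le_add_left ?_ _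
  calc ∑ i ∈ T \ range #T, nu.1 i
      ≤ ∑ _ ∈ T \ range #T, nu.1 #T :=
        sum_le_sum fun i hi => nu.2 (not_lt.1 (mt mem_range.2 (mem_sdiff.1 hi).2))
    _ = ∑ _ ∈ range #T \ T, nu.1 #T := by rw [sum_const, sum_const, card_eq]
    _ ≤ ∑ i ∈ range #T \ T, nu.1 i :=
        sum_le_sum fun i hi => nu.2 (mem_range.1 (mem_sdiff.1 hi).1).le

theorem sum_range_eq_size {k : ℕ} (h : nu.length ≤ k) : ∑ i ∈ range k, nu.1 i = nu.size := by
  rw [size_eq_sum_fin h, Fin.sum_univ_eq_sum_range (fun i => nu.1 i)]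

theorem size_add (lam mu : IntPartition) : (lam + mu).size = lam.size + mu.size := by
  have h₁ := le_max_left lam.length mu.length
  have h₂ := le_max_right lam.length mu.length
  rw [size_eq_sum_fin h₁, size_eq_sum_fin h₂, size_eq_sum_fin (length_add_le h₁ h₂),
    ← sum_add_distrib]
  rfl

theorem eq_of_sum_range_eq (h : ∀ k, ∑ i ∈ range k, nu.1 i = ∑ i ∈ range k, lam.1 i) :
    nu = lam := by
  refine Subtype.ext (Finsupp.ext fun k => ?_)
  have sum_succ := h (k + 1)
  rw [sum_range_succ, sum_range_succ, h k] at sum_succ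
  exact Nat.add_left_cancel sum_succ

end IntPartition

/-- The rearrangement of the exponent `e` to a partition is dominated by `lam`. Quantifying over
all sets of entries avoids the rearrangement. -/
def Below (lam : IntPartition) (e : Fin N →₀ ℕ) : Prop :=
  e.degree = lam.size ∧ ∀ T : Finset (Fin N), ∑ i ∈ T, e i ≤ ∑ k ∈ range #T, lam.1 k

variable {lam mu nu : IntPartition} {e e' : Fin N →₀ ℕ}

theorem below_zero : Below 0 (0 : Fin N →₀ ℕ) :=
  ⟨map_zero _, fun _ => sum_const_zero.trans_le (Nat.zero_le _)⟩

theorem Below.mapDomain (h : Below lam e) (s : Equiv.Perm (Fin N)) :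
    Below lam (e.mapDomain s) := by
  refine ⟨by rw [← sum_parts, parts_mapDomain, sum_parts, h.1], fun T => ?_⟩
  calc ∑ i ∈ T, e.mapDomain s i = ∑ i ∈ T.map s.symm.toEmbedding, e i := by
        simp only [sum_map, Equiv.coe_toEmbedding, Finsupp.mapDomain_equiv_apply]
    _ ≤ _ := by
        rw [← card_map s.symm.toEmbedding]
        exact h.2 _

theorem below_exponent (hN : nu.length ≤ N) (h : DominatedBy nu lam) :
    Below lam (exponent N nu.1) := by
  refine ⟨by rw [degree_exponent hN, h.1], fun T => le_trans ?_ (h.2 #T)⟩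
  have := sum_le_sum_range nu (T.map Fin.valEmbedding)
  rwa [sum_map, card_map] at this

theorem below_of_parts_eq (he : parts e = parts nu.1) (h : DominatedBy nu lam) : Below lam e := by
  obtain ⟨hN, s, rfl⟩ := exists_perm_of_parts_eq he
  exact (below_exponent hN h).mapDomain s

theorem Below.sum_filter_le (h : Below lam e) {k : ℕ} (hk : k ≤ N) :
    ∑ i : Fin N with i.1 < k, e i ≤ ∑ i ∈ range k, lam.1 i := by
  have := h.2 {i : Fin N | i.1 < k}
  rwa [card_filter_val_lt hk] at this

theorem Below.sum_range_le {x : ℕ →₀ ℕ} (h : Below lam (exponent N x)) {k : ℕ} (hk : k ≤ N) :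
    ∑ i ∈ range k, x i ≤ ∑ i ∈ range k, lam.1 i :=
  (sum_range_eq_sum_filter hk).trans_le (h.sum_filter_le hk)

theorem Below.dominatedBy (h : Below lam (exponent N nu.1)) (hnu : nu.length ≤ N)
    (hlam : lam.length ≤ N) : DominatedBy nu lam := by
  have size_eq : nu.size = lam.size := by rw [← h.1, degree_exponent hnu]
  refine ⟨size_eq, fun k => ?_⟩
  rcases le_total k N with hk | hk
  · exact h.sum_range_le hk
  · rw [sum_range_eq_size (hnu.trans hk), sum_range_eq_size (hlam.trans hk), size_eq]

theorem Below.add (h : Below lam e) (h' : Below mu e') : Below (lam + mu) (e + e') := by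
  refine ⟨by rw [map_add, h.1, h'.1, size_add], fun T => ?_⟩
  calc ∑ i ∈ T, (e + e') i = ∑ i ∈ T, e i + ∑ i ∈ T, e' i := sum_add_distrib
    _ ≤ ∑ i ∈ range #T, lam.1 i + ∑ i ∈ range #T, mu.1 i := add_le_add (h.2 T) (h'.2 T)
    _ = ∑ i ∈ range #T, (lam + mu).1 i := sum_add_distrib.symm

theorem Below.eq_of_add_eq (h : Below lam e) (h' : Below mu e')
    (hadd : e + e' = exponent N (lam + mu).1) :
    e = exponent N lam.1 ∧ e' = exponent N mu.1 := by
  have sum_eq (k : ℕ) (hk : k ≤ N) :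
      ∑ i : Fin N with i.1 < k, e i + ∑ i : Fin N with i.1 < k, e' i =
        ∑ i ∈ range k, lam.1 i + ∑ i ∈ range k, mu.1 i :=
    calc _ = ∑ i : Fin N with i.1 < k, (e + e') i := sum_add_distrib.symm
      _ = ∑ i ∈ range k, (lam + mu).1 i := by rw [hadd, sum_range_eq_sum_filter hk]
      _ = _ := sum_add_distrib
  constructor <;> refine eq_exponent_of_sum_filter_eq fun k hk => ?_ <;>
    linarith [sum_eq k hk, h.sum_filter_le hk, h'.sum_filter_le hk]

end Dominance

section IsBelow

variable {N : ℕ} {K : Type*} [CommSemiring K]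

/-- All exponents of `f` are below `lam` in the dominance order. -/
def IsBelow (lam : IntPartition) (f : MvPolynomial (Fin N) K) : Prop :=
  ∀ e, coeff e f ≠ 0 → Below lam e

variable {lam mu : IntPartition} {f g : MvPolynomial (Fin N) K}

theorem isBelow_one : IsBelow 0 (1 : MvPolynomial (Fin N) K) := by
  classical
  intro e he
  rw [coeff_one] at he
  obtain rfl := (ite_ne_right_iff.1 he).1
  exact below_zero

theorem IsBelow.mul (hf : IsBelow lam f) (hg : IsBelow mu g) : IsBelow (lam + mu) (f * g) := by
  intro e he
  rw [coeff_mul] at he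
  obtain ⟨p, hp, hne⟩ := exists_ne_zero_of_sum_ne_zero he
  rw [← HasAntidiagonal.mem_antidiagonal.1 hp]
  exact (hf _ (left_ne_zero_of_mul hne)).add (hg _ (right_ne_zero_of_mul hne))

theorem IsBelow.coeff_mul (hf : IsBelow lam f) (hg : IsBelow mu g) :
    coeff (exponent N (lam + mu).1) (f * g) =
      coeff (exponent N lam.1) f * coeff (exponent N mu.1) g := by
  have mem_antidiagonal :
      (exponent N lam.1, exponent N mu.1) ∈ antidiagonal (exponent N (lam + mu).1) :=
    HasAntidiagonal.mem_antidiagonal.2 (Finsupp.ext fun _ => rfl)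
  rw [MvPolynomial.coeff_mul, sum_eq_single_of_mem _ mem_antidiagonal]
  intro p hp hne
  by_contra h
  have := (hf _ (left_ne_zero_of_mul h)).eq_of_add_eq (hg _ (right_ne_zero_of_mul h))
    (HasAntidiagonal.mem_antidiagonal.1 hp)
  exact hne (Prod.ext this.1 this.2)

theorem IsBelow.prod {ι : Type*} {s : Finset ι} {lam : ι → IntPartition}
    {f : ι → MvPolynomial (Fin N) K} (h : ∀ i ∈ s, IsBelow (lam i) (f i)) :
    IsBelow (∑ i ∈ s, lam i) (∏ i ∈ s, f i) := by
  classical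
  induction s using Finset.induction with
  | empty => exact isBelow_one
  | insert i s hi ih =>
    rw [sum_insert hi, prod_insert hi]
    exact (h i (mem_insert_self i s)).mul (ih fun j hj => h j (mem_insert_of_mem hj))

theorem coeff_prod_of_isBelow {ι : Type*} {s : Finset ι} {lam : ι → IntPartition}
    {f : ι → MvPolynomial (Fin N) K} (h : ∀ i ∈ s, IsBelow (lam i) (f i)) :
    coeff (exponent N (∑ i ∈ s, lam i).1) (∏ i ∈ s, f i) =
      ∏ i ∈ s, coeff (exponent N (lam i).1) (f i) := by
  classical
  induction s using Finset.induction with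
  | empty =>
    rw [sum_empty, prod_empty, prod_empty]
    rw [coeff_one, if_pos (by ext i; rfl)]
  | insert i s hi ih =>
    have hs : ∀ j ∈ s, IsBelow (lam j) (f j) := fun j hj => h j (mem_insert_of_mem hj)
    rw [sum_insert hi, prod_insert hi, prod_insert hi,
      (h i (mem_insert_self i s)).coeff_mul (IsBelow.prod hs), ih hs]

theorem IsBelow.sub {K : Type*} [CommRing K] {f g : MvPolynomial (Fin N) K}
    (hf : IsBelow lam f) (hg : IsBelow lam g) : IsBelow lam (f - g) := by
  intro e he
  by_cases h : coeff e f = 0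
  · refine hg e fun h' => he ?_
    rw [coeff_sub, h, h', sub_zero]
  · exact hf e h

end IsBelow

section EigenZero

variable {N : ℕ}

/-- The value at `α = 0` of the eigenvalue `eigenvalue N lam` of the Laplace–Beltrami operator.
Unlike `(N - 1) * lam.size - lam.conj.b`, this form is additive in `lam` at sight. -/
def eigenZero (N : ℕ) (lam : IntPartition) : ℕ := ∑ i : Fin N, (N - 1 - i) * lam.1 i

theorem sum_range_sub_mul_eq (x : ℕ → ℕ) (n : ℕ) :
    ∑ i ∈ range n, (n - 1 - i) * x i = ∑ k ∈ range n, ∑ i ∈ range k, x i := by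
  induction n with
  | zero => rfl
  | succ n ih =>
    rw [sum_range_succ, sum_range_succ, ← ih, ← sum_add_distrib, Nat.add_sub_cancel, Nat.sub_self,
      zero_mul, add_zero]
    refine sum_congr rfl fun i hi => ?_
    have hi := mem_range.1 hi
    rw [← Nat.succ_mul, show (n - 1 - i).succ = n - i by omega]

theorem eigenZero_eq_sum_sum_range (lam : IntPartition) :
    eigenZero N lam = ∑ k ∈ range N, ∑ i ∈ range k, lam.1 i := by
  rw [eigenZero, Fin.sum_univ_eq_sum_range (fun i => (N - 1 - i) * lam.1 i), sum_range_sub_mul_eq]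

theorem conj_b_add_eigenZero_add_size {lam : IntPartition} (h : lam.length ≤ N) :
    lam.conj.b + eigenZero N lam + lam.size = N * lam.size := by
  rw [conj_b_eq_sum_fin h, eigenZero, size_eq_sum_fin h, mul_sum, ← sum_add_distrib,
    ← sum_add_distrib]
  refine sum_congr rfl fun i _ => ?_
  calc i * lam.1 i + (N - 1 - i) * lam.1 i + lam.1 i = (i + (N - 1 - i) + 1) * lam.1 i := by ring
    _ = N * lam.1 i := by rw [show i + (N - 1 - i) + 1 = N by omega]

theorem eigenvalue_eq_X_mul_add_eigenZero {lam : IntPartition} (h : lam.length ≤ N) :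
    eigenvalue N lam = RatFunc.X * (lam.b : QAlpha) + (eigenZero N lam : QAlpha) := by
  have cast_eq := congrArg (Nat.cast : ℕ → QAlpha) (conj_b_add_eigenZero_add_size h)
  push_cast at cast_eq
  rw [eigenvalue]
  linear_combination -cast_eq

theorem eigenZero_sum {ι : Type*} (s : Finset ι) (lam : ι → IntPartition) :
    eigenZero N (∑ i ∈ s, lam i) = ∑ i ∈ s, eigenZero N (lam i) := by
  simp only [eigenZero, coe_sum_apply, mul_sum]
  rw [sum_comm]

theorem Below.eigenZero_lt {lam nu : IntPartition} (h : Below lam (exponent N nu.1))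
    (hnu : nu.length ≤ N) (hlam : lam.length ≤ N) (hne : nu ≠ lam) :
    eigenZero N nu < eigenZero N lam := by
  rw [eigenZero_eq_sum_sum_range, eigenZero_eq_sum_sum_range]
  refine sum_lt_sum (fun k hk => h.sum_range_le (mem_range.1 hk).le) ?_
  by_contra! all_le
  refine hne (eq_of_sum_range_eq fun k => ?_)
  rcases lt_or_ge k N with hk | hk
  · exact (h.sum_range_le hk.le).antisymm (all_le k (mem_range.2 hk))
  · rw [sum_range_eq_size (hnu.trans hk), sum_range_eq_size (hlam.trans hk), ← h.1,
      degree_exponent hnu]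

end EigenZero

section Redistribute

variable {N : ℕ} {σ : Type*} {e : σ →₀ ℕ} {i j : σ} {a : ℕ}

theorem sum_redistribute {M : Type*} [AddCommMonoid M] (F : ℕ → M) (hij : i ≠ j) {T : Finset σ}
    (hi : i ∈ T) (hj : j ∈ T) (a : ℕ) :
    ∑ k ∈ T, F (redistribute e i j a k) + (F (e i) + F (e j)) =
      ∑ k ∈ T, F (e k) + (F a + F (e i + e j - a)) := by
  classical
  have split_sum (x : σ →₀ ℕ) : ∑ k ∈ T, F (x k) =
      F (x i) + (F (x j) + ∑ k ∈ (T.erase i).erase j, F (x k)) := by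
    rw [add_sum_erase _ (fun k => F (x k)) (mem_erase.2 ⟨hij.symm, hj⟩),
      add_sum_erase _ (fun k => F (x k)) hi]
  have rest_eq : ∑ k ∈ (T.erase i).erase j, F (redistribute e i j a k) =
      ∑ k ∈ (T.erase i).erase j, F (e k) := by
    refine sum_congr rfl fun k hk => ?_
    simp only [mem_erase] at hk
    rw [redistribute_apply, if_neg hk.1, if_neg hk.2.1]
  rw [split_sum, split_sum e, rest_eq]
  simp only [redistribute_apply, if_neg hij, if_true]
  abel

theorem degree_redistribute [Finite σ] (hij : i ≠ j) (ha : a ≤ e i + e j) :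
    (redistribute e i j a).degree = e.degree := by
  cases nonempty_fintype σ
  have := sum_redistribute (e := e) id hij (mem_univ i) (mem_univ j) a
  rw [Finsupp.degree_eq_sum, Finsupp.degree_eq_sum]
  simp only [id] at this
  omega

theorem sum_sq_lt_sum_sq_redistribute [Fintype σ] (hij : i ≠ j) (hle : e j ≤ e i)
    (ha : a ∈ Ioc (e i) (e i + e j)) : ∑ k, e k ^ 2 < ∑ k, redistribute e i j a k ^ 2 := by
  have sum_eq := sum_redistribute (e := e) (· ^ 2) hij (mem_univ i) (mem_univ j) a
  rw [mem_Ioc] at ha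
  obtain ⟨b, hb⟩ := Nat.exists_eq_add_of_le ha.2
  rw [show e i + e j - a = b by omega] at sum_eq
  -- With `a + b = e i + e j`, the sum of squares grows by `2 (a - e i) (a - e j)`.
  nlinarith [mul_pos (Nat.sub_pos_of_lt ha.1) (Nat.sub_pos_of_lt (hle.trans_lt ha.1)),
    Nat.sub_add_cancel ha.1.le, Nat.sub_add_cancel (hle.trans ha.1.le)]

theorem sum_le_sum_redistribute (hij : i ≠ j) (ha : a ∈ Ioc (e i) (e i + e j)) {T : Finset σ}
    (hT : j ∈ T → i ∈ T) : ∑ k ∈ T, e k ≤ ∑ k ∈ T, redistribute e i j a k := by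
  classical
  rw [mem_Ioc] at ha
  by_cases hj : j ∈ T
  · have := sum_redistribute (e := e) id hij (hT hj) hj a
    simp only [id] at this
    omega
  · refine sum_le_sum fun k hk => ?_
    rw [redistribute_apply, if_neg (ne_of_mem_of_not_mem hk hj)]
    split_ifs with hki
    · exact hki ▸ ha.1.le
    · exact le_rfl

theorem Below.of_redistribute {lam : IntPartition} {e : Fin N →₀ ℕ} {i j : Fin N} (hij : i ≠ j)
    (hle : e j ≤ e i) (ha : a ∈ Ioc (e i) (e i + e j)) (h : Below lam (redistribute e i j a)) :
    Below lam e := by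
  refine ⟨by rw [← h.1, degree_redistribute hij (mem_Ioc.1 ha).2], fun T => ?_⟩
  by_cases hT : j ∈ T → i ∈ T
  · exact (sum_le_sum_redistribute hij ha hT).trans (h.2 T)
  · obtain ⟨hj, hi⟩ := Classical.not_imp.1 hT
    have hi' : i ∉ T.erase j := fun h => hi (mem_of_mem_erase h)
    have card_eq : #(insert i (T.erase j)) = #T := by
      rw [card_insert_of_notMem hi', card_erase_add_one hj]
    calc ∑ k ∈ T, e k = e j + ∑ k ∈ T.erase j, e k := (add_sum_erase T _ hj).symm
      _ ≤ e i + ∑ k ∈ T.erase j, e k := Nat.add_le_add_right hle _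
      _ = ∑ k ∈ insert i (T.erase j), e k := (sum_insert hi').symm
      _ ≤ ∑ k ∈ insert i (T.erase j), redistribute e i j a k :=
          sum_le_sum_redistribute hij ha fun _ => mem_insert_self i _
      _ ≤ ∑ k ∈ range #T, lam.1 k := card_eq ▸ h.2 _

theorem not_below_redistribute {lam : IntPartition} {i j : Fin N} (hij : i < j)
    (ha : lam.1 i < a) : ¬ Below lam (redistribute (exponent N lam.1) i j a) := by
  intro h
  have sum_le := h.sum_filter_le (k := i + 1) i.2
  have sum_eq : ∑ k : Fin N with k.1 < i.1, redistribute (exponent N lam.1) i j a k =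
      ∑ k : Fin N with k.1 < i.1, exponent N lam.1 k := by
    refine sum_congr rfl fun k hk => ?_
    have hk : k < i := (mem_filter.1 hk).2
    rw [redistribute_apply, if_neg (hk.trans hij).ne, if_neg hk.ne]
  rw [sum_filter_lt_succ, sum_eq, ← sum_range_eq_sum_filter i.2.le, sum_range_succ,
    redistribute_apply, if_neg hij.ne, if_pos rfl] at sum_le
  omega

/-- The square of the sum minus the sum of the squares: a measure of exponents that decreases when
two entries are moved apart by `redistribute`. -/
def sqDefect (M : Multiset ℕ) : ℕ := M.sum ^ 2 - (M.map (· ^ 2)).sum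

theorem sqDefect_parts [Fintype σ] (e : σ →₀ ℕ) :
    sqDefect (parts e) = e.degree ^ 2 - ∑ i, e i ^ 2 := by
  rw [sqDefect, sum_parts, parts, Multiset.map_map]
  congr 1
  refine sum_subset (subset_univ e.support) fun i _ hi => ?_
  rw [Function.comp_apply, Finsupp.notMem_support_iff.1 hi, zero_pow two_ne_zero]

theorem sqDefect_redistribute_lt [Finite σ] (hij : i ≠ j) (hle : e j ≤ e i)
    (ha : a ∈ Ioc (e i) (e i + e j)) :
    sqDefect (parts (redistribute e i j a)) < sqDefect (parts e) := by
  cases nonempty_fintype σ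
  have degree_eq := degree_redistribute hij (mem_Ioc.1 ha).2
  have sum_lt := sum_sq_lt_sum_sq_redistribute hij hle ha
  have sum_sq_le : ∑ k, redistribute e i j a k ^ 2 ≤ (redistribute e i j a).degree ^ 2 := by
    rw [Finsupp.degree_eq_sum]
    exact sum_sq_le_sq_sum_of_nonneg fun i _ => Nat.zero_le _
  rw [degree_eq] at sum_sq_le
  rw [sqDefect_parts, sqDefect_parts, degree_eq]
  omega

theorem symmetric_induction {K : Type*} [CommSemiring K] {P : K → Prop}
    {f : MvPolynomial (Fin N) K} (hf : f.IsSymmetric)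
    (h : ∀ nu : IntPartition, nu.length ≤ N →
      (∀ i j : Fin N, i < j → ∀ a ∈ Ioc (nu.1 i) (nu.1 i + nu.1 j),
        P (coeff (redistribute (exponent N nu.1) i j a) f)) → P (coeff (exponent N nu.1) f))
    (e : Fin N →₀ ℕ) : P (coeff e f) := by
  induction hm : sqDefect (parts e) using Nat.strong_induction_on generalizing e with
  | _ m ih =>
    obtain ⟨nu, s, hnu, rfl⟩ := exists_eq_mapDomain_exponent e
    rw [coeff_mapDomain_of_isSymmetric hf]
    refine h nu hnu fun i j hij a ha => ih _ ?_ _ rfl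
    rw [← hm, parts_mapDomain]
    exact sqDefect_redistribute_lt hij.ne (nu.2 hij.le) ha

end Redistribute

section LaplaceBeltramiOp

variable {N : ℕ} {K : Type*} [CommRing K]

/-- The operator that agrees with the Laplace–Beltrami operator on symmetric polynomials; `c` is
half the Jack parameter. -/
noncomputable def laplaceBeltramiOp (c : K) (f : MvPolynomial (Fin N) K) :
    MvPolynomial (Fin N) K :=
  firstOrderOp f + C c * ∑ i, X i ^ 2 * pderiv i (pderiv i f)

theorem map_laplaceBeltramiOp {L : Type*} [CommRing L] (φ : K →+* L) (c : K)
    (f : MvPolynomial (Fin N) K) :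
    map φ (laplaceBeltramiOp c f) = laplaceBeltramiOp (φ c) (map φ f) := by
  simp only [laplaceBeltramiOp, map_add, map_mul, map_C, map_sum, map_pow, map_X,
    map_firstOrderOp, pderiv_map]

theorem coeff_X_mul_pderiv {σ : Type*} (i : σ) (f : MvPolynomial σ K) (e : σ →₀ ℕ) :
    coeff e (X i * pderiv i f) = e i * coeff e f := by
  classical
  induction f using MvPolynomial.induction_on' with
  | add p q hp hq => simp only [map_add, mul_add, coeff_add, hp, hq]
  | monomial m c =>
    rw [X_mul_pderiv_monomial, coeff_smul, coeff_monomial]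
    split_ifs with h
    · rw [h, nsmul_eq_mul]
    · rw [smul_zero, mul_zero]

theorem two_mul_choose_two_add (n : ℕ) : 2 * n.choose 2 + n = n * n := by
  rw [Nat.choose_two_right, Nat.mul_div_cancel' (Nat.even_mul_pred_self n).two_dvd,
    Nat.mul_sub_one, Nat.sub_add_cancel (Nat.le_mul_self n)]

theorem coeff_X_sq_mul_pderiv_pderiv {σ : Type*} (i : σ) (f : MvPolynomial σ K) (e : σ →₀ ℕ) :
    coeff e (X i ^ 2 * pderiv i (pderiv i f)) = 2 * ((e i).choose 2 : ℕ) * coeff e f := by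
  have euler_sq : X i ^ 2 * pderiv i (pderiv i f) =
      X i * pderiv i (X i * pderiv i f) - X i * pderiv i f := by
    rw [pderiv_mul, pderiv_X_self]
    ring
  have two_mul_choose : (2 * ((e i).choose 2 : ℕ) + e i : K) = e i * e i := by
    exact_mod_cast congrArg (Nat.cast : ℕ → K) (two_mul_choose_two_add (e i))
  rw [euler_sq, coeff_sub, coeff_X_mul_pderiv, coeff_X_mul_pderiv]
  linear_combination -coeff e f * two_mul_choose

theorem coeff_laplaceBeltramiOp (c : K) (f : MvPolynomial (Fin N) K) {nu : IntPartition}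
    (h : nu.length ≤ N) :
    coeff (exponent N nu.1) (laplaceBeltramiOp c f) =
      (2 * c * nu.b + eigenZero N nu) * coeff (exponent N nu.1) f +
      ∑ i : Fin N, ∑ j ∈ Ioi i, ∑ a ∈ Ioc (nu.1 i) (nu.1 i + nu.1 j),
        (2 * a - nu.1 i - nu.1 j) * coeff (redistribute (exponent N nu.1) i j a) f := by
  rw [laplaceBeltramiOp, coeff_add, coeff_firstOrderOp, coeff_C_mul, coeff_sum]
  simp_rw [coeff_X_sq_mul_pderiv_pderiv, ← sum_mul, ← mul_sum]
  rw [b_eq_sum_fin h, eigenZero]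
  push_cast
  simp only [exponent_apply]
  ring

variable [IsDomain K] [CharZero K]

theorem isSymmetric_laplaceBeltramiOp (c : K) {f : MvPolynomial (Fin N) K} (hf : f.IsSymmetric) :
    (laplaceBeltramiOp c f).IsSymmetric := by
  intro s
  rw [laplaceBeltramiOp, map_add, isSymmetric_firstOrderOp hf s, map_mul, rename_C, map_sum]
  congr 2
  refine Fintype.sum_equiv s _ _ fun i => ?_
  rw [map_mul, map_pow, rename_X, ← pderiv_rename s.injective, ← pderiv_rename s.injective, hf s]

theorem laplaceBeltrami_eq_algebraMap {f : MvPolynomial (Fin N) QAlpha} (hf : f.IsSymmetric) :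
    laplaceBeltrami N f = algebraMap _ _ (laplaceBeltramiOp (RatFunc.X / 2) f) := by
  let θ := algebraMap (MvPolynomial (Fin N) QAlpha) (FractionRing (MvPolynomial (Fin N) QAlpha))
  have inv_mul (i j : Fin N) (hij : i ≠ j) : (θ (X i) - θ (X j))⁻¹ * (θ (X i) - θ (X j)) = 1 := by
    rw [← map_sub]
    refine inv_mul_cancel₀ ?_
    rw [map_ne_zero_iff _ (IsFractionRing.injective _ _)]
    exact X_sub_X_ne_zero hij
  rw [laplaceBeltrami, laplaceBeltramiOp, map_add,
    ← sum_mul_map_pderiv_eq_map_firstOrderOp θ inv_mul hf]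
  simp only [div_eq_mul_inv, θ]

/-- The operator is triangular, so the eigenvalue belongs to one of the exponents of `f`. -/
theorem eq_zero_of_firstOrderOp_eq {f : MvPolynomial (Fin N) K} (hf : f.IsSymmetric) (n : ℕ)
    (hop : firstOrderOp f = C (n : K) * f)
    (hn : ∀ nu : IntPartition, nu.length ≤ N → coeff (exponent N nu.1) f ≠ 0 →
      eigenZero N nu ≠ n) : f = 0 := by
  ext e
  rw [coeff_zero]
  refine symmetric_induction (P := fun x => x = 0) hf (fun nu hnu ih => ?_) e
  by_contra hne
  have coeff_op := coeff_laplaceBeltramiOp 0 f hnu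
  rw [laplaceBeltramiOp, C_0, zero_mul, add_zero, hop, coeff_C_mul,
    sum_eq_zero (s := univ) fun i _ => sum_eq_zero fun j hj => sum_eq_zero fun a ha => by
      rw [ih i j (mem_Ioi.1 hj) a ha, mul_zero]] at coeff_op
  simp only [mul_zero, zero_mul, zero_add, add_zero] at coeff_op
  exact hn nu hnu hne (by exact_mod_cast (mul_right_cancel₀ hne coeff_op).symm)

end LaplaceBeltramiOp

section JackPolynomials

variable {N : ℕ} {K : Type*} [CommSemiring K]

theorem coeff_sum_monomialPoly (a : IntPartition →₀ K) {e : Fin N →₀ ℕ} {nu : IntPartition}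
    (h : parts e = parts nu.1) :
    coeff e (a.sum fun nu c => C c * monomialPoly N K nu) = a nu := by
  rw [Finsupp.sum, coeff_sum]
  simp_rw [coeff_C_mul, coeff_monomialPoly, h]
  rw [sum_eq_single nu]
  · rw [if_pos rfl, mul_one]
  · intro mu _ hne
    rw [if_neg fun h' => hne (eq_of_parts_eq h'.symm), mul_zero]
  · intro hnu
    rw [Finsupp.notMem_support_iff.1 hnu, zero_mul]

theorem isSymmetric_sum_monomialPoly (a : IntPartition →₀ K) :
    (a.sum fun nu c => C c * monomialPoly N K nu).IsSymmetric := by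
  intro s
  rw [Finsupp.sum, map_sum]
  exact sum_congr rfl fun nu _ =>
    ((MvPolynomial.IsSymmetric.C _).mul (isSymmetric_monomialPoly nu)) s

theorem IntPartition.dominatedBy_refl (lam : IntPartition) : DominatedBy lam lam :=
  ⟨rfl, fun _ => le_rfl⟩

variable {lam : IntPartition} {f : MvPolynomial (Fin N) QAlpha}

theorem isBelow_sum_monomialPoly {a : IntPartition →₀ K}
    (ha : ∀ nu ∈ a.support, DominatedBy nu lam) :
    IsBelow lam (a.sum fun nu c => C c * monomialPoly N K nu) := by
  intro e he
  obtain ⟨nu, -, hnu⟩ := exists_parts_eq e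
  rw [coeff_sum_monomialPoly a hnu.symm] at he
  exact below_of_parts_eq hnu.symm (ha nu (Finsupp.mem_support_iff.2 he))

theorem isJackPoly_iff : IsJackPoly N lam f ↔
    laplaceBeltrami N f = algebraMap _ _ (C (eigenvalue N lam) * f) ∧
    ∃ a : IntPartition →₀ QAlpha, a lam = hook lam ∧ (∀ nu ∈ a.support, DominatedBy nu lam) ∧
      f = a.sum fun nu c => C c * monomialPoly N QAlpha nu := by
  classical
  refine and_congr_right fun _ => ⟨?_, ?_⟩
  · rintro ⟨a, ha, rfl⟩
    have lam_eq_zero : a lam = 0 := by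
      by_contra hne
      exact (ha lam (Finsupp.mem_support_iff.2 hne)).2 rfl
    refine ⟨Finsupp.single lam (hook lam) + a, ?_, fun nu hnu => ?_, ?_⟩
    · rw [Finsupp.add_apply, Finsupp.single_eq_same, lam_eq_zero, add_zero]
    · rcases mem_union.1 (Finsupp.support_add hnu) with hsingle | hnu
      · rw [mem_singleton.1 (Finsupp.support_single_subset hsingle)]
        exact dominatedBy_refl lam
      · exact (ha nu hnu).1
    · rw [Finsupp.sum_add_index' (by simp) (by simp [add_mul]), Finsupp.sum_single_index (by simp)]
  · rintro ⟨a, hlam, ha, rfl⟩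
    refine ⟨a.erase lam, fun nu hnu => ?_, ?_⟩
    · rw [Finsupp.support_erase, mem_erase] at hnu
      exact ⟨ha nu hnu.2, hnu.1⟩
    · rw [← hlam,
        Finsupp.add_sum_erase' a lam (fun nu c => C c * monomialPoly N QAlpha nu) (by simp)]

theorem IsJackPoly.isSymmetric (h : IsJackPoly N lam f) : f.IsSymmetric := by
  obtain ⟨-, a, -, -, rfl⟩ := isJackPoly_iff.1 h
  exact isSymmetric_sum_monomialPoly a

theorem IsJackPoly.laplaceBeltramiOp_eq (h : IsJackPoly N lam f) :
    laplaceBeltramiOp (RatFunc.X / 2) f = C (eigenvalue N lam) * f := by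
  have eigen := h.1
  rw [laplaceBeltrami_eq_algebraMap h.isSymmetric] at eigen
  exact IsFractionRing.injective _ _ eigen

theorem IsJackPoly.isBelow (h : IsJackPoly N lam f) : IsBelow lam f := by
  obtain ⟨-, a, -, ha, rfl⟩ := isJackPoly_iff.1 h
  exact isBelow_sum_monomialPoly ha

theorem IsJackPoly.coeff_exponent (h : IsJackPoly N lam f) (hlam : lam.length ≤ N) :
    coeff (exponent N lam.1) f = hook lam := by
  obtain ⟨-, a, ha, -, rfl⟩ := isJackPoly_iff.1 h
  rw [coeff_sum_monomialPoly a (parts_exponent hlam), ha]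

end JackPolynomials

section Regular

variable {F : Type*} [Field F]

open scoped RatFunc LaurentSeries in
/-- The Laurent expansion of a rational function at `0`. -/
noncomputable def toLaurent (F : Type*) [Field F] : RatFunc F →+* LaurentSeries F :=
  algebraMap (RatFunc F) (LaurentSeries F)

open scoped RatFunc LaurentSeries in
theorem toLaurent_algebraMap (p : Polynomial F) :
    toLaurent F (algebraMap _ _ p) = HahnSeries.ofPowerSeries ℤ F p :=
  (RatFunc.coe_coe p).symm

theorem toLaurent_X : toLaurent F RatFunc.X = HahnSeries.ofPowerSeries ℤ F PowerSeries.X := by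
  rw [← RatFunc.algebraMap_X, toLaurent_algebraMap, Polynomial.coe_X]

/-- The rational functions without a pole at `0`, encoded as those whose Laurent expansion at `0`
is a power series. -/
noncomputable def regular (F : Type*) [Field F] : Subring (RatFunc F) :=
  (HahnSeries.ofPowerSeries ℤ F).range.comap (toLaurent F)

theorem mem_regular {x : RatFunc F} : x ∈ regular F ↔
    ∃ y : PowerSeries F, HahnSeries.ofPowerSeries ℤ F y = toLaurent F x :=
  Iff.rfl

theorem mem_regular_of_mul_mem {x z : RatFunc F} {y : PowerSeries F}
    (hy : PowerSeries.constantCoeff y ≠ 0) (hx : toLaurent F x = HahnSeries.ofPowerSeries ℤ F y)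
    (hxz : x * z ∈ regular F) : z ∈ regular F := by
  obtain ⟨w, hw⟩ := mem_regular.1 hxz
  refine mem_regular.2 ⟨y⁻¹ * w, ?_⟩
  rw [map_mul, hw, map_mul, hx, ← mul_assoc, ← map_mul, PowerSeries.inv_mul_cancel _ hy, map_one,
    one_mul]

theorem ne_zero_of_toLaurent_eq {x : RatFunc F} {y : PowerSeries F}
    (hy : PowerSeries.constantCoeff y ≠ 0) (hx : toLaurent F x = HahnSeries.ofPowerSeries ℤ F y) :
    x ≠ 0 := by
  rintro rfl
  rw [map_zero, eq_comm, map_eq_zero_iff _ HahnSeries.ofPowerSeries_injective] at hx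
  exact hy (by rw [hx, map_zero])

theorem toLaurent_hook (lam : IntPartition) :
    toLaurent ℚ (hook lam) = HahnSeries.ofPowerSeries ℤ ℚ (hookProd PowerSeries.X lam) := by
  rw [map_hookProd, ← toLaurent_X, ← map_hookProd]
  rfl

variable {N : ℕ} {lam nu : IntPartition} {f : MvPolynomial (Fin N) QAlpha}

theorem exists_toLaurent_eigenvalue_sub (h : Below lam (exponent N nu.1)) (hnu : nu.length ≤ N)
    (hlam : lam.length ≤ N) (hne : nu ≠ lam) :
    ∃ y : PowerSeries ℚ, PowerSeries.constantCoeff y ≠ 0 ∧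
      toLaurent ℚ (eigenvalue N lam - eigenvalue N nu) = HahnSeries.ofPowerSeries ℤ ℚ y := by
  have eigenZero_ne : (eigenZero N lam - eigenZero N nu : ℚ) ≠ 0 :=
    sub_ne_zero.2 (Nat.cast_injective.ne (h.eigenZero_lt hnu hlam hne).ne')
  refine ⟨PowerSeries.X * ((lam.b : PowerSeries ℚ) - (nu.b : PowerSeries ℚ)) +
    ((eigenZero N lam : PowerSeries ℚ) - (eigenZero N nu : PowerSeries ℚ)), ?_, ?_⟩
  · simpa only [map_add, map_mul, map_sub, map_natCast, PowerSeries.constantCoeff_X, zero_mul,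
      zero_add] using eigenZero_ne
  · rw [eigenvalue_eq_X_mul_add_eigenZero hlam, eigenvalue_eq_X_mul_add_eigenZero hnu]
    simp only [map_add, map_mul, map_sub, map_natCast, toLaurent_X]
    ring

theorem coeff_laplaceBeltramiOp_X_div_two (f : MvPolynomial (Fin N) QAlpha)
    (hnu : nu.length ≤ N) :
    coeff (exponent N nu.1) (laplaceBeltramiOp (RatFunc.X / 2) f) =
      eigenvalue N nu * coeff (exponent N nu.1) f +
      ∑ i : Fin N, ∑ j ∈ Ioi i, ∑ a ∈ Ioc (nu.1 i) (nu.1 i + nu.1 j),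
        (2 * a - nu.1 i - nu.1 j) * coeff (redistribute (exponent N nu.1) i j a) f := by
  rw [coeff_laplaceBeltramiOp _ _ hnu, eigenvalue_eq_X_mul_add_eigenZero hnu,
    mul_div_cancel₀ _ (two_ne_zero' QAlpha)]

/-- The eigenvector equation expresses the coefficient of `x ^ nu` through coefficients of more
spread out exponents, divided by a difference of eigenvalues that does not vanish at `α = 0`. -/
theorem IsJackPoly.coeff_mem_regular (h : IsJackPoly N lam f) (hlam : lam.length ≤ N)
    (e : Fin N →₀ ℕ) : coeff e f ∈ regular ℚ := by
  refine symmetric_induction (P := fun x => x ∈ regular ℚ) h.isSymmetric (fun nu hnu ih => ?_) e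
  by_cases hne : coeff (exponent N nu.1) f = 0
  · rw [hne]
    exact zero_mem _
  by_cases hnl : nu = lam
  · rw [hnl, h.coeff_exponent hlam]
    exact mem_regular.2 ⟨_, (toLaurent_hook lam).symm⟩
  have eigen := coeff_laplaceBeltramiOp_X_div_two f hnu
  rw [h.laplaceBeltramiOp_eq, coeff_C_mul, ← sub_eq_iff_eq_add', ← sub_mul] at eigen
  obtain ⟨y, hy, toLaurent_eq⟩ := exists_toLaurent_eigenvalue_sub (h.isBelow _ hne) hnu hlam hnl
  refine mem_regular_of_mul_mem hy toLaurent_eq (eigen ▸ ?_)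
  refine sum_mem fun i _ => sum_mem fun j hj => sum_mem fun a ha =>
    mul_mem ?_ (ih i j (mem_Ioi.1 hj) a ha)
  exact_mod_cast intCast_mem (regular ℚ) (2 * a - nu.1 i - nu.1 j : ℤ)

end Regular

section Existence

variable {N : ℕ} {lam nu : IntPartition}

theorem exists_forall_eq_of_wellFounded {ι M : Type*} [Zero M] {r : ι → ι → Prop}
    (hr : WellFounded r) (F : ι → (ι → M) → M)
    (hF : ∀ x A B, (∀ y, r y x → A y = B y) → F x A = F x B) : ∃ A : ι → M, ∀ x, A x = F x A := by
  classical
  let A : ι → M := hr.fix fun x rec => F x fun y => if h : r y x then rec y h else 0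
  refine ⟨A, fun x => ?_⟩
  have unfold_fix : A x = F x fun y => if _ : r y x then A y else 0 := hr.fix_eq _ x
  rw [unfold_fix]
  exact hF x _ _ fun y hy => dif_pos hy

theorem IntPartition.DominatedBy.length_le_size (h : DominatedBy nu lam) :
    nu.length ≤ lam.size := by
  rw [← h.1, length, size, Finsupp.sum, card_eq_sum_ones]
  exact sum_le_sum fun i hi => Nat.one_le_iff_ne_zero.2 (Finsupp.mem_support_iff.1 hi)

theorem IntPartition.finite_dominatedBy (lam : IntPartition) :
    {nu | DominatedBy nu lam}.Finite := by
  refine ((finite_toSet (finsuppAntidiag (range lam.size) lam.size)).preimage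
    Subtype.val_injective.injOn).subset fun (nu : IntPartition) hnu => ?_
  have length_le := hnu.length_le_size
  simp only [Set.mem_preimage, mem_coe, mem_finsuppAntidiag]
  refine ⟨by rw [sum_range_eq_size length_le, hnu.1], ?_⟩
  rw [nu.support_eq_range]
  exact range_subset_range.2 length_le

theorem parts_redistribute_exponent (hnu : nu.length ≤ N) (i j : Fin N) (a : ℕ) :
    parts (redistribute (exponent N nu.1) i j a) = parts (redistribute nu.1 i j a) := by
  have embDomain_eq : (exponent N (redistribute nu.1 i j a)).embDomain Fin.valEmbedding =
      redistribute nu.1 i j a := by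
    refine embDomain_exponent fun k hk => ?_
    by_contra h
    rw [redistribute_apply, if_neg (by omega), if_neg (by omega)] at hk
    exact h (length_le_iff.1 hnu k hk)
  rw [← embDomain_eq, parts_embDomain]
  congr 1
  ext k
  simp only [exponent_apply, redistribute_apply, Fin.ext_iff]

open Classical in
/-- The partition with the given multiset of parts; it is `0` if there is none, i.e. if `0` is among
the parts. -/
noncomputable def ofParts (M : Multiset ℕ) : IntPartition :=
  if h : ∃ nu : IntPartition, parts nu.1 = M then h.choose else 0

theorem parts_ofParts (e : Fin N →₀ ℕ) : parts (ofParts (parts e)).1 = parts e := by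
  have exists_partition : ∃ nu : IntPartition, parts nu.1 = parts e :=
    (exists_parts_eq e).imp fun _ => And.right
  rw [ofParts, dif_pos exists_partition]
  exact exists_partition.choose_spec

section RaiseSum

variable {K : Type*} [CommRing K]

/-- The contribution of the partitions above `nu` to the coefficient of `m_nu` in the image under
the Laplace–Beltrami operator of the symmetric function with coefficients `A`. -/
noncomputable def raiseSum (nu : IntPartition) (A : IntPartition → K) : K :=
  ∑ j ∈ range nu.length, ∑ i ∈ range j, ∑ a ∈ Ioc (nu.1 i) (nu.1 i + nu.1 j),
    (2 * a - nu.1 i - nu.1 j) * A (ofParts (parts (redistribute nu.1 i j a)))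

theorem raiseSum_eq (hnu : nu.length ≤ N) (A : IntPartition → K) :
    raiseSum nu A = ∑ i : Fin N, ∑ j ∈ Ioi i, ∑ a ∈ Ioc (nu.1 i) (nu.1 i + nu.1 j),
      (2 * a - nu.1 i - nu.1 j) *
        A (ofParts (parts (redistribute (exponent N nu.1) i j a))) := by
  simp_rw [parts_redistribute_exponent hnu]
  set G : ℕ → ℕ → K := fun i j => ∑ a ∈ Ioc (nu.1 i) (nu.1 i + nu.1 j),
    (2 * a - nu.1 i - nu.1 j) * A (ofParts (parts (redistribute nu.1 i j a))) with hG
  have eq_zero (i j : ℕ) (hj : nu.length ≤ j) : G i j = 0 := by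
    simp only [hG, apply_eq_zero hj, add_zero, Ioc_self, sum_empty]
  calc raiseSum nu A
    _ = ∑ j ∈ range N, ∑ i ∈ range j, G i j :=
      sum_subset (range_subset_range.2 hnu) fun j _ hj =>
        sum_eq_zero fun i _ => eq_zero i j (not_lt.1 (mt mem_range.2 hj))
    _ = ∑ j : Fin N, ∑ i ∈ Iio j, G i j := by
      rw [← Fin.sum_univ_eq_sum_range fun j => ∑ i ∈ range j, G i j]
      refine sum_congr rfl fun j _ => ?_
      rw [← Nat.Iio_eq_range, ← Fin.map_valEmbedding_Iio, sum_map]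
      rfl
    _ = ∑ i : Fin N, ∑ j ∈ Ioi i, G i j :=
      sum_comm' fun j i => by simp only [mem_univ, mem_Iio, mem_Ioi, true_and, and_true]

theorem raiseSum_congr {A B : IntPartition → K}
    (h : ∀ mu : IntPartition, sqDefect (parts mu.1) < sqDefect (parts nu.1) → A mu = B mu) :
    raiseSum nu A = raiseSum nu B := by
  rw [raiseSum_eq le_rfl, raiseSum_eq le_rfl]
  refine sum_congr rfl fun i _ => sum_congr rfl fun j hj => sum_congr rfl fun a ha => ?_
  rw [h]
  rw [parts_ofParts, ← parts_exponent (le_refl nu.length)]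
  exact sqDefect_redistribute_lt (mem_Ioi.1 hj).ne (nu.2 (mem_Ioi.1 hj).le) ha

theorem raiseSum_eq_zero {A : IntPartition → K} (hA : ∀ mu, A mu ≠ 0 → DominatedBy mu lam)
    (hnu : nu.length ≤ N) (hlam : lam.length ≤ N) (h : DominatedBy nu lam → nu = lam) :
    raiseSum nu A = 0 := by
  rw [raiseSum_eq hnu]
  refine sum_eq_zero fun i _ => sum_eq_zero fun j hj => sum_eq_zero fun a ha => ?_
  by_contra hne
  have below := below_of_parts_eq (parts_ofParts _).symm (hA _ (right_ne_zero_of_mul hne))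
  obtain rfl : nu = lam := h <| Below.dominatedBy
    (below.of_redistribute (mem_Ioi.1 hj).ne (nu.2 (mem_Ioi.1 hj).le) ha) hnu hlam
  exact not_below_redistribute (mem_Ioi.1 hj) (mem_Ioc.1 ha).1 below

end RaiseSum

theorem coeff_laplaceBeltramiOp_sum_monomialPoly (a : IntPartition →₀ QAlpha)
    (hnu : nu.length ≤ N) :
    coeff (exponent N nu.1)
      (laplaceBeltramiOp (RatFunc.X / 2) (a.sum fun nu c => C c * monomialPoly N QAlpha nu)) =
      eigenvalue N nu * a nu + raiseSum nu a := by
  rw [coeff_laplaceBeltramiOp_X_div_two _ hnu, coeff_sum_monomialPoly a (parts_exponent hnu),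
    raiseSum_eq hnu]
  simp_rw [coeff_sum_monomialPoly a (parts_ofParts _).symm]

theorem eigenvalue_sub_eigenvalue (h : nu.size = lam.size) (M N : ℕ) :
    eigenvalue M lam - eigenvalue M nu = eigenvalue N lam - eigenvalue N nu := by
  simp only [eigenvalue, h]
  ring

theorem eigenvalue_sub_ne_zero (h : DominatedBy nu lam) (hne : nu ≠ lam) (N : ℕ) :
    eigenvalue N lam - eigenvalue N nu ≠ 0 := by
  rw [eigenvalue_sub_eigenvalue h.1 N (max lam.length nu.length)]
  obtain ⟨y, hy, toLaurent_eq⟩ := exists_toLaurent_eigenvalue_sub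
    (below_exponent (le_max_right _ _) h) (le_max_right _ _) (le_max_left _ _) hne
  exact ne_zero_of_toLaurent_eq hy toLaurent_eq

/-- The eigenvector equation determines the coefficients recursively. It does not depend on the
number of variables, by `eigenvalue_sub_eigenvalue`, and is stated for none. -/
theorem exists_eigenvalue_sub_mul_eq_raiseSum (lam : IntPartition) : ∃ a : IntPartition →₀ QAlpha,
    a lam = hook lam ∧ (∀ nu, a nu ≠ 0 → DominatedBy nu lam) ∧
    ∀ nu, DominatedBy nu lam → nu ≠ lam →
      (eigenvalue 0 lam - eigenvalue 0 nu) * a nu = raiseSum nu a := by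
  classical
  obtain ⟨A, hA⟩ := exists_forall_eq_of_wellFounded
    (measure fun nu : IntPartition => sqDefect (parts nu.1)).wf
    (fun nu A => if nu = lam then hook lam else if DominatedBy nu lam then
      (eigenvalue 0 lam - eigenvalue 0 nu)⁻¹ * raiseSum nu A else 0)
    fun nu A B h => by simp only [raiseSum_congr h]
  have dominated (nu : IntPartition) (hnu : A nu ≠ 0) : DominatedBy nu lam := by
    by_contra h
    refine hnu ?_
    rw [hA, if_neg, if_neg h]
    rintro rfl
    exact h (dominatedBy_refl nu)
  refine ⟨Finsupp.onFinset (finite_dominatedBy lam).toFinset A fun nu hnu =>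
    (finite_dominatedBy lam).mem_toFinset.2 (dominated nu hnu), ?_, dominated, fun nu hnu hne => ?_⟩
  · exact (hA lam).trans (if_pos rfl)
  · simp only [Finsupp.onFinset_apply, Finsupp.coe_onFinset]
    conv_lhs => rw [hA nu, if_neg hne, if_pos hnu]
    exact mul_inv_cancel_left₀ (eigenvalue_sub_ne_zero hnu hne 0) _

theorem laplaceBeltramiOp_sum_monomialPoly {a : IntPartition →₀ QAlpha}
    (ha : ∀ nu, a nu ≠ 0 → DominatedBy nu lam)
    (hrec : ∀ nu, DominatedBy nu lam → nu ≠ lam →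
      (eigenvalue 0 lam - eigenvalue 0 nu) * a nu = raiseSum nu a) (hlam : lam.length ≤ N) :
    laplaceBeltramiOp (RatFunc.X / 2) (a.sum fun nu c => C c * monomialPoly N QAlpha nu) =
      C (eigenvalue N lam) * a.sum fun nu c => C c * monomialPoly N QAlpha nu := by
  have symm := isSymmetric_sum_monomialPoly (N := N) a
  refine eq_of_coeff_exponent_eq (isSymmetric_laplaceBeltramiOp _ symm)
    ((MvPolynomial.IsSymmetric.C _).mul symm) fun nu hnu => ?_
  rw [coeff_laplaceBeltramiOp_sum_monomialPoly a hnu, coeff_C_mul,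
    coeff_sum_monomialPoly a (parts_exponent hnu), ← eq_sub_iff_add_eq', ← sub_mul]
  by_cases h : DominatedBy nu lam ∧ nu ≠ lam
  · rw [eigenvalue_sub_eigenvalue h.1.1 N 0, hrec nu h.1 h.2]
  · rw [raiseSum_eq_zero ha hnu hlam fun hdom => not_not.1 fun hne => h ⟨hdom, hne⟩, eq_comm,
      mul_eq_zero]
    rcases eq_or_ne nu lam with rfl | hne
    · exact Or.inl (sub_self _)
    · exact Or.inr (not_not.1 fun ha' => h ⟨ha nu ha', hne⟩)

theorem isJackExpansion_jackCoeff (lam : IntPartition) : IsJackExpansion lam (jackCoeff lam) := by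
  have exists_expansion : ∃ a, IsJackExpansion lam a := by
    obtain ⟨a, hlam, ha, hrec⟩ := exists_eigenvalue_sub_mul_eq_raiseSum lam
    refine ⟨a, fun N hN => isJackPoly_iff.2
      ⟨?_, a, hlam, fun nu hnu => ha nu (Finsupp.mem_support_iff.1 hnu), rfl⟩⟩
    rw [laplaceBeltrami_eq_algebraMap (isSymmetric_sum_monomialPoly a),
      laplaceBeltramiOp_sum_monomialPoly ha hrec hN]
  rw [jackCoeff, dif_pos exists_expansion]
  exact exists_expansion.choose_spec

end Existence

section JackPolySeries

theorem jackCoeff_mem_regular (lam nu : IntPartition) : jackCoeff lam nu ∈ regular ℚ := by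
  have lam_le := le_max_left lam.length nu.length
  have isJackPoly := isJackExpansion_jackCoeff lam _ lam_le
  rw [← coeff_sum_monomialPoly (jackCoeff lam) (parts_exponent (le_max_right lam.length nu.length))]
  exact isJackPoly.coeff_mem_regular lam_le _

theorem exists_ofPowerSeries_eq_toLaurent_jackCoeff (lam : IntPartition) :
    ∃ a : IntPartition →₀ PowerSeries ℚ,
      ∀ nu, HahnSeries.ofPowerSeries ℤ ℚ (a nu) = toLaurent ℚ (jackCoeff lam nu) := by
  choose g hg using fun nu => mem_regular.1 (jackCoeff_mem_regular lam nu)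
  refine ⟨Finsupp.onFinset (jackCoeff lam).support g fun nu hnu => ?_, hg⟩
  rw [Finsupp.mem_support_iff]
  intro coeff_eq_zero
  have map_eq_zero := hg nu
  rw [coeff_eq_zero, map_zero] at map_eq_zero
  exact hnu ((map_eq_zero_iff _ HahnSeries.ofPowerSeries_injective).1 map_eq_zero)

/-- The expansions at `α = 0` of the coefficients of the Jack symmetric function in the basis of
monomial symmetric functions. -/
noncomputable def jackCoeffSeries (lam : IntPartition) : IntPartition →₀ PowerSeries ℚ :=
  (exists_ofPowerSeries_eq_toLaurent_jackCoeff lam).choose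

theorem ofPowerSeries_jackCoeffSeries (lam nu : IntPartition) :
    HahnSeries.ofPowerSeries ℤ ℚ (jackCoeffSeries lam nu) = toLaurent ℚ (jackCoeff lam nu) :=
  (exists_ofPowerSeries_eq_toLaurent_jackCoeff lam).choose_spec nu

/-- The Jack polynomial in `N` variables with coefficients expanded at `α = 0`. -/
noncomputable def jackPolySeries (N : ℕ) (lam : IntPartition) :
    MvPolynomial (Fin N) (PowerSeries ℚ) :=
  (jackCoeffSeries lam).sum fun nu c => C c * monomialPoly N (PowerSeries ℚ) nu

variable {N : ℕ} {lam : IntPartition}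

theorem isSymmetric_jackPolySeries : (jackPolySeries N lam).IsSymmetric :=
  isSymmetric_sum_monomialPoly _

theorem map_ofPowerSeries_jackPolySeries :
    map (HahnSeries.ofPowerSeries ℤ ℚ) (jackPolySeries N lam) =
      map (toLaurent ℚ) ((jackCoeff lam).sum fun nu c => C c * monomialPoly N QAlpha nu) := by
  ext1 e
  obtain ⟨nu, -, h⟩ := exists_parts_eq e
  rw [coeff_map, coeff_map, jackPolySeries, coeff_sum_monomialPoly _ h.symm,
    coeff_sum_monomialPoly _ h.symm, ofPowerSeries_jackCoeffSeries]

theorem ofPowerSeries_coeff_jackPolySeries (e : Fin N →₀ ℕ) :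
    HahnSeries.ofPowerSeries ℤ ℚ (coeff e (jackPolySeries N lam)) =
      toLaurent ℚ (coeff e ((jackCoeff lam).sum fun nu c => C c * monomialPoly N QAlpha nu)) := by
  rw [← coeff_map, map_ofPowerSeries_jackPolySeries, coeff_map]

theorem isBelow_jackPolySeries (h : lam.length ≤ N) : IsBelow lam (jackPolySeries N lam) := by
  intro e he
  refine (isJackExpansion_jackCoeff lam N h).isBelow e fun coeff_eq_zero => he ?_
  have map_eq_zero := ofPowerSeries_coeff_jackPolySeries (lam := lam) e
  rw [coeff_eq_zero, map_zero] at map_eq_zero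
  exact (map_eq_zero_iff _ HahnSeries.ofPowerSeries_injective).1 map_eq_zero

theorem coeff_exponent_jackPolySeries (h : lam.length ≤ N) :
    coeff (exponent N lam.1) (jackPolySeries N lam) = hookProd PowerSeries.X lam := by
  apply HahnSeries.ofPowerSeries_injective (Γ := ℤ)
  rw [ofPowerSeries_coeff_jackPolySeries, (isJackExpansion_jackCoeff lam N h).coeff_exponent h,
    toLaurent_hook]

theorem toLaurent_X_div_two : toLaurent ℚ (RatFunc.X / 2) =
    HahnSeries.ofPowerSeries ℤ ℚ (PowerSeries.C (1 / 2) * PowerSeries.X) := by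
  have two_mul_eq : (2 : PowerSeries ℚ) * PowerSeries.C (1 / 2) = 1 := by
    rw [← map_ofNat (PowerSeries.C (R := ℚ)), ← map_mul, mul_one_div_cancel two_ne_zero, map_one]
  refine mul_left_cancel₀ ((map_ne_zero (toLaurent ℚ)).2 (two_ne_zero (α := QAlpha))) ?_
  rw [← map_mul, mul_div_cancel₀ _ two_ne_zero, toLaurent_X, map_ofNat,
    ← map_ofNat (HahnSeries.ofPowerSeries ℤ ℚ), ← map_mul, ← mul_assoc, two_mul_eq, one_mul]

theorem laplaceBeltramiOp_jackPolySeries (h : lam.length ≤ N) :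
    laplaceBeltramiOp (PowerSeries.C (1 / 2 : ℚ) * PowerSeries.X) (jackPolySeries N lam) =
      C (PowerSeries.X * (lam.b : PowerSeries ℚ) + (eigenZero N lam : PowerSeries ℚ)) *
        jackPolySeries N lam := by
  apply map_injective (HahnSeries.ofPowerSeries ℤ ℚ) HahnSeries.ofPowerSeries_injective
  have eigen := congrArg (map (toLaurent ℚ))
    (isJackExpansion_jackCoeff lam N h).laplaceBeltramiOp_eq
  rw [map_laplaceBeltramiOp, map_mul, map_C, ← map_ofPowerSeries_jackPolySeries,
    eigenvalue_eq_X_mul_add_eigenZero h, toLaurent_X_div_two] at eigen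
  rw [map_laplaceBeltramiOp, eigen, map_mul (MvPolynomial.map _), MvPolynomial.map_C]
  simp only [map_add, map_mul, map_natCast, toLaurent_X]

end JackPolySeries

section Derivations

variable {k S : Type*} [CommRing k] [CommRing S] [Algebra k S]

section Localization

variable (R : Type*) [CommRing R] [Algebra S R] [Algebra k R] [IsScalarTower k S R]
  (M : Submonoid S) [IsLocalization M R]

/-- The extension of a derivation to a localization, obtained from the compatibility of Kähler
differentials with localization. -/
noncomputable def localizedDerivation (D : Derivation k S S) : Derivation k R R :=
  (LinearMap.extendScalarsOfIsLocalization M R <|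
    IsLocalizedModule.lift M (KaehlerDifferential.map k k S R)
      ((Algebra.linearMap S R).compDer D).liftKaehlerDifferential
      (IsLocalizedModule.map_units (Algebra.linearMap S R))).compDer (KaehlerDifferential.D k R)

theorem localizedDerivation_algebraMap (D : Derivation k S S) (s : S) :
    localizedDerivation R M D (algebraMap S R s) = algebraMap S R (D s) := by
  change LinearMap.extendScalarsOfIsLocalization M R _ (KaehlerDifferential.D k R _) = _
  rw [LinearMap.extendScalarsOfIsLocalization_apply', ← KaehlerDifferential.map_D k k S R,
    IsLocalizedModule.lift_apply, Derivation.liftKaehlerDifferential_comp_D]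
  rfl

end Localization

/-- The extension of a derivation to power series, applied to each coefficient. -/
noncomputable def coeffwise (D : Derivation k S S) : Derivation k (PowerSeries S) (PowerSeries S) :=
  Derivation.mk'
    { toFun := fun f => PowerSeries.mk fun n => D (PowerSeries.coeff n f)
      map_add' := fun f g => by ext n; simp
      map_smul' := fun c f => by ext n; simp }
    fun f g => by
      ext n
      simp only [LinearMap.coe_mk, AddHom.coe_mk, smul_eq_mul, map_add, PowerSeries.coeff_mk,
        mul_comm g, PowerSeries.coeff_mul, map_sum, Derivation.leibniz, ← sum_add_distrib]
      exact sum_congr rfl fun p _ => by ring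

theorem coeff_coeffwise (D : Derivation k S S) (f : PowerSeries S) (n : ℕ) :
    PowerSeries.coeff n (coeffwise D f) = D (PowerSeries.coeff n f) :=
  PowerSeries.coeff_mk n fun n => D (PowerSeries.coeff n f)

theorem coeffwise_X (D : Derivation k S S) : coeffwise D PowerSeries.X = 0 := by
  ext n
  rw [coeff_coeffwise, PowerSeries.coeff_X]
  split_ifs
  · rw [Derivation.map_one_eq_zero, map_zero]
  · rw [map_zero, map_zero]

theorem coeffwise_map {R : Type*} [CommRing R] [Algebra k R] {D : Derivation k S S}
    {D' : Derivation k R R} {φ : S →+* R} (h : ∀ s, D' (φ s) = φ (D s)) (f : PowerSeries S) :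
    coeffwise D' (PowerSeries.map φ f) = PowerSeries.map φ (coeffwise D f) := by
  ext n
  simp only [coeff_coeffwise, PowerSeries.coeff_map, h]

end Derivations

section ToSeries

variable {σ k : Type*} [CommRing k]

/-- Polynomials over a power series ring as power series over the polynomial ring. -/
noncomputable def toSeries : MvPolynomial σ (PowerSeries k) →+* PowerSeries (MvPolynomial σ k) :=
  eval₂Hom (PowerSeries.map C) fun i => PowerSeries.C (X i)

theorem toSeries_C (a : PowerSeries k) :
    toSeries (C a : MvPolynomial σ (PowerSeries k)) = PowerSeries.map C a :=
  eval₂Hom_C _ _ a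

theorem toSeries_X (i : σ) :
    toSeries (X i : MvPolynomial σ (PowerSeries k)) = PowerSeries.C (X i) :=
  eval₂Hom_X' _ _ i

theorem coeff_toSeries (n : ℕ) (f : MvPolynomial σ (PowerSeries k)) (e : σ →₀ ℕ) :
    coeff e (PowerSeries.coeff n (toSeries f)) = PowerSeries.coeff n (coeff e f) := by
  classical
  induction f using MvPolynomial.induction_on' with
  | add p q hp hq => simp only [map_add, coeff_add, hp, hq]
  | monomial d a =>
    have toSeries_monomial : toSeries (monomial d a) =
        PowerSeries.map C a * PowerSeries.C (monomial d 1) := by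
      rw [toSeries, eval₂Hom_monomial, monomial_eq, C_1, one_mul, Finsupp.prod, Finsupp.prod,
        map_prod]
      simp only [map_pow]
    rw [toSeries_monomial, PowerSeries.coeff_mul_C, PowerSeries.coeff_map, C_mul_monomial, mul_one,
      coeff_monomial, coeff_monomial]
    split_ifs
    · rfl
    · rw [map_zero]

theorem toSeries_pderiv (i : σ) (f : MvPolynomial σ (PowerSeries k)) :
    toSeries (pderiv i f) = coeffwise (pderiv i) (toSeries f) := by
  ext n e
  rw [coeff_toSeries, coeff_coeffwise, coeff_pderiv, coeff_pderiv, coeff_toSeries]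
  exact_mod_cast PowerSeries.coeff_mul_C n _ ((e i + 1 : ℕ) : k)

theorem constantCoeff_toSeries (f : MvPolynomial σ (PowerSeries k)) :
    PowerSeries.constantCoeff (toSeries f) = map PowerSeries.constantCoeff f := by
  ext e
  rw [← PowerSeries.coeff_zero_eq_constantCoeff_apply, coeff_toSeries, coeff_map,
    PowerSeries.coeff_zero_eq_constantCoeff_apply]

theorem X_pow_dvd_toSeries_iff {m : ℕ} {f : MvPolynomial σ (PowerSeries k)} :
    PowerSeries.X ^ m ∣ toSeries f ↔ C (PowerSeries.X ^ m) ∣ f := by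
  simp only [C_dvd_iff_dvd_coeff, PowerSeries.X_pow_dvd_iff, MvPolynomial.ext_iff, coeff_toSeries,
    coeff_zero]
  exact ⟨fun h e n hn => h n hn e, fun h n hn e => h e n hn⟩

theorem X_pow_dvd_map_iff {S R : Type*} [CommSemiring S] [CommSemiring R] {φ : S →+* R}
    (hφ : Function.Injective φ) {m : ℕ} {f : PowerSeries S} :
    PowerSeries.X ^ m ∣ PowerSeries.map φ f ↔ PowerSeries.X ^ m ∣ f := by
  simp only [PowerSeries.X_pow_dvd_iff, PowerSeries.coeff_map, map_eq_zero_iff φ hφ]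

end ToSeries

section EvenOddProducts

variable {ι M G O : Type*}

/-- The product of `f I` over the subsets `I` of `S` of even cardinality; `evenSum` is the additive
version. -/
@[to_additive]
def evenProd [CommMonoid M] (S : Finset ι) (f : Finset ι → M) : M :=
  ∏ I ∈ S.powerset with ¬Odd #I, f I

/-- The product of `f I` over the subsets `I` of `S` of odd cardinality; `oddSum` is the additive
version. -/
@[to_additive]
def oddProd [CommMonoid M] (S : Finset ι) (f : Finset ι → M) : M :=
  ∏ I ∈ S.powerset with Odd #I, f I

theorem map_evenProd {N F : Type*} [CommMonoid M] [CommMonoid N] [FunLike F M N]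
    [MonoidHomClass F M N] (φ : F) (S : Finset ι) (f : Finset ι → M) :
    φ (evenProd S f) = evenProd S fun I => φ (f I) :=
  map_prod φ _ _

theorem map_oddProd {N F : Type*} [CommMonoid M] [CommMonoid N] [FunLike F M N]
    [MonoidHomClass F M N] (φ : F) (S : Finset ι) (f : Finset ι → M) :
    φ (oddProd S f) = oddProd S fun I => φ (f I) :=
  map_prod φ _ _

@[to_additive]
theorem altProd_mul_oddProd [CommGroup G] (S : Finset ι) (u : Finset ι → G) :
    altProd S u * oddProd S u = evenProd S u := by
  have odd_factors : ∏ I ∈ S.powerset with Odd #I, u I ^ ((-1 : ℤ) ^ #I) * u I = 1 :=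
    prod_eq_one fun I hI => by
      rw [(mem_filter.1 hI).2.neg_one_pow, zpow_neg_one, inv_mul_cancel]
  rw [altProd, ← prod_filter_mul_prod_filter_not S.powerset (fun I => Odd #I), oddProd,
    mul_right_comm, ← prod_mul_distrib, odd_factors, one_mul]
  refine prod_congr rfl fun I hI => ?_
  rw [(Nat.not_odd_iff_even.1 (mem_filter.1 hI).2).neg_one_pow, zpow_one]

theorem val_altProd_mul_oddProd [CommRing O] (S : Finset ι) (u : Finset ι → Oˣ) :
    ((altProd S u : Oˣ) : O) * oddProd S (fun I => (u I : O)) = evenProd S fun I => (u I : O) := by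
  simpa only [map_mul, map_oddProd, map_evenProd, Units.coeHom_apply] using
    congrArg (Units.coeHom O) (altProd_mul_oddProd S u)

theorem dvd_altProd_sub_one_iff [CommRing O] {S : Finset ι} {u : Finset ι → Oˣ} {c : O} :
    c ∣ ((altProd S u : Oˣ) : O) - 1 ↔
      c ∣ evenProd S (fun I => (u I : O)) - oddProd S fun I => (u I : O) := by
  have isUnit_oddProd : IsUnit (oddProd S fun I => (u I : O)) :=
    ⟨oddProd S u, map_oddProd (Units.coeHom O) S u⟩
  rw [← val_altProd_mul_oddProd, ← sub_one_mul, isUnit_oddProd.dvd_mul_right]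

end EvenOddProducts

section AlternatingEigenvalues

variable {ι M O : Type*} {S : Finset ι}

theorem altSum_sum_eq_zero [AddCommGroup M] (hS : 2 ≤ #S) (v : ι → M) :
    altSum S (fun I => ∑ i ∈ I, v i) = 0 := by
  classical
  have filter_eq {I : Finset ι} (hI : I ⊆ S) : {i ∈ S | {i} ⊆ I} = I := by
    simp only [singleton_subset_iff, filter_mem_eq_inter, inter_eq_right.2 hI]
  calc altSum S (fun I => ∑ i ∈ I, v i)
      = altSum S fun I => ∑ i ∈ S with {i} ⊆ I, v i :=
        altSum_congr fun I hI => by rw [filter_eq hI]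
    _ = ∑ i ∈ S with {i} = S, (-1 : ℤ) ^ #S • v i :=
        altSum_sum_of_subset S S _ (fun i hi => singleton_subset_iff.2 hi) v
    _ = 0 := sum_eq_zero fun i hi => by
        rw [← (mem_filter.1 hi).2, card_singleton] at hS
        omega

theorem altSum_sq_sum_eq_zero [CommRing O] (hS : 3 ≤ #S) (v : ι → O) :
    altSum S (fun I => (∑ i ∈ I, v i) ^ 2) = 0 := by
  classical
  have filter_eq {I : Finset ι} (hI : I ⊆ S) : {p ∈ S ×ˢ S | {p.1, p.2} ⊆ I} = I ×ˢ I := by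
    ext p
    simp only [mem_filter, insert_subset_iff, singleton_subset_iff, mem_product]
    exact ⟨And.right, fun hp => ⟨⟨hI hp.1, hI hp.2⟩, hp⟩⟩
  calc altSum S (fun I => (∑ i ∈ I, v i) ^ 2)
      = altSum S fun I => ∑ p ∈ S ×ˢ S with {p.1, p.2} ⊆ I, v p.1 * v p.2 :=
        altSum_congr fun I hI => by rw [filter_eq hI, sq, sum_mul_sum, ← sum_product']
    _ = ∑ p ∈ S ×ˢ S with {p.1, p.2} = S, (-1 : ℤ) ^ #S • (v p.1 * v p.2) :=
        altSum_sum_of_subset S (S ×ˢ S) _ (fun p hp => insert_subset_iff.2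
          ⟨(mem_product.1 hp).1, singleton_subset_iff.2 (mem_product.1 hp).2⟩) _
    _ = 0 := sum_eq_zero fun p hp => by
        rw [← (mem_filter.1 hp).2] at hS
        exact absurd (hS.trans card_le_two) (by decide)

variable (lam : ι → IntPartition)

theorem altSum_eigenZero (N : ℕ) (hS : 2 ≤ #S) :
    altSum S (fun I => (eigenZero N (∑ i ∈ I, lam i) : ℤ)) = 0 := by
  simp_rw [eigenZero_sum, Nat.cast_sum]
  exact altSum_sum_eq_zero hS _

theorem altSum_b (hS : 3 ≤ #S) : altSum S (fun I => ((∑ i ∈ I, lam i).b : ℤ)) = 0 := by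
  set N := S.sup fun i => (lam i).length
  have two_mul_b {I : Finset ι} (hI : I ⊆ S) : 2 * ((∑ i ∈ I, lam i).b : ℤ) =
      ∑ k : Fin N, ((∑ i ∈ I, ((lam i).1 k : ℤ)) ^ 2 + -1 * ∑ i ∈ I, ((lam i).1 k : ℤ)) := by
    rw [b_eq_sum_fin (length_sum_le fun i hi => le_sup (f := fun i => (lam i).length) (hI hi)),
      Nat.cast_sum, mul_sum]
    refine sum_congr rfl fun k _ => ?_
    have two_mul_choose := congrArg (Nat.cast : ℕ → ℤ)
      (two_mul_choose_two_add ((∑ i ∈ I, lam i).1 k))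
    rw [coe_sum_apply] at two_mul_choose ⊢
    push_cast at two_mul_choose ⊢
    linear_combination two_mul_choose
  refine (mul_eq_zero.1 (?_ : (2 : ℤ) * _ = 0)).resolve_left two_ne_zero
  rw [← altSum_const_mul, altSum_congr fun I => two_mul_b, altSum_sum]
  refine sum_eq_zero fun k _ => ?_
  rw [altSum_add, altSum_const_mul, altSum_sq_sum_eq_zero hS, altSum_sum_eq_zero (by omega),
    mul_zero, add_zero]

theorem X_pow_dvd_altSum_eigenvalue [CommRing O] (N : ℕ) (S : Finset ι) :
    (PowerSeries.X : PowerSeries O) ^ (#S - 1) ∣ altSum S fun I =>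
      PowerSeries.X * ((∑ i ∈ I, lam i).b : PowerSeries O) +
        (eigenZero N (∑ i ∈ I, lam i) : PowerSeries O) := by
  have altSum_natCast (n : Finset ι → ℕ) : altSum S (fun I => (n I : PowerSeries O)) =
      ((altSum S fun I => (n I : ℤ) : ℤ) : PowerSeries O) := by
    simpa only [eq_intCast, Int.cast_natCast] using
      (map_altSum (Int.castRingHom (PowerSeries O)) S fun I => (n I : ℤ)).symm
  rw [altSum_add, altSum_const_mul, altSum_natCast, altSum_natCast]
  obtain card_le | card_eq | le_card : #S ≤ 1 ∨ #S = 2 ∨ 3 ≤ #S := by omega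
  · rw [Nat.sub_eq_zero_of_le card_le, pow_zero]
    exact one_dvd _
  · rw [altSum_eigenZero lam N card_eq.ge, Int.cast_zero, add_zero, card_eq, pow_one]
    exact dvd_mul_right _ _
  · rw [altSum_eigenZero lam N (by omega), altSum_b lam le_card, Int.cast_zero, mul_zero, add_zero]
    exact dvd_zero _

theorem evenSum_sum_eq_oddSum_sum (hS : 2 ≤ #S) :
    evenSum S (fun I => ∑ i ∈ I, lam i) = oddSum S fun I => ∑ i ∈ I, lam i := by
  apply Subtype.ext
  ext k
  have cast_eq := altSum_add_oddSum S fun I => ∑ i ∈ I, ((lam i).1 k : ℤ)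
  rw [altSum_sum_eq_zero hS, zero_add] at cast_eq
  simp only [evenSum, oddSum, coe_sum_apply] at cast_eq ⊢
  exact_mod_cast cast_eq.symm

end AlternatingEigenvalues

section FirstOrderDerivation

variable {N : ℕ} {k : Type*} [CommRing k] [IsDomain k] [CharZero k]

theorem firstOrderOp_mul {f g : MvPolynomial (Fin N) k} (hf : f.IsSymmetric) (hg : g.IsSymmetric) :
    firstOrderOp (f * g) = firstOrderOp f * g + f * firstOrderOp g := by
  let θ := algebraMap (MvPolynomial (Fin N) k) (FractionRing (MvPolynomial (Fin N) k))
  have inv_mul_X_sub_X (i j : Fin N) (hij : i ≠ j) :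
      (θ (X i) - θ (X j))⁻¹ * (θ (X i) - θ (X j)) = 1 := by
    rw [← map_sub]
    exact inv_mul_cancel₀ ((map_ne_zero_iff θ (IsFractionRing.injective _ _)).2
      (X_sub_X_ne_zero hij))
  have expand {p : MvPolynomial (Fin N) k} (hp : p.IsSymmetric) :=
    (sum_mul_map_pderiv_eq_map_firstOrderOp θ inv_mul_X_sub_X hp).symm
  apply IsFractionRing.injective (MvPolynomial (Fin N) k) (FractionRing (MvPolynomial (Fin N) k))
  change θ _ = θ _
  simp only [map_add, map_mul, expand (hf.mul hg), expand hf, expand hg, pderiv_mul, sum_mul,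
    mul_sum, ← sum_add_distrib]
  exact sum_congr rfl fun i _ => sum_congr rfl fun j _ => by ring

theorem firstOrderOp_one : firstOrderOp (1 : MvPolynomial (Fin N) k) = 0 := by
  simpa using firstOrderOp_mul (N := N) (k := k) IsSymmetric.one IsSymmetric.one

theorem isSymmetric_prod {σ κ K : Type*} [CommRing K] {s : Finset κ} {f : κ → MvPolynomial σ K}
    (hf : ∀ i ∈ s, (f i).IsSymmetric) : (∏ i ∈ s, f i).IsSymmetric :=
  prod_mem (S := symmetricSubalgebra σ K) hf

theorem firstOrderOp_prod {κ : Type*} {s : Finset κ} {a : κ → k} {f : κ → MvPolynomial (Fin N) k}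
    (hf : ∀ i ∈ s, (f i).IsSymmetric) (h : ∀ i ∈ s, firstOrderOp (f i) = C (a i) * f i) :
    firstOrderOp (∏ i ∈ s, f i) = C (∑ i ∈ s, a i) * ∏ i ∈ s, f i := by
  classical
  induction s using Finset.induction with
  | empty => rw [prod_empty, sum_empty, firstOrderOp_one, C_0, zero_mul]
  | insert i s hi ih =>
    obtain ⟨hf_i, hf_s⟩ := forall_mem_insert .. |>.1 hf
    obtain ⟨h_i, h_s⟩ := forall_mem_insert .. |>.1 h
    rw [prod_insert hi, sum_insert hi, firstOrderOp_mul hf_i (isSymmetric_prod hf_s), h_i,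
      ih hf_s h_s, C_add]
    ring

end FirstOrderDerivation

section RationalSeries

variable {σ k : Type*} [CommRing k] (R : Type*) [Field R] [Algebra (MvPolynomial σ k) R]

/-- Polynomials over a power series ring as power series over a field of rational functions. -/
noncomputable def toRatSeries : MvPolynomial σ (PowerSeries k) →+* PowerSeries R :=
  (PowerSeries.map (algebraMap (MvPolynomial σ k) R)).comp toSeries

theorem toRatSeries_apply (f : MvPolynomial σ (PowerSeries k)) :
    toRatSeries R f = PowerSeries.map (algebraMap (MvPolynomial σ k) R) (toSeries f) :=
  rfl

theorem toRatSeries_X (i : σ) : toRatSeries R (X i : MvPolynomial σ (PowerSeries k)) =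
    PowerSeries.C (algebraMap (MvPolynomial σ k) R (X i)) := by
  rw [toRatSeries_apply, toSeries_X, PowerSeries.map_C]

theorem toRatSeries_C (a : PowerSeries k) : toRatSeries R (C a : MvPolynomial σ (PowerSeries k)) =
    PowerSeries.map ((algebraMap (MvPolynomial σ k) R).comp C) a := by
  rw [toRatSeries_apply, toSeries_C, PowerSeries.map_comp, RingHom.comp_apply]

variable [IsFractionRing (MvPolynomial σ k) R]

theorem X_pow_dvd_toRatSeries_iff {m : ℕ} {f : MvPolynomial σ (PowerSeries k)} :
    PowerSeries.X ^ m ∣ toRatSeries R f ↔ C (PowerSeries.X ^ m) ∣ f := by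
  rw [toRatSeries_apply, X_pow_dvd_map_iff (IsFractionRing.injective _ _), X_pow_dvd_toSeries_iff]

theorem isUnit_toRatSeries {f : MvPolynomial σ (PowerSeries k)}
    (hf : map PowerSeries.constantCoeff f ≠ 0) : IsUnit (toRatSeries R f) := by
  rw [PowerSeries.isUnit_iff_constantCoeff, isUnit_iff_ne_zero, toRatSeries_apply,
    ← PowerSeries.coeff_zero_eq_constantCoeff_apply, PowerSeries.coeff_map,
    PowerSeries.coeff_zero_eq_constantCoeff_apply, constantCoeff_toSeries]
  exact (map_ne_zero_iff _ (IsFractionRing.injective _ _)).2 hf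

variable [Algebra k R] [IsScalarTower k (MvPolynomial σ k) R]

variable (k) in
/-- The partial derivative `∂_i` of rational functions. -/
noncomputable def ratDeriv (i : σ) : Derivation k R R :=
  localizedDerivation R (nonZeroDivisors (MvPolynomial σ k)) (pderiv i)

theorem coeffwise_ratDeriv_toRatSeries (i : σ) (f : MvPolynomial σ (PowerSeries k)) :
    coeffwise (ratDeriv k R i) (toRatSeries R f) = toRatSeries R (pderiv i f) := by
  rw [toRatSeries_apply, toRatSeries_apply, toSeries_pderiv]
  exact coeffwise_map (localizedDerivation_algebraMap R _ (pderiv i)) _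

end RationalSeries

theorem derivation_mul_sq_of_mul_eq {k O : Type*} [CommRing k] [CommRing O] [Algebra k O]
    (D : Derivation k O O) {u p q : O} (h : u * q = p) : D u * q ^ 2 = D p * q - p * D q := by
  rw [← h, Derivation.leibniz, smul_eq_mul, smul_eq_mul]
  ring

instance charZero_powerSeries {k : Type*} [Semiring k] [CharZero k] : CharZero (PowerSeries k) :=
  charZero_of_injective_ringHom PowerSeries.C_injective

section Weight

variable {N : ℕ} {k : Type*} [CommRing k] (R : Type*) [Field R] [Algebra (MvPolynomial (Fin N) k) R]

variable (k) in
/-- The coefficient `∑ j ≠ i, x_i ^ 2 / (x_i - x_j)` of `∂_i` in the Laplace–Beltrami operator. -/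
noncomputable def weight (i : Fin N) : R :=
  ∑ j ∈ univ.erase i, algebraMap (MvPolynomial (Fin N) k) R (X i) ^ 2 *
    (algebraMap (MvPolynomial (Fin N) k) R (X i) - algebraMap (MvPolynomial (Fin N) k) R (X j))⁻¹

variable [IsDomain k] [CharZero k] [IsFractionRing (MvPolynomial (Fin N) k) R]

theorem sum_weight_mul_toRatSeries_pderiv {f : MvPolynomial (Fin N) (PowerSeries k)}
    (hf : f.IsSymmetric) :
    ∑ i : Fin N, PowerSeries.C (weight k R i) * toRatSeries R (pderiv i f) =
      toRatSeries R (firstOrderOp f) := by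
  rw [← sum_mul_map_pderiv_eq_map_firstOrderOp (toRatSeries R) (c := fun i j => PowerSeries.C
    (algebraMap (MvPolynomial (Fin N) k) R (X i) -
      algebraMap (MvPolynomial (Fin N) k) R (X j))⁻¹) ?_ hf]
  · simp only [weight, map_sum, map_mul, map_pow, sum_mul, toRatSeries_X]
  · intro i j hij
    rw [toRatSeries_X, toRatSeries_X, ← map_sub, ← map_sub,
      ← map_sub, ← map_mul, inv_mul_cancel₀, map_one]
    exact (map_ne_zero_iff _ (IsFractionRing.injective _ _)).2 (X_sub_X_ne_zero hij)

variable [Algebra k R] [IsScalarTower k (MvPolynomial (Fin N) k) R]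

theorem sum_weight_mul_ratDeriv_mul_sq {f g : MvPolynomial (Fin N) (PowerSeries k)}
    (hf : f.IsSymmetric) (hg : g.IsSymmetric) {u : PowerSeries R}
    (hu : u * toRatSeries R g = toRatSeries R f) :
    (∑ i : Fin N, PowerSeries.C (weight k R i) * coeffwise (ratDeriv k R i) u) *
        toRatSeries R g ^ 2 =
      toRatSeries R (firstOrderOp f * g - f * firstOrderOp g) := by
  rw [map_sub, map_mul, map_mul, ← sum_weight_mul_toRatSeries_pderiv R hf,
    ← sum_weight_mul_toRatSeries_pderiv R hg, sum_mul, sum_mul, mul_sum, ← sum_sub_distrib]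
  refine sum_congr rfl fun i _ => ?_
  rw [mul_assoc, derivation_mul_sq_of_mul_eq _ hu, coeffwise_ratDeriv_toRatSeries,
    coeffwise_ratDeriv_toRatSeries]
  ring

end Weight

section Rigidity

variable {N : ℕ} {k : Type*} [CommRing k]

theorem firstOrderOp_mul_sub_mul_firstOrderOp {f g h : MvPolynomial (Fin N) k} {c : k}
    (hf : f - g = C c * h) :
    firstOrderOp f * g - f * firstOrderOp g =
      C c * (firstOrderOp h * g - h * firstOrderOp g) := by
  have firstOrderOp_eq : firstOrderOp f = firstOrderOp g + C c * firstOrderOp h := by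
    rw [sub_eq_iff_eq_add'.1 hf]
    simp only [firstOrderOp, map_add, ← smul_eq_C_mul, map_smul, sum_add_distrib, smul_sum]
  rw [firstOrderOp_eq, sub_eq_iff_eq_add'.1 hf]
  ring

variable [IsDomain k]

theorem isSymmetric_of_C_mul_isSymmetric {σ : Type*} {c : k} (hc : c ≠ 0) {f : MvPolynomial σ k}
    (hf : (C c * f).IsSymmetric) : f.IsSymmetric := fun s =>
  mul_left_cancel₀ (C_ne_zero.2 hc) <| by rw [← hf s, map_mul, rename_C]

variable [CharZero k] {lam : IntPartition} {f g : MvPolynomial (Fin N) k}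

theorem eq_zero_of_isBelow_of_firstOrderOp_eq (hlam : lam.length ≤ N) (hf : f.IsSymmetric)
    (isBelow : IsBelow lam f) (hlead : coeff (exponent N lam.1) f = 0)
    (hop : firstOrderOp f = C (eigenZero N lam : k) * f) : f = 0 := by
  refine eq_zero_of_firstOrderOp_eq hf _ hop fun nu hnu hne => ?_
  refine ((isBelow _ hne).eigenZero_lt hnu hlam ?_).ne
  rintro rfl
  exact hne hlead

theorem C_X_pow_succ_dvd_sub {f g : MvPolynomial (Fin N) (PowerSeries k)} {m : ℕ}
    (hlam : lam.length ≤ N) (hf : f.IsSymmetric) (hg : g.IsSymmetric) (isBelow_f : IsBelow lam f)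
    (isBelow_g : IsBelow lam g) (hg_ne : map PowerSeries.constantCoeff g ≠ 0)
    (hg_eigen : firstOrderOp (map PowerSeries.constantCoeff g) =
      C (eigenZero N lam : k) * map PowerSeries.constantCoeff g)
    (hlead : PowerSeries.X ^ (m + 1) ∣ coeff (exponent N lam.1) (f - g))
    (hop : C (PowerSeries.X ^ (m + 1)) ∣ firstOrderOp f * g - f * firstOrderOp g)
    (hsub : C (PowerSeries.X ^ m) ∣ f - g) : C (PowerSeries.X ^ (m + 1)) ∣ f - g := by
  obtain ⟨h, hfg⟩ := hsub
  have X_pow_ne_zero : (PowerSeries.X ^ m : PowerSeries k) ≠ 0 :=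
    pow_ne_zero m PowerSeries.X_ne_zero
  have C_X_dvd_iff (p : MvPolynomial (Fin N) (PowerSeries k)) :
      C (PowerSeries.X ^ (m + 1)) ∣ C (PowerSeries.X ^ m) * p ↔
        map PowerSeries.constantCoeff p = 0 := by
    rw [pow_succ, C_mul, mul_dvd_mul_iff_left (C_ne_zero.2 X_pow_ne_zero), C_dvd_iff_dvd_coeff,
      MvPolynomial.ext_iff]
    simp only [PowerSeries.X_dvd_iff, coeff_map, coeff_zero]
  have coeff_sub_eq (e) : coeff e (f - g) = PowerSeries.X ^ m * coeff e h := by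
    rw [hfg, coeff_C_mul]
  have isSymmetric_h : h.IsSymmetric :=
    isSymmetric_of_C_mul_isSymmetric X_pow_ne_zero (hfg ▸ hf.sub hg)
  rw [hfg, C_X_dvd_iff]
  refine eq_zero_of_isBelow_of_firstOrderOp_eq hlam (isSymmetric_h.map _) ?_ ?_ ?_
  · refine fun e he => isBelow_f.sub isBelow_g e ?_
    rw [coeff_sub_eq]
    exact mul_ne_zero X_pow_ne_zero fun h_eq => he (by rw [coeff_map, h_eq, map_zero])
  · rw [coeff_sub_eq, pow_succ, mul_dvd_mul_iff_left X_pow_ne_zero, PowerSeries.X_dvd_iff] at hlead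
    rw [coeff_map, hlead]
  · rw [firstOrderOp_mul_sub_mul_firstOrderOp hfg, C_X_dvd_iff, map_sub, map_mul, map_mul,
      map_firstOrderOp, map_firstOrderOp, hg_eigen, sub_eq_zero] at hop
    exact mul_right_cancel₀ hg_ne (by rw [hop]; ring)

end Rigidity

section ConstantTerm

variable {N : ℕ} {lam : IntPartition}

theorem constantCoeff_hookProd_ne_zero (lam : IntPartition) :
    PowerSeries.constantCoeff (hookProd (PowerSeries.X : PowerSeries ℚ) lam) ≠ 0 := by
  rw [map_hookProd, PowerSeries.constantCoeff_X, hookProd, prod_ne_zero_iff]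
  intro s _
  rw [zero_mul, zero_add]
  positivity

theorem map_constantCoeff_jackPolySeries_ne_zero (h : lam.length ≤ N) :
    map PowerSeries.constantCoeff (jackPolySeries N lam) ≠ 0 :=
  ne_zero_iff.2 ⟨exponent N lam.1, by
    rw [coeff_map, coeff_exponent_jackPolySeries h]
    exact constantCoeff_hookProd_ne_zero lam⟩

theorem firstOrderOp_map_constantCoeff_jackPolySeries (h : lam.length ≤ N) :
    firstOrderOp (map PowerSeries.constantCoeff (jackPolySeries N lam)) =
      C (eigenZero N lam : ℚ) * map PowerSeries.constantCoeff (jackPolySeries N lam) := by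
  have eigen := congrArg (MvPolynomial.map PowerSeries.constantCoeff)
    (laplaceBeltramiOp_jackPolySeries h)
  rw [map_laplaceBeltramiOp, map_mul (MvPolynomial.map _), map_C] at eigen
  simpa [laplaceBeltramiOp] using eigen

end ConstantTerm

section ProductsOfJackPolynomials

variable {κ : Type*} {N : ℕ} {s : Finset κ} {nu : κ → IntPartition}

theorem isSymmetric_prod_jackPolySeries : (∏ a ∈ s, jackPolySeries N (nu a)).IsSymmetric :=
  isSymmetric_prod fun _ _ => isSymmetric_jackPolySeries

variable (h : ∀ a ∈ s, (nu a).length ≤ N)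

include h

theorem isBelow_prod_jackPolySeries : IsBelow (∑ a ∈ s, nu a) (∏ a ∈ s, jackPolySeries N (nu a)) :=
  IsBelow.prod fun a ha => isBelow_jackPolySeries (h a ha)

theorem coeff_exponent_prod_jackPolySeries :
    coeff (exponent N (∑ a ∈ s, nu a).1) (∏ a ∈ s, jackPolySeries N (nu a)) =
      ∏ a ∈ s, hookProd PowerSeries.X (nu a) :=
  (coeff_prod_of_isBelow fun a ha => isBelow_jackPolySeries (h a ha)).trans
    (prod_congr rfl fun a ha => coeff_exponent_jackPolySeries (h a ha))

theorem map_constantCoeff_prod_jackPolySeries_ne_zero :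
    map PowerSeries.constantCoeff (∏ a ∈ s, jackPolySeries N (nu a)) ≠ 0 := by
  rw [map_prod, prod_ne_zero_iff]
  exact fun a ha => map_constantCoeff_jackPolySeries_ne_zero (h a ha)

theorem firstOrderOp_map_constantCoeff_prod_jackPolySeries :
    firstOrderOp (map PowerSeries.constantCoeff (∏ a ∈ s, jackPolySeries N (nu a))) =
      C (eigenZero N (∑ a ∈ s, nu a) : ℚ) *
        map PowerSeries.constantCoeff (∏ a ∈ s, jackPolySeries N (nu a)) := by
  rw [map_prod, eigenZero_sum, Nat.cast_sum]
  exact firstOrderOp_prod (fun _ _ => isSymmetric_jackPolySeries.map _)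
    fun a ha => firstOrderOp_map_constantCoeff_jackPolySeries (h a ha)

end ProductsOfJackPolynomials

section Factorization

variable {ι : Type*} {N : ℕ} {lam : ι → IntPartition} {S : Finset ι}

theorem X_pow_dvd_evenProd_hookProd_sub (lam : ι → IntPartition)
    (hS : S.Nonempty) :
    (PowerSeries.X : PowerSeries ℚ) ^ (#S - 1) ∣
      evenProd S (fun I => hookProd PowerSeries.X (∑ i ∈ I, lam i)) -
        oddProd S fun I => hookProd PowerSeries.X (∑ i ∈ I, lam i) := by
  have isUnit_hookProd (I : Finset ι) :
      IsUnit (hookProd (PowerSeries.X : PowerSeries ℚ) (∑ i ∈ I, lam i)) := by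
    rw [PowerSeries.isUnit_iff_constantCoeff, isUnit_iff_ne_zero]
    exact constantCoeff_hookProd_ne_zero _
  have isUnit_factor (t n : ℕ) :
      IsUnit ((t : PowerSeries ℚ) + 1 + PowerSeries.X * (n : PowerSeries ℚ)) := by
    rw [PowerSeries.isUnit_iff_constantCoeff, isUnit_iff_ne_zero]
    simp only [map_add, map_natCast, map_one, map_mul, PowerSeries.constantCoeff_X, zero_mul,
      add_zero]
    positivity
  exact dvd_altProd_sub_one_iff.1 <| mem_unitsCongrOne.1 <|
    altProd_hookProd_mem_unitsCongrOne (g := fun t n => (isUnit_factor t n).unit)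
      (fun _ _ => rfl) lam hS (H := fun I => (isUnit_hookProd I).unit) fun _ _ => rfl

theorem X_pow_dvd_coeff_evenProd_sub_oddProd (hN : ∀ i, (lam i).length ≤ N)
    (hS : 2 ≤ #S) :
    PowerSeries.X ^ (#S - 1) ∣ coeff (exponent N (oddSum S fun I => ∑ i ∈ I, lam i).1)
      (evenProd S (fun I => jackPolySeries N (∑ i ∈ I, lam i)) -
        oddProd S fun I => jackPolySeries N (∑ i ∈ I, lam i)) := by
  have length_le (I : Finset ι) : (∑ i ∈ I, lam i).length ≤ N := length_sum_le fun i _ => hN i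
  have coeff_oddProd : coeff (exponent N (oddSum S fun I => ∑ i ∈ I, lam i).1)
      (oddProd S fun I => jackPolySeries N (∑ i ∈ I, lam i)) =
        oddProd S fun I => hookProd PowerSeries.X (∑ i ∈ I, lam i) :=
    coeff_exponent_prod_jackPolySeries fun I _ => length_le I
  have coeff_evenProd : coeff (exponent N (evenSum S fun I => ∑ i ∈ I, lam i).1)
      (evenProd S fun I => jackPolySeries N (∑ i ∈ I, lam i)) =
        evenProd S fun I => hookProd PowerSeries.X (∑ i ∈ I, lam i) :=
    coeff_exponent_prod_jackPolySeries fun I _ => length_le I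
  rw [evenSum_sum_eq_oddSum_sum lam hS] at coeff_evenProd
  rw [coeff_sub, coeff_oddProd, coeff_evenProd]
  exact X_pow_dvd_evenProd_hookProd_sub lam (card_pos.1 (by omega))

variable (R : Type*) [Field R] [Algebra (MvPolynomial (Fin N) ℚ) R]
  [IsFractionRing (MvPolynomial (Fin N) ℚ) R] (hN : ∀ i, (lam i).length ≤ N)

/-- The Jack polynomial of the sum of the `lam i` over `I`, as an invertible power series in the
Jack parameter. -/
noncomputable def jackUnit (I : Finset ι) : (PowerSeries R)ˣ :=
  (isUnit_toRatSeries R <| map_constantCoeff_jackPolySeries_ne_zero <|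
    length_sum_le (s := I) fun i _ => hN i).unit

theorem val_jackUnit (I : Finset ι) :
    (jackUnit R hN I : PowerSeries R) = toRatSeries R (jackPolySeries N (∑ i ∈ I, lam i)) :=
  rfl

theorem X_pow_dvd_altProd_jackUnit_iff {m : ℕ} :
    PowerSeries.X ^ m ∣ ((altProd S (jackUnit R hN) : (PowerSeries R)ˣ) : PowerSeries R) - 1 ↔
      C (PowerSeries.X ^ m) ∣ evenProd S (fun I => jackPolySeries N (∑ i ∈ I, lam i)) -
        oddProd S fun I => jackPolySeries N (∑ i ∈ I, lam i) := by
  simp_rw [dvd_altProd_sub_one_iff, val_jackUnit]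
  rw [← map_evenProd, ← map_oddProd, ← map_sub, X_pow_dvd_toRatSeries_iff]

variable [Algebra ℚ R] [IsScalarTower ℚ (MvPolynomial (Fin N) ℚ) R]

theorem laplaceBeltrami_jackUnit (I : Finset ι) :
    ∑ i : Fin N, PowerSeries.C (weight ℚ R i) *
          coeffwise (ratDeriv ℚ R i) (jackUnit R hN I : PowerSeries R) +
        PowerSeries.X * ∑ i, PowerSeries.C (algebraMap (MvPolynomial (Fin N) ℚ) R
          (C (1 / 2) * X i ^ 2)) *
            coeffwise (ratDeriv ℚ R i)
              (coeffwise (ratDeriv ℚ R i) (jackUnit R hN I : PowerSeries R)) =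
      (PowerSeries.X * ((∑ i ∈ I, lam i).b : PowerSeries R) +
        (eigenZero N (∑ i ∈ I, lam i) : PowerSeries R)) * (jackUnit R hN I : PowerSeries R) := by
  have eigen := congrArg (toRatSeries R)
    (laplaceBeltramiOp_jackPolySeries (length_sum_le (s := I) fun i _ => hN i))
  rw [laplaceBeltramiOp, map_add, ← sum_weight_mul_toRatSeries_pderiv R isSymmetric_jackPolySeries]
    at eigen
  simp only [val_jackUnit, coeffwise_ratDeriv_toRatSeries]
  simp only [map_mul, map_add, map_natCast, toRatSeries_C, toRatSeries_X, PowerSeries.map_X,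
    map_sum, map_pow, PowerSeries.map_C, RingHom.comp_apply] at eigen ⊢
  rw [← eigen]
  congr 1
  rw [mul_sum, mul_sum]
  exact sum_congr rfl fun i _ => by ring

theorem C_X_pow_succ_dvd_evenProd_sub_oddProd {m : ℕ} (hm : m < #S - 1)
    (hsub : C (PowerSeries.X ^ m) ∣ evenProd S (fun I => jackPolySeries N (∑ i ∈ I, lam i)) -
      oddProd S fun I => jackPolySeries N (∑ i ∈ I, lam i))
    (hop : PowerSeries.X ^ (m + 1) ∣ ∑ i : Fin N, PowerSeries.C (weight ℚ R i) *
      coeffwise (ratDeriv ℚ R i) ((altProd S (jackUnit R hN) : (PowerSeries R)ˣ) : PowerSeries R)) :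
    C (PowerSeries.X ^ (m + 1)) ∣ evenProd S (fun I => jackPolySeries N (∑ i ∈ I, lam i)) -
      oddProd S fun I => jackPolySeries N (∑ i ∈ I, lam i) := by
  have hS : 2 ≤ #S := by omega
  have length_le (I : Finset ι) : (∑ i ∈ I, lam i).length ≤ N := length_sum_le fun i _ => hN i
  have isBelow_evenProd : IsBelow (oddSum S fun I => ∑ i ∈ I, lam i)
      (evenProd S fun I => jackPolySeries N (∑ i ∈ I, lam i)) := by
    rw [← evenSum_sum_eq_oddSum_sum lam hS]
    exact isBelow_prod_jackPolySeries fun I _ => length_le I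
  have altProd_mul : ((altProd S (jackUnit R hN) : (PowerSeries R)ˣ) : PowerSeries R) *
      toRatSeries R (oddProd S fun I => jackPolySeries N (∑ i ∈ I, lam i)) =
        toRatSeries R (evenProd S fun I => jackPolySeries N (∑ i ∈ I, lam i)) := by
    rw [map_oddProd, map_evenProd]
    exact val_altProd_mul_oddProd S (jackUnit R hN)
  refine C_X_pow_succ_dvd_sub (length_sum_le fun I _ => length_le I)
    isSymmetric_prod_jackPolySeries isSymmetric_prod_jackPolySeries isBelow_evenProd
    (isBelow_prod_jackPolySeries fun I _ => length_le I)
    (map_constantCoeff_prod_jackPolySeries_ne_zero fun I _ => length_le I)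
    (firstOrderOp_map_constantCoeff_prod_jackPolySeries fun I _ => length_le I)
    ((pow_dvd_pow _ hm).trans (X_pow_dvd_coeff_evenProd_sub_oddProd hN hS)) ?_ hsub
  rw [← X_pow_dvd_toRatSeries_iff R]
  exact (hop.mul_right _).trans (sum_weight_mul_ratDeriv_mul_sq R
    isSymmetric_prod_jackPolySeries isSymmetric_prod_jackPolySeries altProd_mul).dvd

theorem X_pow_dvd_altProd_jackUnit_sub_one (hS : S.Nonempty) :
    PowerSeries.X ^ (#S - 1) ∣
      ((altProd S (jackUnit R hN) : (PowerSeries R)ˣ) : PowerSeries R) - 1 := by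
  induction S using Finset.strongInduction with
  | H S ih =>
    suffices h : ∀ m ≤ #S - 1, PowerSeries.X ^ m ∣
        ((altProd S (jackUnit R hN) : (PowerSeries R)ˣ) : PowerSeries R) - 1 from h _ le_rfl
    intro m hm
    induction m with
    | zero => simp only [pow_zero, one_dvd]
    | succ m ihm =>
      have dvd_m := ihm (by omega)
      refine (X_pow_dvd_altProd_jackUnit_iff R hN).2 <| C_X_pow_succ_dvd_evenProd_sub_oddProd R hN
        hm ((X_pow_dvd_altProd_jackUnit_iff R hN).1 dvd_m) ?_
      exact pow_succ_dvd_sum_derivation_altProd (fun i => coeffwise_X _) _ _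
        (fun I _ => laplaceBeltrami_jackUnit R hN I) (X_pow_dvd_altSum_eigenvalue lam N S) ih hm
        dvd_m

theorem C_X_pow_dvd_evenProd_sub_oddProd (hN : ∀ i, (lam i).length ≤ N) :
    C (PowerSeries.X ^ (#S - 1)) ∣ evenProd S (fun I => jackPolySeries N (∑ i ∈ I, lam i)) -
      oddProd S fun I => jackPolySeries N (∑ i ∈ I, lam i) := by
  obtain rfl | hS := S.eq_empty_or_nonempty
  · simp only [card_empty, zero_tsub, pow_zero, C_1, one_dvd]
  · exact (X_pow_dvd_altProd_jackUnit_iff (FractionRing (MvPolynomial (Fin N) ℚ)) hN).1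
      (X_pow_dvd_altProd_jackUnit_sub_one _ hN hS)

end Factorization

section Expansion

variable {R : Type*} [Field R]

theorem toLaurent_C (x : R) :
    toLaurent R (RatFunc.C x) = HahnSeries.ofPowerSeries ℤ R (PowerSeries.C x) := by
  rw [← RatFunc.algebraMap_C, toLaurent_algebraMap, Polynomial.coe_C]

theorem toLaurent_eq_ofPowerSeries_iff {f : RatFunc R} {a : PowerSeries R} :
    toLaurent R f = HahnSeries.ofPowerSeries ℤ R a ↔ (f.num : PowerSeries R) = a * f.denom := by
  have denom_ne_zero : toLaurent R (algebraMap _ _ f.denom) ≠ 0 :=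
    (map_ne_zero _).2 (RatFunc.algebraMap_ne_zero f.denom_ne_zero)
  conv_lhs => rw [← RatFunc.num_div_denom f]
  rw [map_div₀, div_eq_iff denom_ne_zero, toLaurent_algebraMap, toLaurent_algebraMap, ← map_mul]
  exact HahnSeries.ofPowerSeries_injective.eq_iff

theorem denom_eval_zero_ne_zero {f : RatFunc R} (hf : f ∈ regular R) : f.denom.eval 0 ≠ 0 := by
  obtain ⟨a, ha⟩ := mem_regular.1 hf
  intro denom_eval
  have constantCoeff_coe (p : Polynomial R) :
      PowerSeries.constantCoeff (p : PowerSeries R) = p.eval 0 := by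
    rw [← PowerSeries.coeff_zero_eq_constantCoeff_apply, Polynomial.coeff_coe,
      Polynomial.coeff_zero_eq_eval_zero]
  have num_eval : f.num.eval 0 = 0 := by
    rw [← constantCoeff_coe, toLaurent_eq_ofPowerSeries_iff.1 ha.symm, map_mul, constantCoeff_coe,
      denom_eval, mul_zero]
  obtain ⟨u, v, bezout⟩ := f.isCoprime_num_denom
  simpa [num_eval, denom_eval] using congrArg (Polynomial.eval 0) bezout

theorem isBigO_of_X_pow_dvd {f : RatFunc R} {a : PowerSeries R} {n : ℕ} {k : ℤ} (hk : k ≤ n)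
    (hf : toLaurent R f = HahnSeries.ofPowerSeries ℤ R a) (ha : PowerSeries.X ^ n ∣ a) :
    IsBigO f k := by
  obtain ⟨w, rfl⟩ := ha
  obtain ⟨j, hj⟩ := Int.le.dest hk
  have X_ne_zero : (RatFunc.X : RatFunc R) ≠ 0 := RatFunc.X_ne_zero
  have f_eq : toLaurent R f =
      toLaurent R (RatFunc.X ^ n) * HahnSeries.ofPowerSeries ℤ R w := by
    rw [hf, map_mul, map_pow, map_pow, toLaurent_X]
  refine denom_eval_zero_ne_zero (mem_regular.2 ⟨PowerSeries.X ^ j * w, ?_⟩)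
  rw [map_mul (toLaurent R), f_eq, mul_right_comm, ← map_mul, ← zpow_natCast, ← hj,
    ← zpow_add₀ X_ne_zero, add_neg_cancel_comm, zpow_natCast, map_pow, toLaurent_X, ← map_pow,
    ← map_mul]

theorem toLaurent_altProd {ι : Type*} {S : Finset ι} {f : Finset ι → RatFunc R}
    {u : Finset ι → (PowerSeries R)ˣ}
    (h : ∀ I, toLaurent R (f I) = HahnSeries.ofPowerSeries ℤ R (u I)) :
    toLaurent R (∏ I ∈ S.powerset, f I ^ ((-1 : ℤ) ^ #I)) =
      HahnSeries.ofPowerSeries ℤ R (altProd S u : (PowerSeries R)ˣ) := by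
  change _ = ((Units.map (HahnSeries.ofPowerSeries ℤ R : PowerSeries R →* LaurentSeries R)
    (altProd S u) : (LaurentSeries R)ˣ) : LaurentSeries R)
  rw [altProd, map_prod, map_prod, Units.coe_prod]
  refine prod_congr rfl fun I _ => ?_
  rw [map_zpow₀, map_zpow, Units.val_zpow_eq_zpow_val, h]
  rfl

theorem toLaurent_extendScalars [Algebra ℚ R] {q : QAlpha} {a : PowerSeries ℚ}
    (h : toLaurent ℚ q = HahnSeries.ofPowerSeries ℤ ℚ a) :
    toLaurent R (extendScalars R q) =
      HahnSeries.ofPowerSeries ℤ R (PowerSeries.map (algebraMap ℚ R) a) := by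
  have coe_map (p : Polynomial ℚ) : ((p.map (algebraMap ℚ R) : Polynomial R) : PowerSeries R) =
      PowerSeries.map (algebraMap ℚ R) p := by
    ext n
    rw [Polynomial.coeff_coe, Polynomial.coeff_map, PowerSeries.coeff_map, Polynomial.coeff_coe]
  have denom_ne_zero : toLaurent R (algebraMap _ _ (q.denom.map (algebraMap ℚ R))) ≠ 0 :=
    (map_ne_zero _).2 <| RatFunc.algebraMap_ne_zero <|
      (Polynomial.map_ne_zero_iff (algebraMap ℚ R).injective).2 q.denom_ne_zero
  rw [extendScalars, RatFunc.coe_mapRingHom_eq_coe_map, RatFunc.map_apply, map_div₀,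
    Polynomial.coe_mapRingHom, div_eq_iff denom_ne_zero, toLaurent_algebraMap,
    toLaurent_algebraMap, ← map_mul, coe_map, coe_map, toLaurent_eq_ofPowerSeries_iff.1 h, map_mul]

end Expansion

section JackSeries

/-- The Jack symmetric function, expanded at `α = 0`, with `m nu` in place of the monomial
symmetric functions. -/
noncomputable def jackSeries {A : Type*} [CommRing A] [Algebra ℚ A] (m : IntPartition → A)
    (lam : IntPartition) : PowerSeries A :=
  (jackCoeffSeries lam).sum fun nu c => PowerSeries.map (algebraMap ℚ A) c * PowerSeries.C (m nu)

theorem map_jackSeries {A B : Type*} [CommRing A] [Algebra ℚ A] [CommRing B] [Algebra ℚ B]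
    (φ : A →+* B) (m : IntPartition → A) (lam : IntPartition) :
    PowerSeries.map φ (jackSeries m lam) = jackSeries (fun nu => φ (m nu)) lam := by
  rw [jackSeries, Finsupp.sum, map_sum]
  refine sum_congr rfl fun nu _ => ?_
  rw [map_mul, PowerSeries.map_C, ← RingHom.comp_apply (PowerSeries.map φ), ← PowerSeries.map_comp,
    Subsingleton.elim (φ.comp (algebraMap ℚ A)) (algebraMap ℚ B)]

theorem toLaurent_jackIn {R : Type*} [Field R] [Algebra ℚ R] (m : IntPartition → R)
    (lam : IntPartition) :
    toLaurent R (jackIn m lam) = HahnSeries.ofPowerSeries ℤ R (jackSeries m lam) := by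
  classical
  rw [jackIn, jackSeries, Finsupp.sum_of_support_subset _ subset_union_left _ (by simp),
    Finsupp.sum_of_support_subset (jackCoeffSeries lam) subset_union_right _ (by simp), map_sum,
    map_sum]
  refine sum_congr rfl fun nu _ => ?_
  rw [map_mul, map_mul, toLaurent_C,
    toLaurent_extendScalars (ofPowerSeries_jackCoeffSeries lam nu).symm]

theorem isBigO_altProd_jackIn {R : Type*} [Field R] [Algebra ℚ R] {m : IntPartition → R} {r : ℕ}
    {lam : Fin r → IntPartition} (hu : ∀ I : Finset (Fin r), IsUnit (jackSeries m (∑ i ∈ I, lam i)))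
    (hdvd : PowerSeries.X ^ (r - 1) ∣ evenProd univ (fun I => jackSeries m (∑ i ∈ I, lam i)) -
      oddProd univ fun I => jackSeries m (∑ i ∈ I, lam i)) :
    IsBigO ((∏ I : Finset (Fin r), jackIn m (∑ i ∈ I, lam i) ^ ((-1 : ℤ) ^ #I)) - 1)
      ((r : ℤ) - 1) := by
  refine isBigO_of_X_pow_dvd (by omega) ?_
    (dvd_altProd_sub_one_iff (u := fun I => (hu I).unit).2 hdvd)
  rw [map_sub, map_sub, map_one, map_one, ← powerset_univ,
    toLaurent_altProd (u := fun I => (hu I).unit) fun I => toLaurent_jackIn m _]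

end JackSeries

section Polynomials

variable {N : ℕ}

theorem toSeries_map_C {σ k : Type*} [CommRing k] (f : MvPolynomial σ k) :
    toSeries (map PowerSeries.C f) = PowerSeries.C f := by
  ext n e
  rw [coeff_toSeries, coeff_map, PowerSeries.coeff_C, PowerSeries.coeff_C]
  split_ifs
  · rfl
  · rw [coeff_zero]

theorem toSeries_jackPolySeries (lam : IntPartition) :
    toSeries (jackPolySeries N lam) = jackSeries (monomialPoly N ℚ) lam := by
  rw [jackPolySeries, jackSeries, Finsupp.sum, map_sum]
  refine sum_congr rfl fun nu _ => ?_
  rw [map_mul, toSeries_C, ← map_monomialPoly PowerSeries.C, toSeries_map_C, algebraMap_eq]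

theorem constantCoeff_jackSeries_monomialPoly_ne_zero {lam : IntPartition} (h : lam.length ≤ N) :
    PowerSeries.constantCoeff (jackSeries (monomialPoly N ℚ) lam) ≠ 0 := by
  rw [← toSeries_jackPolySeries, constantCoeff_toSeries]
  exact map_constantCoeff_jackPolySeries_ne_zero h

theorem X_pow_dvd_jackSeries_monomialPoly {ι : Type*} {lam : ι → IntPartition}
    (hN : ∀ i, (lam i).length ≤ N) (S : Finset ι) :
    PowerSeries.X ^ (#S - 1) ∣
      evenProd S (fun I => jackSeries (monomialPoly N ℚ) (∑ i ∈ I, lam i)) -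
        oddProd S fun I => jackSeries (monomialPoly N ℚ) (∑ i ∈ I, lam i) := by
  simp_rw [← toSeries_jackPolySeries]
  rw [← map_evenProd, ← map_oddProd, ← map_sub, X_pow_dvd_toSeries_iff]
  exact C_X_pow_dvd_evenProd_sub_oddProd hN

end Polynomials

section SymmetricFunctions

/-- The restriction of symmetric functions to `N` variables. -/
noncomputable def restrict (N : ℕ) : SymmFun →+* MvPowerSeries (Fin N) ℚ :=
  (MvPowerSeries.killCompl (R := ℚ) (Fin.valEmbedding (n := N))).toRingHom.comp
    SymmFun.val.toRingHom

theorem coeff_restrict (N : ℕ) (f : SymmFun) (e : Fin N →₀ ℕ) :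
    MvPowerSeries.coeff e (restrict N f) =
      MvPowerSeries.coeff (e.embDomain Fin.valEmbedding) f.1 :=
  rfl

theorem restrict_monomialSymm (N : ℕ) (nu : IntPartition) :
    restrict N (monomialSymm nu) = coeToMvPowerSeries.ringHom (monomialPoly N ℚ nu) := by
  classical
  ext e
  rw [coeff_restrict, coeToMvPowerSeries.ringHom_apply, coeff_coe, coeff_monomialPoly, monomialSymm,
    coeff_monomialSeries, parts_embDomain]

theorem map_restrict_jackSeries (N : ℕ) (lam : IntPartition) :
    PowerSeries.map (restrict N) (jackSeries monomialSymm lam) =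
      PowerSeries.map coeToMvPowerSeries.ringHom (jackSeries (monomialPoly N ℚ) lam) := by
  simp_rw [map_jackSeries, restrict_monomialSymm]

theorem eq_zero_of_restrict_eq_zero {f : SymmFun} (n : ℕ) (h : ∀ N, n ≤ N → restrict N f = 0) :
    f = 0 := by
  apply Subtype.ext
  ext e
  obtain ⟨M, hM⟩ := e.support.exists_nat_subset_range
  obtain ⟨e, rfl⟩ : e ∈ Set.range (Finsupp.embDomain (Fin.valEmbedding (n := max n M))) := by
    rw [Finsupp.mem_range_embDomain_iff]
    exact fun i hi => ⟨⟨i, (mem_range.1 (hM hi)).trans_le (le_max_right n M)⟩, rfl⟩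
  rw [← coeff_restrict, h _ (le_max_left n M)]
  rfl

theorem X_pow_dvd_of_forall_map_restrict {f : PowerSeries SymmFun} {m : ℕ} (n : ℕ)
    (h : ∀ N, n ≤ N → PowerSeries.X ^ m ∣ PowerSeries.map (restrict N) f) :
    PowerSeries.X ^ m ∣ f :=
  PowerSeries.X_pow_dvd_iff.2 fun k hk => eq_zero_of_restrict_eq_zero n fun N hN => by
    rw [← PowerSeries.coeff_map, PowerSeries.X_pow_dvd_iff.1 (h N hN) k hk]

theorem constantCoeff_jackSeries_monomialSymm_ne_zero (lam : IntPartition) :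
    PowerSeries.constantCoeff (jackSeries monomialSymm lam) ≠ 0 := by
  intro eq_zero
  have map_eq := congrArg (PowerSeries.coeff 0) (map_restrict_jackSeries lam.length lam)
  rw [PowerSeries.coeff_map, PowerSeries.coeff_map, PowerSeries.coeff_zero_eq_constantCoeff_apply,
    PowerSeries.coeff_zero_eq_constantCoeff_apply, eq_zero, map_zero, eq_comm,
    coeToMvPowerSeries.ringHom_apply, coe_eq_zero_iff] at map_eq
  exact constantCoeff_jackSeries_monomialPoly_ne_zero le_rfl map_eq

theorem X_pow_dvd_jackSeries_monomialSymm {ι : Type*} [Finite ι]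
    (lam : ι → IntPartition) (S : Finset ι) :
    PowerSeries.X ^ (#S - 1) ∣
      evenProd S (fun I => jackSeries monomialSymm (∑ i ∈ I, lam i)) -
        oddProd S fun I => jackSeries monomialSymm (∑ i ∈ I, lam i) := by
  cases nonempty_fintype ι
  refine X_pow_dvd_of_forall_map_restrict (univ.sup fun i => (lam i).length) fun N hN => ?_
  have hdvd := map_dvd (PowerSeries.map coeToMvPowerSeries.ringHom)
    (X_pow_dvd_jackSeries_monomialPoly (lam := lam)
      (fun i => (le_sup (f := fun i => (lam i).length) (mem_univ i)).trans hN) S)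
  rw [map_pow, PowerSeries.map_X, map_sub, map_evenProd, map_oddProd] at hdvd
  simpa only [map_sub, map_evenProd, map_oddProd, map_restrict_jackSeries] using hdvd

end SymmetricFunctions

section FieldOfFractions

variable {r : ℕ} {lam : Fin r → IntPartition}

theorem isBigO_altProd_jackIn_algebraMap {A : Type*} [CommRing A] [Algebra ℚ A]
    {m : IntPartition → A} (R : Type*) [Field R] [Algebra ℚ R] [Algebra A R] [IsFractionRing A R]
    (hne : ∀ I, PowerSeries.constantCoeff (jackSeries m (∑ i ∈ I, lam i)) ≠ 0)
    (hdvd : PowerSeries.X ^ (r - 1) ∣ evenProd univ (fun I => jackSeries m (∑ i ∈ I, lam i)) -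
      oddProd univ fun I => jackSeries m (∑ i ∈ I, lam i)) :
    IsBigO ((∏ I : Finset (Fin r), jackIn (fun nu => algebraMap A R (m nu))
      (∑ i ∈ I, lam i) ^ ((-1 : ℤ) ^ #I)) - 1) ((r : ℤ) - 1) := by
  refine isBigO_altProd_jackIn (fun I => ?_) ?_
  · rw [← map_jackSeries, PowerSeries.isUnit_iff_constantCoeff,
      ← PowerSeries.coeff_zero_eq_constantCoeff_apply, PowerSeries.coeff_map, isUnit_iff_ne_zero,
      PowerSeries.coeff_zero_eq_constantCoeff_apply]
    exact (map_ne_zero_iff _ (IsFractionRing.injective _ _)).2 (hne I)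
  · simp_rw [← map_jackSeries]
    rw [← map_evenProd, ← map_oddProd, ← map_sub]
    exact (X_pow_dvd_map_iff (IsFractionRing.injective _ _)).2 hdvd

theorem isBigO_jackPoly {N : ℕ} (hN : ∀ i, (lam i).length ≤ N) :
    IsBigO ((∏ I : Finset (Fin r), jackPoly N (∑ i ∈ I, lam i) ^ ((-1 : ℤ) ^ #I)) - 1)
      ((r : ℤ) - 1) := by
  have hdvd := X_pow_dvd_jackSeries_monomialPoly hN univ
  rw [card_univ, Fintype.card_fin] at hdvd
  exact isBigO_altProd_jackIn_algebraMap _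
    (fun I => constantCoeff_jackSeries_monomialPoly_ne_zero (length_sum_le fun i _ => hN i)) hdvd

theorem isBigO_jackSymm (lam : Fin r → IntPartition) :
    IsBigO ((∏ I : Finset (Fin r), jackSymm (∑ i ∈ I, lam i) ^ ((-1 : ℤ) ^ #I)) - 1)
      ((r : ℤ) - 1) := by
  have hdvd := X_pow_dvd_jackSeries_monomialSymm lam univ
  rw [card_univ, Fintype.card_fin] at hdvd
  exact isBigO_altProd_jackIn_algebraMap _
    (fun I => constantCoeff_jackSeries_monomialSymm_ne_zero _) hdvd

end FieldOfFractions

end Jack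

theorem mainTheorem3 (r : ℕ) (lam : Fin r → Jack.IntPartition) :
    Jack.IsBigO
      ((∏ I : Finset (Fin r), Jack.jackSymm (∑ i ∈ I, lam i) ^ ((-1 : ℤ) ^ I.card)) - 1)
      ((r : ℤ) - 1) ∧
    ∀ N : ℕ, (∀ i, (lam i).length ≤ N) →
      Jack.IsBigO
        ((∏ I : Finset (Fin r), Jack.jackPoly N (∑ i ∈ I, lam i) ^ ((-1 : ℤ) ^ I.card)) - 1)
        ((r : ℤ) - 1) :=
  ⟨Jack.isBigO_jackSymm lam, fun _ hN => Jack.isBigO_jackPoly hN⟩
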